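/- Let $\theta,\rho$ be real constants with $0<\theta<\frac1{200}$, $\rho>32\theta$ and $\rho+4\theta<\frac{11}{54}$. For real $x>1$ put $$\delta=x^{-\theta},\qquad K=\delta^{-1}\log^2x,\qquad \Delta=x^{\rho},\qquad D=\frac{x^{1/2}}{\Delta K^4}.$$ A positive integer $d$ is called well-separable of level $D$ if for all real $H,S\ge1$ with $HS=D$ there are positive integers $h\le H$, $s\le S$ with $d=hs$. Write $e(y)=e^{2\pi iy}$, let $\tau(d)$ be the number of positive divisors of $d$ and $\Lambda$ the von Mangoldt function, and let $n\sim x$ mean $x/2\le n<x$. Theorem. For all real $A,B$ and all $\varepsilon>0$ there are constants $C$ and $x_0$, depending only on $\theta,\rho,A,B,\varepsilon$, such that the following holds for every real $x\ge x_0$. Let $\alpha$ be irrational and $\beta$ real, let $a,b$ be integers and $q\ge1$ an integer with $\gcd(a,q)=1$ and $\left|\alpha-\frac aq\right|<\frac1{q^2}$. Let $\lambda(d)$ $(1\le d\le D)$ be complex numbers with $|\lambda(d)|\le A\,\tau(d)$ such that $\lambda(d)\ne0$ only if $d$ is well-separable of level $D$, and let $c(k)$ $(0<|k|\le K)$ be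 complex numbers with $|c(k)|\le B$. Then the sum $$W=\sum_{d\le D}\lambda(d)\sum_{1\le|k|\le K}c(k)\sum_{\substack{n\sim x\\ n\equiv b\,(\mathrm{mod}\ d)}}e\big((\alpha n^2+\beta)k\big)\Lambda(n)$$ satisfies $$|W|\le C\,x^{\varepsilon}\left(\frac{xK}{\Delta^{1/32}}+\frac{xK}{q^{1/32}}+x^{15/16}K^{31/32}q^{1/32}+\frac{x\Delta^{1/2}K}{q^{1/4}}+x^{1/2}\Delta^{1/2}K^{3/4}q^{1/4}\right).$$ -/

import Mathlib

/-- A natural number `d` is well-separable of level `D` if for all real `H, S ≥ 1` with `H * S = D`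
there are natural numbers `h ≤ H` and `s ≤ S` with `d = h * s`. -/
def IsWellSeparable (D : ℝ) (d : ℕ) : Prop :=
  ∀ H S : ℝ, 1 ≤ H → 1 ≤ S → H * S = D →
    ∃ h s : ℕ, (h : ℝ) ≤ H ∧ (s : ℝ) ≤ S ∧ d = h * s

/-- The additive character `e(y) = exp(2πiy)`. -/
noncomputable def expChar (y : ℝ) : ℂ :=
  Complex.exp (2 * (Real.pi : ℂ) * Complex.I * (y : ℂ))

/-- `δ = x^(-θ)`. -/
noncomputable def deltaParam (θ x : ℝ) : ℝ := x ^ (-θ)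

/-- `K = δ⁻¹ log² x`. -/
noncomputable def KParam (θ x : ℝ) : ℝ := (deltaParam θ x)⁻¹ * Real.log x ^ 2

/-- `Δ = x^ρ`. -/
noncomputable def DeltaParam (ρ x : ℝ) : ℝ := x ^ ρ

/-- `D = x^(1/2) / (Δ K⁴)`. -/
noncomputable def DParam (θ ρ x : ℝ) : ℝ :=
  x ^ (1 / 2 : ℝ) / (DeltaParam ρ x * KParam θ x ^ 4)

/-- The natural numbers `n` with `x / 2 ≤ n < x` and `n ≡ b (mod d)`. -/
noncomputable def dyadicProgression (x : ℝ) (b : ℤ) (d : ℕ) : Finset ℕ :=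
  open scoped Classical in
  (Finset.range ⌈x⌉₊).filter fun n => x / 2 ≤ (n : ℝ) ∧ (n : ℤ) ≡ b [ZMOD (d : ℤ)]

/-- The nonzero integers `k` with `|k| ≤ K`. -/
noncomputable def nonzeroFrequencies (K : ℝ) : Finset ℤ :=
  (Finset.Icc (-⌊K⌋) ⌊K⌋).filter fun k => k ≠ 0

/-- The sum over `1 ≤ d ≤ D`, `1 ≤ |k| ≤ K` and `n ∼ x`, `n ≡ b (mod d)` of
`λ(d) c(k) e((α n² + β) k) Λ(n)`. -/
noncomputable def WSum (D K x : ℝ) (b : ℤ) (α β : ℝ) (lam : ℕ → ℂ) (c : ℤ → ℂ) : ℂ :=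
  ∑ d ∈ Finset.Icc 1 ⌊D⌋₊, lam d * ∑ k ∈ nonzeroFrequencies K, c k *
    ∑ n ∈ dyadicProgression x b d,
      expChar ((α * (n : ℝ) ^ 2 + β) * (k : ℝ)) * ((ArithmeticFunction.vonMangoldt n : ℝ) : ℂ)

/-! Put r = Δ^{1/32}. The whole estimate reduces to a dichotomy on q. If q < r^48 or r^48 q > K x²,
the trivial bound of size K x, up to divisor and logarithm factors, is already below the sum of the
last two terms (`DivBound.norm_WSum_le`, `le_add_of_not_minor`). Otherwise `MinorArc.norm_WSum_le`
proves |W| ≪ L^9 K x / r, which is the first term of the bound. Here L is a small power of x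
dominating divisor functions, logarithms and all coefficients.

On the minor arc, moduli not coprime to b see only prime powers of primes dividing d and are
negligible. For the others, Vaughan's identity at V = x^{1/4} gives Type I and Type II sums. In Type
I the smooth variable runs through a progression modulo d, so the phase is quadratic with leading
coefficient α (n d)² k, and one Weyl differencing step leaves an average of `geomBound` over α y U²,
where U = n d.

In Type II, with n ∼ N the shorter variable, well-separability provides a factorization d = h s with
h as large as the diagonal allows (h r² ≤ N). Cauchy–Schwarz keeps k, h, m outside and s, n inside.
Opening the square forces n₁ ≡ n₂ (mod h), because both congruences involve the same invertible m.
Writing n₁ - n₂ = h j, n₁ + n₂ = n and w = lcm(s₁, s₂), the variable m runs through one class modulo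
h w, and the phase has leading coefficient α (h w)² · h j n k. Differencing in m with shift l
therefore leads to averages of `geomBound` over α y h³ w² with y = 2 j n k l.

These averages are the core: `sum_sum_geomBound_square_le` for α y w² and
`sum_geomBound_cube_square_le` for α y h³ w². By Fejér kernels (`sum_geomBound_le_sum_norm`),
closeness to integers is controlled by exponential sums. Weyl differencing turns these into sums of
`geomBound` along multiples α z, where the spacing of α z for a denominator q applies
(`HasApprox.sum_geomBound_le`). With P = r^16, the conditions P³ ≤ q and P³ q ≤ K x² give a saving
of P for squares. The cubic variable needs a fourth power and leaves P^{1/4} = r^4. Two further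
applications of Cauchy–Schwarz take square roots and leave r, which explains the exponent 1/32. When
h is below r^16 the cubic variable is too short; then all of d is treated as s, and the square
average suffices. -/

open Finset

/-! ### Distance to integers, geometric sums and Weyl differencing. -/

/-- Distance to the nearest integer. -/
noncomputable def distInt (θ : ℝ) : ℝ := |θ - round θ|

/-- A smoothed version of `min T (1 / ‖θ‖)`. -/
noncomputable def geomBound (T : ℕ) (θ : ℝ) : ℝ := 1 / (1 / (T : ℝ) + distInt θ)

lemma distInt_nonneg (θ : ℝ) : 0 ≤ distInt θ := abs_nonneg _

lemma distInt_le (θ : ℝ) (z : ℤ) : distInt θ ≤ |θ - z| := round_le θ z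

lemma distInt_neg (θ : ℝ) : distInt (-θ) = distInt θ := by
  apply le_antisymm
  · refine (distInt_le (-θ) (-round θ)).trans_eq ?_
    rw [distInt, ← abs_neg]; push_cast; ring_nf
  · refine (distInt_le θ (-round (-θ))).trans_eq ?_
    rw [distInt, ← abs_neg]; push_cast; ring_nf

lemma geomBound_nonneg (T : ℕ) (θ : ℝ) : 0 ≤ geomBound T θ := by
  have := distInt_nonneg θ
  unfold geomBound; positivity

lemma geomBound_neg (T : ℕ) (θ : ℝ) : geomBound T (-θ) = geomBound T θ := by
  rw [geomBound, geomBound, distInt_neg]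

lemma geomBound_le {T : ℕ} (hT : 1 ≤ T) (θ : ℝ) : geomBound T θ ≤ T := by
  have h := distInt_nonneg θ
  have hT' : (0 : ℝ) < T := by exact_mod_cast hT
  unfold geomBound
  rw [div_le_iff₀ (by positivity)]
  have : (T : ℝ) * (1 / T) = 1 := by field_simp
  nlinarith

lemma norm_expChar (y : ℝ) : ‖expChar y‖ = 1 := by
  have : expChar y = Complex.exp ((2 * Real.pi * y : ℝ) * Complex.I) := by
    unfold expChar; push_cast; ring_nf
  rw [this, Complex.norm_exp_ofReal_mul_I]

lemma expChar_add (x y : ℝ) : expChar (x + y) = expChar x * expChar y := by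
  unfold expChar; rw [← Complex.exp_add]; push_cast; ring_nf

lemma expChar_zero : expChar 0 = 1 := by simp [expChar]

lemma expChar_int (n : ℤ) : expChar n = 1 := by
  unfold expChar
  rw [Complex.exp_eq_one_iff]
  exact ⟨n, by push_cast; ring⟩

lemma star_expChar (y : ℝ) : (starRingEnd ℂ) (expChar y) = expChar (-y) := by
  unfold expChar
  rw [← Complex.exp_conj]
  simp [Complex.conj_ofReal, map_ofNat]

lemma expChar_nat_mul (t : ℕ) (y : ℝ) : expChar (t * y) = expChar y ^ t := by
  unfold expChar
  rw [← Complex.exp_nat_mul]; push_cast; ring_nf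

lemma expChar_sub_int (y : ℝ) (n : ℤ) : expChar (y - n) = expChar y := by
  have : y = (y - n) + n := by ring
  conv_rhs => rw [this, expChar_add, expChar_int, mul_one]

/-- `‖e(θ) - 1‖ ≥ 4‖θ‖`. -/
lemma norm_expChar_sub_one (θ : ℝ) : 4 * distInt θ ≤ ‖expChar θ - 1‖ := by
  have h1 : expChar θ = expChar (θ - round θ) := (expChar_sub_int _ _).symm
  have h2 : expChar (θ - round θ) =
      Complex.exp (Complex.I * (2 * Real.pi * (θ - round θ) : ℝ)) := by
    unfold expChar; push_cast; ring_nf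
  rw [h1, h2, Complex.norm_exp_I_mul_ofReal_sub_one]
  have h3 : ‖2 * Real.sin (2 * Real.pi * (θ - round θ) / 2)‖
      = 2 * |Real.sin (Real.pi * (θ - round θ))| := by
    rw [norm_mul]; simp only [Real.norm_eq_abs]; norm_num; congr 2; ring
  rw [h3]
  have h4 := abs_sub_round θ
  have h5 : 2 / Real.pi * |Real.pi * (θ - round θ)| ≤ |Real.sin (Real.pi * (θ - round θ))| := by
    apply Real.mul_abs_le_abs_sin
    rw [abs_mul, abs_of_pos Real.pi_pos]
    nlinarith [Real.pi_pos]
  rw [abs_mul, abs_of_pos Real.pi_pos] at h5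
  have h6 : 2 / Real.pi * (Real.pi * |θ - round θ|) = 2 * |θ - round θ| := by
    field_simp
  unfold distInt
  linarith

/-- The modulus is at most T trivially and at most 1/(2‖θ‖) by the geometric series; adding the two
inequalities in multiplied-out form gives the smoothed minimum. Allowing every N ≤ T makes the bound
uniform over incomplete sums. -/
lemma norm_sum_expChar_range (N T : ℕ) (h : N ≤ T) (θ c : ℝ) :
    ‖∑ t ∈ range N, expChar (θ * t + c)‖ ≤ 2 * geomBound T θ := by
  rcases Nat.eq_zero_or_pos N with rfl | hN
  · simp [geomBound_nonneg]
  have hT : (0 : ℝ) < T := by exact_mod_cast hN.trans_le h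
  have hd := distInt_nonneg θ
  have h1 : ∑ t ∈ range N, expChar (θ * t + c) = (∑ t ∈ range N, expChar θ ^ t) * expChar c := by
    rw [sum_mul]; refine sum_congr rfl fun t _ => ?_
    rw [expChar_add, mul_comm θ, expChar_nat_mul]
  rw [h1, norm_mul, norm_expChar, mul_one]
  have hA : ‖∑ t ∈ range N, expChar θ ^ t‖ ≤ T := by
    refine (norm_sum_le _ _).trans ?_
    simp only [norm_pow, norm_expChar, one_pow, sum_const, card_range, nsmul_eq_mul, mul_one]
    exact_mod_cast h
  have hB : ‖∑ t ∈ range N, expChar θ ^ t‖ * (4 * distInt θ) ≤ 2 := by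
    have h2 : (∑ t ∈ range N, expChar θ ^ t) * (expChar θ - 1) = expChar θ ^ N - 1 :=
      geom_sum_mul _ _
    calc _ ≤ ‖∑ t ∈ range N, expChar θ ^ t‖ * ‖expChar θ - 1‖ := by
          gcongr; exact norm_expChar_sub_one θ
      _ = ‖expChar θ ^ N - 1‖ := by rw [← norm_mul, h2]
      _ ≤ ‖expChar θ ^ N‖ + ‖(1 : ℂ)‖ := norm_sub_le _ _
      _ = 2 := by rw [norm_pow, norm_expChar]; norm_num
  unfold geomBound
  rw [← mul_div_assoc, le_div_iff₀ (by positivity), mul_add]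
  have h3 : ‖∑ t ∈ range N, expChar θ ^ t‖ * (1 / T) ≤ 1 := by
    rw [mul_one_div, div_le_one hT]; exact hA
  linarith

/-- Pairs are sorted by their difference: the diagonal, then both orders for each shift l. -/
lemma sum_range_sum_range_eq_differences {M : Type*} [AddCommMonoid M] (G : ℕ → ℕ → M) (N : ℕ) :
    ∑ s ∈ range N, ∑ t ∈ range N, G s t = ∑ t ∈ range N, G t t +
      ∑ l ∈ Ico 1 N, ∑ t ∈ range (N - l), (G (t + l) t + G t (t + l)) := by
  induction N with
  | zero => simp
  | succ N ih =>
    have h1 : ∑ l ∈ Ico 1 (N + 1), ∑ t ∈ range (N + 1 - l), (G (t + l) t + G t (t + l)) =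
        ∑ l ∈ Ico 1 N, ∑ t ∈ range (N - l), (G (t + l) t + G t (t + l)) +
        ∑ t ∈ range N, (G N t + G t N) := by
      have h2 : ∀ l ∈ Ico 1 (N + 1), ∑ t ∈ range (N + 1 - l), (G (t + l) t + G t (t + l)) =
          ∑ t ∈ range (N - l), (G (t + l) t + G t (t + l)) + (G N (N - l) + G (N - l) N) := by
        intro l hl
        rw [mem_Ico] at hl
        rw [show N + 1 - l = (N - l) + 1 by omega, sum_range_succ,
          show N - l + l = N by omega]
      rw [sum_congr rfl h2, sum_add_distrib]
      congr 1
      · rcases Nat.eq_zero_or_pos N with rfl | hN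
        · simp
        · rw [sum_Ico_succ_top (by omega)]; simp
      · rw [← sum_range_reflect, sum_Ico_eq_sum_range]
        refine sum_congr (by simp) fun t ht => ?_
        rw [show N - 1 - t = N - (1 + t) by omega]
    rw [h1, sum_range_succ, sum_range_succ (fun t => G t t), sum_range_succ (G N)]
    simp_rw [sum_range_succ (G _)]
    rw [sum_add_distrib, sum_add_distrib, ih]
    abel

/-- Differencing inequality. -/
lemma norm_sum_sq_le_differences (f : ℕ → ℝ) (N : ℕ) :
    ‖∑ t ∈ range N, expChar (f t)‖ ^ 2 ≤
      N + 2 * ∑ l ∈ Ico 1 N, ‖∑ t ∈ range (N - l), expChar (f (t + l) - f t)‖ := by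
  have h1 : ((‖∑ t ∈ range N, expChar (f t)‖ ^ 2 : ℝ) : ℂ) =
      ∑ s ∈ range N, ∑ t ∈ range N, expChar (f s - f t) := by
    rw [Complex.ofReal_pow, ← Complex.mul_conj', map_sum, sum_mul_sum]
    simp_rw [star_expChar, ← expChar_add, ← sub_eq_add_neg]
  have h2 : ‖∑ t ∈ range N, expChar (f t)‖ ^ 2 =
      ‖∑ s ∈ range N, ∑ t ∈ range N, expChar (f s - f t)‖ := by
    rw [← h1, Complex.norm_real, Real.norm_of_nonneg (by positivity)]
  rw [h2, sum_range_sum_range_eq_differences]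
  refine (norm_add_le _ _).trans ?_
  gcongr
  · simp [expChar_zero]
  · refine (norm_sum_le _ _).trans ?_
    rw [mul_sum]
    refine sum_le_sum fun l _ => ?_
    rw [sum_add_distrib]
    refine (norm_add_le _ _).trans ?_
    have : ‖∑ t ∈ range (N - l), expChar (f t - f (t + l))‖ =
        ‖∑ t ∈ range (N - l), expChar (f (t + l) - f t)‖ := by
      rw [← Complex.norm_conj, map_sum]
      simp_rw [star_expChar, neg_sub]
    linarith

/-- After one differencing the phase is linear in t with slope 2Al; the lower coefficients only
enter the constant term, so the bound depends on A alone. -/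
lemma norm_sum_quadratic_sq_le (N T : ℕ) (h : N ≤ T) (A B C : ℝ) :
    ‖∑ t ∈ range N, expChar (A * t ^ 2 + B * t + C)‖ ^ 2 ≤
      T + 4 * ∑ l ∈ Ico 1 T, geomBound T (2 * A * l) := by
  refine (norm_sum_sq_le_differences _ N).trans ?_
  have h1 : ∀ l ∈ Ico 1 N, ‖∑ t ∈ range (N - l), expChar ((A * ((t + l : ℕ) : ℝ) ^ 2 +
      B * ((t + l : ℕ) : ℝ) + C) - (A * t ^ 2 + B * t + C))‖ ≤ 2 * geomBound T (2 * A * l) := by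
    intro l _
    convert norm_sum_expChar_range (N - l) T (by omega) (2 * A * l) (A * l ^ 2 + B * l) using 4
    push_cast; ring_nf
  have h2 : ∑ l ∈ Ico 1 N, geomBound T (2 * A * l) ≤ ∑ l ∈ Ico 1 T, geomBound T (2 * A * l) :=
    sum_le_sum_of_subset_of_nonneg (Ico_subset_Ico_right h) fun _ _ _ => geomBound_nonneg _ _
  have h3 := sum_le_sum h1
  rw [← mul_sum] at h3
  have h4 : (N : ℝ) ≤ T := by exact_mod_cast h
  linarith

/-- Differencing by l gives a quadratic with leading coefficient 3Al, and differencing again by j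
gives slope 6Alj. Cauchy–Schwarz over l between the two steps accounts for the fourth power. -/
lemma norm_sum_cubic_pow_four_le (H : ℕ) (A : ℝ) :
    ‖∑ t ∈ range H, expChar (A * ((t + 1 : ℕ) : ℝ) ^ 3)‖ ^ 4 ≤
      10 * (H : ℝ) ^ 3 + 32 * H * ∑ l ∈ Ico 1 H, ∑ j ∈ Ico 1 H, geomBound H (6 * A * (l * j)) := by
  set E := fun l : ℕ => ‖∑ t ∈ range (H - l), expChar (A * ((t + l + 1 : ℕ) : ℝ) ^ 3 -
    A * ((t + 1 : ℕ) : ℝ) ^ 3)‖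
  have h1 : ‖∑ t ∈ range H, expChar (A * ((t + 1 : ℕ) : ℝ) ^ 3)‖ ^ 2 ≤
      H + 2 * ∑ l ∈ Ico 1 H, E l := norm_sum_sq_le_differences _ H
  have h2 : ∀ l ∈ Ico 1 H, E l ^ 2 ≤ H + 4 * ∑ j ∈ Ico 1 H, geomBound H (6 * A * (l * j)) := by
    intro l _
    convert norm_sum_quadratic_sq_le (H - l) H (by omega) (3 * A * l)
      (3 * A * (l ^ 2 + 2 * l)) (A * ((l + 1) ^ 3 - 1)) using 4 with t _ j
    · congr 1; push_cast; ring_nf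
    · ring_nf
  have h3 : (∑ l ∈ Ico 1 H, E l) ^ 2 ≤ H * ∑ l ∈ Ico 1 H, E l ^ 2 := by
    refine sq_sum_le_card_mul_sum_sq.trans ?_
    gcongr
    simp
  have h4 : ∑ l ∈ Ico 1 H, E l ^ 2 ≤ (H : ℝ) * H +
      4 * ∑ l ∈ Ico 1 H, ∑ j ∈ Ico 1 H, geomBound H (6 * A * (l * j)) := by
    refine (sum_le_sum h2).trans ?_
    rw [sum_add_distrib, ← mul_sum]
    gcongr
    simp only [sum_const, Nat.card_Ico, nsmul_eq_mul]
    gcongr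
    simp
  have h5 : 0 ≤ ∑ l ∈ Ico 1 H, E l := sum_nonneg fun _ _ => norm_nonneg _
  rcases Nat.eq_zero_or_pos H with rfl | hH
  · simp
  have hH' : (1 : ℝ) ≤ H := by exact_mod_cast hH
  calc _ = (‖∑ t ∈ range H, expChar (A * ((t + 1 : ℕ) : ℝ) ^ 3)‖ ^ 2) ^ 2 := by ring
    _ ≤ (H + 2 * ∑ l ∈ Ico 1 H, E l) ^ 2 := by gcongr
    _ ≤ 2 * H ^ 2 + 8 * (∑ l ∈ Ico 1 H, E l) ^ 2 := by
      nlinarith [sq_nonneg ((H : ℝ) - 2 * ∑ l ∈ Ico 1 H, E l)]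
    _ ≤ 2 * H ^ 3 + 8 * (H * (H * H +
      4 * ∑ l ∈ Ico 1 H, ∑ j ∈ Ico 1 H, geomBound H (6 * A * (l * j)))) := by
      gcongr
      · norm_num
      · exact h3.trans (by gcongr)
    _ = _ := by ring

/-! ### Bookkeeping of divisor and logarithm factors. -/

/-- The number of divisors, and logarithms, of numbers up to `X` are at most `L`. -/
structure DivBound (X L : ℝ) : Prop where
  one_le : 1 ≤ X
  log_le : 2 * (1 + Real.log X) ≤ L
  card_le : ∀ n : ℕ, n ≠ 0 → (n : ℝ) ≤ X → (n.divisors.card : ℝ) ≤ L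

namespace DivBound

variable {X L : ℝ}

lemma two_le (h : DivBound X L) : 2 ≤ L := by
  have := Real.log_nonneg h.one_le
  linarith [h.log_le]

/-- This counts dyadic blocks. The factor 2 in `log_le` absorbs 1 / log 2. -/
lemma log_two_add_one_le (h : DivBound X L) {T : ℕ} (hT : (T : ℝ) ≤ X) :
    ((Nat.log 2 T : ℕ) : ℝ) + 1 ≤ L := by
  rcases Nat.eq_zero_or_pos T with rfl | hT0
  · simp; linarith [h.two_le]
  have h1 : (1 : ℝ) ≤ T := by exact_mod_cast hT0
  have h2 : (2 : ℝ) ^ Nat.log 2 T ≤ T := by exact_mod_cast Nat.pow_log_le_self 2 hT0.ne'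
  have h3 := Real.log_le_log (by positivity) (h2.trans hT)
  rw [Real.log_pow] at h3
  have h4 := Real.log_two_gt_d9
  have := Real.log_nonneg h.one_le
  have h5 : (0 : ℝ) ≤ Nat.log 2 T := by positivity
  nlinarith [h.log_le]

lemma sum_inv_le (h : DivBound X L) {T : ℕ} (hT : (T : ℝ) ≤ X) :
    ∑ i ∈ Icc 1 T, (1 : ℝ) / i ≤ L := by
  have h1 := harmonic_le_one_add_log T
  have h2 : ((harmonic T : ℚ) : ℝ) = ∑ i ∈ Icc 1 T, (1 : ℝ) / i := by
    rw [harmonic_eq_sum_Icc]; push_cast; simp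
  rw [← h2]
  rcases Nat.eq_zero_or_pos T with rfl | hT0
  · simp; linarith [h.two_le]
  have h3 := Real.log_le_log (by exact_mod_cast hT0) hT
  have := Real.log_nonneg h.one_le
  linarith [h.log_le]

/-- Grouping a double sum according to the product of the variables. -/
lemma sum_sum_mul_le (h : DivBound X L) (A B : ℕ) (hAB : ((A * B : ℕ) : ℝ) ≤ X) (f : ℕ → ℝ)
    (hf : ∀ n, 0 ≤ f n) :
    ∑ a ∈ Icc 1 A, ∑ b ∈ Icc 1 B, f (a * b) ≤ L * ∑ z ∈ Icc 1 (A * B), f z := by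
  rw [← sum_product', mul_sum]
  have hmap : ∀ p ∈ Icc 1 A ×ˢ Icc 1 B, p.1 * p.2 ∈ Icc 1 (A * B) := by
    intro p hp
    simp only [mem_product, mem_Icc] at hp ⊢
    exact ⟨Nat.mul_pos hp.1.1 hp.2.1, Nat.mul_le_mul hp.1.2 hp.2.2⟩
  rw [← sum_fiberwise_of_maps_to hmap]
  refine sum_le_sum fun z hz => ?_
  rw [mem_Icc] at hz
  rw [sum_congr rfl (g := fun _ => f z) fun p hp => by rw [(mem_filter.1 hp).2], sum_const,
    nsmul_eq_mul]
  refine mul_le_mul_of_nonneg_right ?_ (hf z)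
  refine le_trans ?_ (h.card_le z (by omega) (le_trans (by exact_mod_cast hz.2) hAB))
  norm_cast
  -- A pair with product z is determined by its first entry, a divisor of z.
  refine card_le_card_of_injOn Prod.fst ?_ ?_
  · intro p hp
    simp only [coe_filter, mem_product, mem_Icc, Set.mem_ofPred_eq] at hp
    rw [mem_coe, Nat.mem_divisors]
    exact ⟨⟨p.2, hp.2.symm⟩, by omega⟩
  · intro p hp p' hp' hpp
    simp only [coe_filter, mem_product, mem_Icc, Set.mem_ofPred_eq] at hp hp'
    ext1
    · exact hpp
    · have : p.1 * p.2 = p.1 * p'.2 := by rw [hp.2, hpp, hp'.2]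
      exact Nat.eq_of_mul_eq_mul_left (by omega) this

end DivBound

/-! ### From closeness to integers to exponential sums. -/

/-- A point `θ` close to an integer is detected by a Fejer kernel at some dyadic scale. -/
lemma geomBound_le_sum_fejer {T : ℕ} (hT : 1 ≤ T) (θ : ℝ) :
    geomBound T θ ≤ 64 * ∑ j ∈ range (Nat.log 2 T + 1),
      ‖∑ t ∈ range (2 ^ j), expChar (θ * t)‖ ^ 2 / 2 ^ j := by
  have hd := distInt_nonneg θ
  have hT' : (0 : ℝ) < T := by exact_mod_cast hT
  have key : ∀ j ∈ range (Nat.log 2 T + 1), geomBound T θ ≤ 16 * 2 ^ j →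
      distInt θ ≤ 1 / (8 * 2 ^ j) → geomBound T θ ≤ 64 * ∑ j ∈ range (Nat.log 2 T + 1),
      ‖∑ t ∈ range (2 ^ j), expChar (θ * t)‖ ^ 2 / 2 ^ j := by
    intro j hj h1 h2
    have h3 : (2 : ℝ) ^ j / 2 ≤ ‖∑ t ∈ range (2 ^ j), expChar (θ * t)‖ := by
      refine le_trans ?_ (Complex.re_le_norm _)
      rw [Complex.re_sum]
      have h4 : ∀ t ∈ range (2 ^ j), (1 / 2 : ℝ) ≤ (expChar (θ * t)).re := by
        intro t ht
        rw [mem_range] at ht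
        have ht' : (t : ℝ) ≤ 2 ^ j := by exact_mod_cast ht.le
        have h5 : expChar (θ * t) = expChar ((θ - round θ) * t) := by
          rw [← expChar_sub_int (θ * t) (round θ * t)]; congr 1; push_cast; ring
        have h6 : expChar ((θ - round θ) * t) =
            Complex.exp ((2 * Real.pi * ((θ - round θ) * t) : ℝ) * Complex.I) := by
          unfold expChar; push_cast; ring_nf
        rw [h5, h6, Complex.exp_ofReal_mul_I_re, ← Real.cos_abs]
        -- At distance at most 1/(8·2^j) all angles are at most π/4, so every term has real part at
        -- least 1/2 and there is no cancellation.
        have h7 : |2 * Real.pi * ((θ - round θ) * t)| ≤ Real.pi / 3 := by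
          rw [abs_mul, abs_mul, abs_mul]
          have h8 : |θ - round θ| * |(t : ℝ)| ≤ 1 / 8 := by
            rw [Nat.abs_cast]
            calc _ ≤ 1 / (8 * 2 ^ j) * (2 : ℝ) ^ j := by gcongr; exact h2
              _ = 1 / 8 := by field_simp
          rw [abs_of_pos Real.pi_pos, abs_of_pos (by norm_num : (0 : ℝ) < 2)]
          nlinarith [Real.pi_pos]
        rw [← Real.cos_pi_div_three]
        refine Real.cos_le_cos_of_nonneg_of_le_pi (abs_nonneg _) ?_ h7
        linarith [Real.pi_pos]
      refine le_trans ?_ (sum_le_sum h4)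
      simp only [sum_const, card_range, nsmul_eq_mul]
      push_cast
      linarith
    refine h1.trans ?_
    have h9 : (16 : ℝ) * 2 ^ j ≤
        64 * (‖∑ t ∈ range (2 ^ j), expChar (θ * t)‖ ^ 2 / 2 ^ j) := by
      have : ((2 : ℝ) ^ j / 2) ^ 2 / 2 ^ j ≤
          ‖∑ t ∈ range (2 ^ j), expChar (θ * t)‖ ^ 2 / 2 ^ j := by gcongr
      have h10 : ((2 : ℝ) ^ j / 2) ^ 2 / 2 ^ j = 2 ^ j / 4 := by field_simp; norm_num
      rw [h10] at this
      linarith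
    refine h9.trans ?_
    gcongr
    exact single_le_sum (f := fun j => ‖∑ t ∈ range (2 ^ j), expChar (θ * t)‖ ^ 2 / 2 ^ j)
      (fun _ _ => by positivity) hj
  have hlog : (T : ℝ) < 2 ^ (Nat.log 2 T + 1) := by
    exact_mod_cast Nat.lt_pow_succ_log_self (by norm_num) T
  have hinv : 0 < distInt θ → geomBound T θ ≤ 1 / distInt θ := by
    intro h; unfold geomBound
    apply one_div_le_one_div_of_le h
    have : (0 : ℝ) ≤ 1 / T := by positivity
    linarith
  by_cases h0 : distInt θ ≤ 1 / (8 * 2 ^ Nat.log 2 T)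
  · refine key (Nat.log 2 T) (by simp) ?_ h0
    refine (geomBound_le hT θ).trans ?_
    rw [pow_succ] at hlog
    linarith [pow_pos (two_pos : (0 : ℝ) < 2) (Nat.log 2 T)]
  -- Take the first scale at which θ is too far from an integer. Its predecessor j detects θ, and
  -- the failure at j + 1 bounds 1/‖θ‖ by 16·2^j. If scale 0 already fails, then 1/‖θ‖ ≤ 8 and the
  -- kernel at j = 0, which equals 1, suffices.
  · have hex : ∃ j : ℕ, ¬ distInt θ ≤ 1 / (8 * 2 ^ j) := ⟨_, h0⟩
    classical
    have hfs := Nat.find_spec hex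
    have hfm : Nat.find hex ≤ Nat.log 2 T := Nat.find_min' hex h0
    rcases hj : Nat.find hex with _ | j
    · rw [hj] at hfs
      have h1 : geomBound T θ ≤ 8 := by
        refine (hinv ?_).trans ?_
        · refine lt_trans ?_ (not_le.1 hfs); norm_num
        · rw [div_le_iff₀]
          · have := not_le.1 hfs; norm_num at this; linarith
          · refine lt_trans ?_ (not_le.1 hfs); norm_num
      have h2 := single_le_sum (f := fun j => ‖∑ t ∈ range (2 ^ j), expChar (θ * t)‖ ^ 2 / 2 ^ j)
        (fun _ _ => by positivity) (show 0 ∈ range (Nat.log 2 T + 1) by simp)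
      simp only [pow_zero, sum_range_one, norm_expChar, one_pow, div_one] at h2
      linarith
    · rw [hj] at hfs hfm
      have hlt := Nat.find_min hex (m := j) (by omega)
      rw [not_not] at hlt
      refine key j (by simp; omega) ?_ hlt
      have h3 := not_le.1 hfs
      have h4 : (0 : ℝ) < 1 / (8 * 2 ^ (j + 1)) := by positivity
      refine (hinv (h4.trans h3)).trans ?_
      calc _ ≤ 1 / (1 / (8 * (2 : ℝ) ^ (j + 1))) := one_div_le_one_div_of_le h4 h3.le
        _ = 16 * 2 ^ j := by rw [one_div_one_div, pow_succ]; ring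

/-- An inequality of Erdős–Turán type. Opening each Fejér kernel and summing over the points first
leaves the frequencies l < 2^j ≤ T; each occurs for at most 2^j pairs, which the normalization 1/2^j
cancels. -/
lemma sum_geomBound_le_sum_norm {ι : Type*} (s : Finset ι) (θ : ι → ℝ) {T : ℕ} (hT : 1 ≤ T) :
    ∑ i ∈ s, geomBound T (θ i) ≤ 128 * ((Nat.log 2 T : ℕ) + 1) *
      (s.card + ∑ t ∈ Icc 1 T, ‖∑ i ∈ s, expChar (t * θ i)‖) := by
  refine (sum_le_sum fun i _ => geomBound_le_sum_fejer hT (θ i)).trans ?_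
  rw [← mul_sum, sum_comm]
  set B := (s.card : ℝ) + ∑ t ∈ Icc 1 T, ‖∑ i ∈ s, expChar (t * θ i)‖
  have hB : 0 ≤ B := add_nonneg (by positivity) (sum_nonneg fun _ _ => norm_nonneg _)
  have key : ∀ j ∈ range (Nat.log 2 T + 1),
      ∑ i ∈ s, ‖∑ t ∈ range (2 ^ j), expChar (θ i * t)‖ ^ 2 / 2 ^ j ≤ 2 * B := by
    intro j hj
    rw [mem_range] at hj
    have hjT : 2 ^ j ≤ T := (Nat.pow_le_pow_right (by norm_num) (by omega)).trans
      (Nat.pow_log_le_self 2 (by omega))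
    rw [← sum_div, div_le_iff₀ (by positivity)]
    have h1 : ((∑ i ∈ s, ‖∑ t ∈ range (2 ^ j), expChar (θ i * t)‖ ^ 2 : ℝ) : ℂ) =
        ∑ u ∈ range (2 ^ j), ∑ t ∈ range (2 ^ j), ∑ i ∈ s, expChar (θ i * u - θ i * t) := by
      rw [Complex.ofReal_sum]
      have : ∀ i ∈ s, ((‖∑ t ∈ range (2 ^ j), expChar (θ i * t)‖ ^ 2 : ℝ) : ℂ) =
          ∑ u ∈ range (2 ^ j), ∑ t ∈ range (2 ^ j), expChar (θ i * u - θ i * t) := by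
        intro i _
        rw [Complex.ofReal_pow, ← Complex.mul_conj', map_sum, sum_mul_sum]
        simp_rw [star_expChar, ← expChar_add, ← sub_eq_add_neg]
      rw [sum_congr rfl this, sum_comm]
      refine sum_congr rfl fun u _ => sum_comm
    have h2 : ∑ i ∈ s, ‖∑ t ∈ range (2 ^ j), expChar (θ i * t)‖ ^ 2 =
        ‖∑ u ∈ range (2 ^ j), ∑ t ∈ range (2 ^ j), ∑ i ∈ s, expChar (θ i * u - θ i * t)‖ := by
      rw [← h1, Complex.norm_real, Real.norm_of_nonneg (sum_nonneg fun _ _ => by positivity)]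
    rw [h2, sum_range_sum_range_eq_differences]
    refine (norm_add_le _ _).trans ?_
    have h3 : ‖∑ t ∈ range (2 ^ j), ∑ i ∈ s, expChar (θ i * t - θ i * t)‖ ≤ 2 ^ j * s.card := by
      simp [expChar_zero]
    have h4 : ‖∑ l ∈ Ico 1 (2 ^ j), ∑ t ∈ range (2 ^ j - l),
        (∑ i ∈ s, expChar (θ i * ((t + l : ℕ) : ℝ) - θ i * t) +
          ∑ i ∈ s, expChar (θ i * t - θ i * ((t + l : ℕ) : ℝ)))‖ ≤
        ∑ l ∈ Ico (1 : ℕ) (2 ^ j), 2 ^ j * (2 * ‖∑ i ∈ s, expChar ((l : ℕ) * θ i)‖) := by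
      refine (norm_sum_le _ _).trans (sum_le_sum fun l hl => ?_)
      refine (norm_sum_le _ _).trans ?_
      have h5 : ∀ t ∈ range (2 ^ j - l), ‖∑ i ∈ s, expChar (θ i * ((t + l : ℕ) : ℝ) - θ i * t) +
          ∑ i ∈ s, expChar (θ i * t - θ i * ((t + l : ℕ) : ℝ))‖ ≤
          2 * ‖∑ i ∈ s, expChar ((l : ℕ) * θ i)‖ := by
        intro t _
        refine (norm_add_le _ _).trans ?_
        have h6 : ∀ i, θ i * ((t + l : ℕ) : ℝ) - θ i * t = l * θ i := fun i => by push_cast; ring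
        have h7 : ∀ i, θ i * t - θ i * ((t + l : ℕ) : ℝ) = -(l * θ i) := fun i => by
          push_cast; ring
        simp_rw [h6, h7, ← star_expChar, ← map_sum, Complex.norm_conj]
        linarith
      refine (sum_le_sum h5).trans ?_
      rw [sum_const, card_range, nsmul_eq_mul]
      gcongr
      have : 2 ^ j - l ≤ 2 ^ j := Nat.sub_le _ _
      exact_mod_cast this
    have h8 : ∑ l ∈ Ico (1 : ℕ) (2 ^ j), ‖∑ i ∈ s, expChar ((l : ℕ) * θ i)‖ ≤
        ∑ t ∈ Icc 1 T, ‖∑ i ∈ s, expChar (t * θ i)‖ := by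
      refine sum_le_sum_of_subset_of_nonneg ?_ fun _ _ _ => norm_nonneg _
      intro l hl
      rw [mem_Ico] at hl
      rw [mem_Icc]; omega
    rw [← mul_sum, ← mul_sum] at h4
    have h9 : (0 : ℝ) ≤ 2 ^ j := by positivity
    have h10 := mul_le_mul_of_nonneg_left h8 h9
    have h11 : (0 : ℝ) ≤ 2 ^ j * s.card := by positivity
    refine (add_le_add h3 h4).trans ?_
    simp only [B]
    linarith
  have := sum_le_sum key
  rw [sum_const, card_range, nsmul_eq_mul] at this
  push_cast at this
  linarith

/-! ### Spacing of the multiples of α. -/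

/-- `α` has the reduced rational approximation `a / q` with error below `1 / q ^ 2`. -/
def HasApprox (α : ℝ) (q : ℕ) : Prop :=
  1 ≤ q ∧ ∃ a : ℤ, IsCoprime a (q : ℤ) ∧ |α - (a : ℝ) / (q : ℝ)| < 1 / (q : ℝ) ^ 2

/-- For 0 < k ≤ q/2 the fraction ak/q is not an integer, hence is at least 1/q away from every
integer, while replacing it by αk costs at most k/q² ≤ 1/(2q). -/
lemma HasApprox.le_distInt {α : ℝ} {q k : ℕ} (h : HasApprox α q) (hk : 1 ≤ k) (hkq : 2 * k ≤ q) :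
    1 / (2 * (q : ℝ)) ≤ distInt (α * k) := by
  obtain ⟨hq, a, hco, ha⟩ := h
  have hq0 : (0 : ℝ) < q := by exact_mod_cast hq
  set z := round (α * k)
  have h1 : a * k - z * q ≠ 0 := by
    intro h0
    have h2 : (q : ℤ) ∣ a * k := ⟨z, by linarith⟩
    have h3 : (q : ℤ) ∣ k := hco.symm.dvd_of_dvd_mul_left h2
    have h4 := Nat.le_of_dvd hk (Int.natCast_dvd_natCast.1 h3)
    omega
  have h5 : (1 : ℝ) ≤ |(a : ℝ) * k - z * q| := by
    exact_mod_cast Int.one_le_abs h1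
  have h6 : α * k - z = ((a : ℝ) * k - z * q) / q + k * (α - a / q) := by field_simp; ring
  have h7 : |(k : ℝ) * (α - a / q)| ≤ 1 / (2 * q) := by
    rw [abs_mul, Nat.abs_cast]
    have hk' : (k : ℝ) ≤ q / 2 := by
      rw [le_div_iff₀ two_pos]; exact_mod_cast (by omega : k * 2 ≤ q)
    calc _ ≤ (q : ℝ) / 2 * (1 / (q : ℝ) ^ 2) := by gcongr
      _ = 1 / (2 * q) := by field_simp
  have h8 : 1 / (q : ℝ) ≤ |((a : ℝ) * k - z * q) / q| := by
    rw [abs_div, abs_of_pos hq0]; gcongr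
  have h9 : 1 / (q : ℝ) = 1 / (2 * q) + 1 / (2 * q) := by field_simp; norm_num
  have h10 := abs_sub_abs_le_abs_sub (((a : ℝ) * k - z * q) / q) (-(k * (α - a / q)))
  rw [abs_neg, sub_neg_eq_add, ← h6] at h10
  change _ ≤ |α * k - z|
  linarith

/-- In a block of q/2 + 1 consecutive integers the points αz are 1/(2q)-separated modulo 1. So each
cell of width 1/(2q), on either side of 0, holds at most one of them, and the sum is dominated by T
plus a harmonic sum, twice. -/
lemma HasApprox.sum_block_le {α X L : ℝ} {q T : ℕ} (h : HasApprox α q) (hL : DivBound X L)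
    (hqX : (q : ℝ) ≤ X) (hT : 1 ≤ T) (z₀ : ℕ) :
    ∑ j ∈ range (q / 2 + 1), geomBound T (α * ((z₀ + j : ℕ) : ℝ)) ≤ 2 * T + 4 * q * L := by
  have hq0 : (0 : ℝ) < q := by exact_mod_cast h.1
  have hT0 : (0 : ℝ) < T := by exact_mod_cast hT
  set u : ℕ → ℝ := fun j => α * ((z₀ + j : ℕ) : ℝ) - round (α * ((z₀ + j : ℕ) : ℝ))
  have hu : ∀ j, distInt (α * ((z₀ + j : ℕ) : ℝ)) = |u j| := fun j => rfl
  set g : ℕ → ℝ := fun i => if i = 0 then (T : ℝ) else 2 * q * (1 / i)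
  -- The side of 0 together with the cell index. Separation makes this injective on the block.
  set F : ℕ → Bool × ℕ := fun j => (decide (0 ≤ u j), ⌊2 * q * |u j|⌋₊)
  have hg : ∀ i, 0 ≤ g i := by
    intro i; simp only [g]; split_ifs <;> positivity
  have hinj : Set.InjOn F (range (q / 2 + 1) : Finset ℕ) := by
    have key : ∀ i j : ℕ, i < j → j ≤ q / 2 → F i ≠ F j := by
      intro i j hij hj hF
      have h1 := h.le_distInt (k := j - i) (by omega) (by omega)
      have h2 := distInt_le (α * ((j - i : ℕ) : ℝ))
        (round (α * ((z₀ + j : ℕ) : ℝ)) - round (α * ((z₀ + i : ℕ) : ℝ)))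
      have h3 : α * ((j - i : ℕ) : ℝ) - ((round (α * ((z₀ + j : ℕ) : ℝ)) -
          round (α * ((z₀ + i : ℕ) : ℝ)) : ℤ) : ℝ) = u j - u i := by
        simp only [u]; rw [Nat.cast_sub hij.le]; push_cast; ring
      rw [h3] at h2
      simp only [F, Prod.mk.injEq, decide_eq_decide] at hF
      have h4 := Nat.floor_le (show 0 ≤ 2 * (q : ℝ) * |u i| by positivity)
      have h5 := Nat.floor_le (show 0 ≤ 2 * (q : ℝ) * |u j| by positivity)
      have h6 := Nat.lt_floor_add_one (2 * (q : ℝ) * |u i|)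
      have h7 := Nat.lt_floor_add_one (2 * (q : ℝ) * |u j|)
      rw [hF.2] at h4 h6
      have h8 : |u j - u i| = abs (|u j| - |u i|) := by
        by_cases h0 : 0 ≤ u i
        · rw [abs_of_nonneg h0, abs_of_nonneg (hF.1.1 h0)]
        · have h0' : ¬ 0 ≤ u j := fun hh => h0 (hF.1.2 hh)
          rw [abs_of_neg (not_le.1 h0), abs_of_neg (not_le.1 h0'), ← abs_neg]
          congr 1; ring
      have h9 : 2 * (q : ℝ) * |u j - u i| < 1 := by
        rw [h8, ← abs_of_pos (show (0 : ℝ) < 2 * q by positivity), ← abs_mul,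
          abs_lt]
        constructor <;> nlinarith
      have h10 : 1 / (2 * (q : ℝ)) ≤ |u j - u i| := h1.trans h2
      rw [div_le_iff₀ (by positivity)] at h10
      linarith
    intro i hi j hj hF
    simp only [coe_range, Set.mem_Iio] at hi hj
    rcases lt_trichotomy i j with hij | hij | hij
    · exact absurd hF (key i j hij (by omega))
    · exact hij
    · exact absurd hF.symm (key j i hij (by omega))
  have hmaps : ∀ j ∈ range (q / 2 + 1), F j ∈ (univ : Finset Bool) ×ˢ range (q + 1) := by
    intro j _
    simp only [mem_product, mem_univ, true_and, mem_range, F]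
    rw [Nat.lt_succ_iff]
    refine Nat.floor_le_of_le ?_
    have := abs_sub_round (α * ((z₀ + j : ℕ) : ℝ))
    change |u j| ≤ 1 / 2 at this
    nlinarith
  have hle : ∀ j ∈ range (q / 2 + 1), geomBound T (α * ((z₀ + j : ℕ) : ℝ)) ≤ g (F j).2 := by
    intro j _
    simp only [g]
    split_ifs with h0
    · exact geomBound_le hT _
    · have h1 : (1 : ℝ) ≤ ((F j).2 : ℝ) := by exact_mod_cast Nat.one_le_iff_ne_zero.2 h0
      have h2 : ((F j).2 : ℝ) ≤ 2 * q * |u j| := Nat.floor_le (by positivity)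
      unfold geomBound
      rw [hu, mul_one_div]
      rw [div_le_div_iff₀ (by positivity) (by positivity)]
      have : 0 ≤ (2 * (q : ℝ)) * (1 / T) := by positivity
      nlinarith
  calc _ ≤ ∑ j ∈ range (q / 2 + 1), g (F j).2 := sum_le_sum hle
    _ = ∑ p ∈ (range (q / 2 + 1)).image F, g p.2 := by rw [sum_image hinj]
    _ ≤ ∑ p ∈ (univ : Finset Bool) ×ˢ range (q + 1), g p.2 := by
      refine sum_le_sum_of_subset_of_nonneg ?_ fun _ _ _ => hg _
      intro p hp
      obtain ⟨j, hj, rfl⟩ := mem_image.1 hp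
      exact hmaps j hj
    _ = 2 * ∑ i ∈ range (q + 1), g i := by rw [sum_product]; simp
    _ = 2 * (T + 2 * q * ∑ i ∈ Icc 1 q, (1 : ℝ) / i) := by
      rw [sum_range_succ', mul_sum]
      congr 1
      rw [add_comm]
      congr 1
      rw [show Icc 1 q = Ico (0 + 1) (q + 1) by ext; simp only [mem_Icc, mem_Ico]; omega,
        ← sum_Ico_add', ← range_eq_Ico]
      refine sum_congr rfl fun k _ => ?_
      simp only [g, if_neg (Nat.succ_ne_zero k)]
    _ ≤ 2 * (T + 2 * q * L) := by gcongr; exact hL.sum_inv_le hqX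
    _ = _ := by ring

/-- The range is covered by at most 2Z/q + 1 blocks of the previous kind. -/
lemma HasApprox.sum_geomBound_le {α X L : ℝ} {q T : ℕ} (h : HasApprox α q) (hL : DivBound X L)
    (hqX : (q : ℝ) ≤ X) (hT : 1 ≤ T) (Z : ℕ) :
    ∑ z ∈ Icc 1 Z, geomBound T (α * z) ≤ 8 * ((Z : ℝ) / q + 1) * (T + q * L) := by
  have hq0 : (0 : ℝ) < q := by exact_mod_cast h.1
  have hL0 := hL.two_le
  have hblock : ∀ n : ℕ, ∑ z ∈ range (n * (q / 2 + 1)), geomBound T (α * z) ≤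
      n * (2 * T + 4 * q * L) := by
    intro n
    induction n with
    | zero => simp
    | succ n ih =>
      rw [Nat.succ_mul, sum_range_add]
      push_cast
      have := h.sum_block_le hL hqX hT (n * (q / 2 + 1))
      push_cast at this ih
      linarith
  set n := Z / (q / 2 + 1) + 1
  have hn : (n : ℝ) ≤ 2 * (Z / q) + 1 := by
    have h1 : ((Z / (q / 2 + 1) : ℕ) : ℝ) ≤ (Z : ℝ) / ((q / 2 + 1 : ℕ) : ℝ) := Nat.cast_div_le
    have h2 : (q : ℝ) / 2 ≤ ((q / 2 + 1 : ℕ) : ℝ) := by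
      rw [div_le_iff₀ two_pos]; exact_mod_cast (by omega : q ≤ (q / 2 + 1) * 2)
    have h3 : (Z : ℝ) / ((q / 2 + 1 : ℕ) : ℝ) ≤ Z / ((q : ℝ) / 2) := by gcongr
    have h4 : (Z : ℝ) / ((q : ℝ) / 2) = 2 * (Z / q) := by field_simp
    simp only [n]; push_cast; linarith
  calc _ ≤ ∑ z ∈ range (n * (q / 2 + 1)), geomBound T (α * z) := by
        refine sum_le_sum_of_subset_of_nonneg ?_ fun _ _ _ => geomBound_nonneg _ _
        intro z hz
        rw [mem_Icc] at hz
        rw [mem_range]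
        have := Nat.lt_div_mul_add (a := Z) (b := q / 2 + 1) (by omega)
        simp only [n]; rw [Nat.succ_mul]; omega
    _ ≤ n * (2 * T + 4 * q * L) := hblock n
    _ ≤ (2 * (Z / q) + 1) * (2 * T + 4 * q * L) := by gcongr
    _ ≤ (2 * (Z / q + 1)) * (4 * (T + q * L)) := by
      gcongr
      · linarith
      · have : (0 : ℝ) ≤ T := by positivity
        linarith
    _ = _ := by ring

/-! ### Averages of `geomBound` over α y w² and α y h³ w². -/

lemma sum_Icc_comp_le_of_injOn {f : ℕ → ℝ} (hf : ∀ n, 0 ≤ f n) (g : ℕ → ℕ) (A B : ℕ)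
    (hinj : Set.InjOn g (Icc 1 A : Finset ℕ)) (hg : ∀ a ∈ Icc 1 A, g a ∈ Icc 1 B) :
    ∑ a ∈ Icc 1 A, f (g a) ≤ ∑ b ∈ Icc 1 B, f b := by
  rw [← sum_image hinj]
  refine sum_le_sum_of_subset_of_nonneg ?_ fun _ _ _ => hf _
  intro b hb
  obtain ⟨a, ha, rfl⟩ := mem_image.1 hb
  exact hg a ha

lemma sum_Icc_mul_le {f : ℕ → ℝ} (hf : ∀ n, 0 ≤ f n) {k : ℕ} (hk : 1 ≤ k) (A : ℕ) :
    ∑ a ∈ Icc 1 A, f (k * a) ≤ ∑ b ∈ Icc 1 (k * A), f b := by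
  refine sum_Icc_comp_le_of_injOn hf _ A _ ?_ ?_
  · intro a _ b _ h
    exact Nat.eq_of_mul_eq_mul_left hk h
  · intro a ha
    rw [mem_Icc] at ha ⊢
    exact ⟨Nat.mul_pos hk ha.1, Nat.mul_le_mul_left k ha.2⟩

lemma sum_Icc_sq_le {f : ℕ → ℝ} (hf : ∀ n, 0 ≤ f n) (A : ℕ) :
    ∑ a ∈ Icc 1 A, f (a ^ 2) ≤ ∑ b ∈ Icc 1 (A ^ 2), f b := by
  refine sum_Icc_comp_le_of_injOn hf _ A _ ?_ ?_
  · intro a _ b _ h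
    exact Nat.pow_left_injective two_ne_zero h
  · intro a ha
    rw [mem_Icc] at ha ⊢
    exact ⟨Nat.pow_pos ha.1, Nat.pow_le_pow_left ha.2 2⟩

lemma sum_Icc_eq_sum_range_succ {M : Type*} [AddCommMonoid M] (f : ℕ → M) (n : ℕ) :
    ∑ i ∈ Icc 1 n, f i = ∑ i ∈ range n, f (i + 1) := by
  rw [show Icc 1 n = Ico (0 + 1) (n + 1) by ext; simp only [mem_Icc, mem_Ico]; omega,
    ← sum_Ico_add', ← range_eq_Ico]

lemma sum_Ico_geomBound_le_sum_Icc (T W : ℕ) (f : ℕ → ℝ) :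
    ∑ l ∈ Ico 1 W, geomBound T (f l) ≤ ∑ l ∈ Icc 1 W, geomBound T (f l) :=
  sum_le_sum_of_subset_of_nonneg Ico_subset_Icc_self fun _ _ _ => geomBound_nonneg _ _

lemma norm_sum_Icc_square_sq_le (W : ℕ) (A : ℝ) :
    ‖∑ w ∈ Icc 1 W, expChar (A * (w : ℝ) ^ 2)‖ ^ 2 ≤
      W + 4 * ∑ l ∈ Icc 1 W, geomBound W (2 * A * l) := by
  have h := norm_sum_quadratic_sq_le W W le_rfl A (2 * A) A
  have h1 : ∑ w ∈ Icc 1 W, expChar (A * (w : ℝ) ^ 2) =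
      ∑ t ∈ range W, expChar (A * t ^ 2 + 2 * A * t + A) := by
    rw [sum_Icc_eq_sum_range_succ]
    refine sum_congr rfl fun t _ => ?_
    congr 1; push_cast; ring
  rw [h1]
  have := sum_Ico_geomBound_le_sum_Icc W W fun l => 2 * A * l
  linarith

section

variable {X L α P : ℝ} {q : ℕ}

/-- The case of long w. Differencing in w turns the mean square into a sum of `geomBound` over
multiples αz with z = 2tyl. Its main contributions, relative to V = TYW², are V/q, TYW = V/W and q;
each is at most V/P² by P³ ≤ q, P² ≤ W and P³ q ≤ V. Cauchy–Schwarz then saves P. -/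
lemma sum_sum_norm_sum_square_le (hL : DivBound X L) (hα : HasApprox α q) (hqX : (q : ℝ) ≤ X)
    {T Y W : ℕ} (hT : 1 ≤ T) (hY : 1 ≤ Y) (hW : 1 ≤ W)
    (hX : 2 * (T : ℝ) * Y * W ≤ X) (hP : 1 ≤ P) (hPq : P ^ 3 ≤ q)
    (hqP : P ^ 3 * q ≤ T * Y * (W : ℝ) ^ 2) (hPW : P ^ 2 ≤ W) :
    ∑ t ∈ Icc 1 T, ∑ y ∈ Icc 1 Y, ‖∑ w ∈ Icc 1 W, expChar (t * (α * (y * (w : ℝ) ^ 2)))‖ ≤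
      15 * L ^ 2 * (T * Y * W) / P := by
  have hL2 := hL.two_le
  have hT' : (1 : ℝ) ≤ T := by exact_mod_cast hT
  have hY' : (1 : ℝ) ≤ Y := by exact_mod_cast hY
  have hW' : (1 : ℝ) ≤ W := by exact_mod_cast hW
  have hq' : (1 : ℝ) ≤ q := by exact_mod_cast hα.1
  set E : ℕ → ℕ → ℝ := fun t y => ‖∑ w ∈ Icc 1 W, expChar (t * (α * (y * (w : ℝ) ^ 2)))‖
  have h1 : ∀ t y, E t y ^ 2 ≤
      W + 4 * ∑ l ∈ Icc 1 W, geomBound W (α * ((2 * (t * y * l) : ℕ) : ℝ)) := by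
    intro t y
    have h := norm_sum_Icc_square_sq_le W (t * α * y)
    have e1 : ∀ w : ℕ, (t : ℝ) * (α * (y * (w : ℝ) ^ 2)) = t * α * y * (w : ℝ) ^ 2 :=
      fun w => by ring
    have e2 : ∀ l : ℕ, α * ((2 * (t * y * l) : ℕ) : ℝ) = 2 * (t * α * y) * l :=
      fun l => by push_cast; ring
    simp only [E, e1, e2]
    exact h
  have h2 : ∑ t ∈ Icc 1 T, ∑ y ∈ Icc 1 Y, ∑ l ∈ Icc 1 W,
      geomBound W (α * ((2 * (t * y * l) : ℕ) : ℝ)) ≤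
      L ^ 2 * (8 * (((2 * (T * Y * W) : ℕ) : ℝ) / q + 1) * (W + q * L)) := by
    calc _ ≤ L * ∑ z ∈ Icc 1 (T * Y), ∑ l ∈ Icc 1 W,
          geomBound W (α * ((2 * (z * l) : ℕ) : ℝ)) := by
          refine hL.sum_sum_mul_le T Y ?_ (fun z => ∑ l ∈ Icc 1 W,
            geomBound W (α * ((2 * (z * l) : ℕ) : ℝ)))
            (fun _ => sum_nonneg fun _ _ => geomBound_nonneg _ _)
          push_cast
          refine le_trans ?_ hX
          have : 0 ≤ (T : ℝ) * Y := by positivity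
          nlinarith
      _ ≤ L * (L * ∑ z ∈ Icc 1 (T * Y * W), geomBound W (α * ((2 * z : ℕ) : ℝ))) := by
          gcongr
          refine hL.sum_sum_mul_le (T * Y) W ?_ (fun z => geomBound W (α * ((2 * z : ℕ) : ℝ)))
            (fun _ => geomBound_nonneg _ _)
          push_cast
          refine le_trans ?_ hX
          have : 0 ≤ (T : ℝ) * Y * W := by positivity
          nlinarith
      _ ≤ L * (L * ∑ z ∈ Icc 1 (2 * (T * Y * W)), geomBound W (α * z)) := by
          gcongr
          exact sum_Icc_mul_le (f := fun z => geomBound W (α * z))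
            (fun _ => geomBound_nonneg _ _) one_le_two _
      _ ≤ _ := by
          rw [← mul_assoc, ← sq]
          gcongr
          exact hα.sum_geomBound_le hL hqX hW _
  have h3 : ∑ t ∈ Icc 1 T, ∑ y ∈ Icc 1 Y, E t y ^ 2 ≤ T * Y * W +
      4 * (L ^ 2 * (8 * (((2 * (T * Y * W) : ℕ) : ℝ) / q + 1) * (W + q * L))) := by
    refine (sum_le_sum fun t _ => sum_le_sum fun y _ => h1 t y).trans ?_
    simp only [sum_add_distrib, ← mul_sum]
    gcongr
    simp [mul_assoc]
  set V : ℝ := T * Y * W * W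
  have hV0 : 0 < V := by positivity
  have hP0 : 0 < P := by linarith
  have hP2 : 0 < P ^ 2 := by positivity
  have hPP : P ^ 2 ≤ P ^ 3 := by nlinarith
  have hTYW : (T : ℝ) * Y * W ≤ V / P ^ 2 := by
    rw [le_div_iff₀ hP2]; simp only [V]; gcongr
  -- The constant 161 that arises is rounded up to 225 = 15² so that the later square root is exact;
  -- 40⁴, 460² and 913² play the same role further on.
  have h4 : ∑ t ∈ Icc 1 T, ∑ y ∈ Icc 1 Y, E t y ^ 2 ≤ 225 * L ^ 3 * (V / P ^ 2) := by
    have e1 : (((2 * (T * Y * W) : ℕ) : ℝ) / q + 1) * (W + q * L) =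
        2 * (V / q) + 2 * L * (T * Y * W) + W + q * L := by
      simp only [V]; push_cast; field_simp; ring
    have e2 : V / q ≤ V / P ^ 2 := by gcongr; linarith
    have e3 : (W : ℝ) ≤ T * Y * W := by
      have : (1 : ℝ) ≤ T * Y := by nlinarith
      nlinarith
    have e4 : (q : ℝ) ≤ V / P ^ 2 := by
      rw [le_div_iff₀ hP2]
      calc (q : ℝ) * P ^ 2 ≤ q * P ^ 3 := by gcongr
        _ = P ^ 3 * q := by ring
        _ ≤ _ := hqP
        _ = V := by simp only [V]; ring
    have e5 : 0 < V / P ^ 2 := by positivity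
    have e6 : (((2 * (T * Y * W) : ℕ) : ℝ) / q + 1) * (W + q * L) ≤ 5 * L * (V / P ^ 2) := by
      rw [e1]
      have := mul_le_mul_of_nonneg_left hTYW (by linarith : 0 ≤ 2 * L)
      have := mul_le_mul_of_nonneg_right e4 (by linarith : 0 ≤ L)
      nlinarith
    have e7 : 1 ≤ L ^ 3 := by nlinarith [pow_le_pow_left₀ zero_le_two hL2 3]
    calc _ ≤ _ := h3
      _ = T * Y * W + 32 * L ^ 2 *
          ((((2 * (T * Y * W) : ℕ) : ℝ) / q + 1) * (W + q * L)) := by ring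
      _ ≤ L ^ 3 * (V / P ^ 2) + 32 * L ^ 2 * (5 * L * (V / P ^ 2)) := by
          refine add_le_add (hTYW.trans (le_mul_of_one_le_left e5.le e7)) ?_
          gcongr
      _ = 161 * (L ^ 3 * (V / P ^ 2)) := by ring
      _ ≤ 225 * (L ^ 3 * (V / P ^ 2)) := by
          have : 0 < L ^ 3 * (V / P ^ 2) := by positivity
          linarith
      _ = _ := by ring
  have h5 : (∑ t ∈ Icc 1 T, ∑ y ∈ Icc 1 Y, E t y) ^ 2 ≤
      (T * Y) * ∑ t ∈ Icc 1 T, ∑ y ∈ Icc 1 Y, E t y ^ 2 := by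
    rw [← sum_product', ← sum_product' (f := fun t y => E t y ^ 2)]
    refine sq_sum_le_card_mul_sum_sq.trans_eq ?_
    simp
  refine le_of_sq_le_sq ?_ (by positivity)
  refine h5.trans ?_
  calc _ ≤ (T * Y) * (225 * L ^ 3 * (V / P ^ 2)) := by gcongr
    _ ≤ (T * Y) * (225 * L ^ 4 * (V / P ^ 2)) := by
      gcongr
      · linarith
      · norm_num
    _ = _ := by simp only [V]; field_simp; norm_num

/-- The case of short w, where the cancellation comes from the geometric sum over y. Enlarging the
squares w² to all integers up to W² loses a factor W ≤ P², which is recovered because P³ ≤ q and P³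
≤ Y. The separate term Y of the count accounts for 1/T. -/
lemma sum_sum_norm_sum_linear_le (hL : DivBound X L) (hα : HasApprox α q) (hqX : (q : ℝ) ≤ X)
    {T Y W : ℕ} (hT : 1 ≤ T) (hY : 1 ≤ Y) (hW : 1 ≤ W)
    (hX : (T : ℝ) * W ^ 2 ≤ X) (hP : 1 ≤ P) (hPq : P ^ 3 ≤ q)
    (hqP : P ^ 3 * q ≤ T * Y * (W : ℝ) ^ 2) (hWP : W ≤ P ^ 2) (hPY : P ^ 3 ≤ Y) :
    ∑ t ∈ Icc 1 T, ∑ w ∈ Icc 1 W, ‖∑ y ∈ Icc 1 Y, expChar (t * (α * (y * (w : ℝ) ^ 2)))‖ ≤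
      48 * L ^ 2 * (T * Y * W) * (1 / P + 1 / T) := by
  have hL2 := hL.two_le
  have hT' : (1 : ℝ) ≤ T := by exact_mod_cast hT
  have hY' : (1 : ℝ) ≤ Y := by exact_mod_cast hY
  have hW' : (1 : ℝ) ≤ W := by exact_mod_cast hW
  have hq' : (1 : ℝ) ≤ q := by exact_mod_cast hα.1
  have hP0 : 0 < P := by linarith
  have h1 : ∀ t w : ℕ, ‖∑ y ∈ Icc 1 Y, expChar (t * (α * (y * (w : ℝ) ^ 2)))‖ ≤
      2 * geomBound Y (α * ((t * w ^ 2 : ℕ) : ℝ)) := by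
    intro t w
    rw [sum_Icc_eq_sum_range_succ]
    convert norm_sum_expChar_range Y Y le_rfl (α * ((t * w ^ 2 : ℕ) : ℝ))
      (α * ((t * w ^ 2 : ℕ) : ℝ)) using 4 with y _
    push_cast; ring_nf
  have h2 : ∑ t ∈ Icc 1 T, ∑ w ∈ Icc 1 W, geomBound Y (α * ((t * w ^ 2 : ℕ) : ℝ)) ≤
      L * (8 * (((T * W ^ 2 : ℕ) : ℝ) / q + 1) * (Y + q * L)) := by
    calc _ ≤ ∑ t ∈ Icc 1 T, ∑ v ∈ Icc 1 (W ^ 2), geomBound Y (α * ((t * v : ℕ) : ℝ)) := by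
          refine sum_le_sum fun t _ => ?_
          exact sum_Icc_sq_le (f := fun v => geomBound Y (α * ((t * v : ℕ) : ℝ)))
            (fun _ => geomBound_nonneg _ _) W
      _ ≤ L * ∑ z ∈ Icc 1 (T * W ^ 2), geomBound Y (α * z) := by
          refine hL.sum_sum_mul_le T (W ^ 2) ?_ (fun z => geomBound Y (α * z))
            (fun _ => geomBound_nonneg _ _)
          push_cast; exact hX
      _ ≤ _ := by
          gcongr
          exact hα.sum_geomBound_le hL hqX hY _
  set V : ℝ := T * Y * W
  have hV0 : 0 < V := by positivity
  have e1 : (((T * W ^ 2 : ℕ) : ℝ) / q + 1) * (Y + q * L) =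
      V * (W / q) + L * (T * W ^ 2) + Y + q * L := by
    simp only [V]; push_cast; field_simp; ring
  have hWPY : (W : ℝ) * P ≤ P ^ 3 := by nlinarith
  have e2 : (W : ℝ) / q ≤ 1 / P := by
    rw [div_le_div_iff₀ (by linarith) hP0]; linarith
  have e3 : (T : ℝ) * W ^ 2 ≤ V / P := by
    rw [le_div_iff₀ hP0]
    calc (T : ℝ) * W ^ 2 * P = T * W * (W * P) := by ring
      _ ≤ T * W * Y := by gcongr; linarith
      _ = V := by simp only [V]; ring
  have e4 : (Y : ℝ) ≤ V / T := by
    rw [le_div_iff₀ (by linarith)]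
    simp only [V]
    have : 0 ≤ (Y : ℝ) * T := by positivity
    nlinarith
  have e5 : (q : ℝ) ≤ V / P := by
    rw [le_div_iff₀ hP0]
    have h6 : (W : ℝ) * (q * P) ≤ W * V := by
      calc (W : ℝ) * (q * P) = q * (W * P) := by ring
        _ ≤ q * P ^ 3 := by gcongr
        _ = P ^ 3 * q := by ring
        _ ≤ _ := hqP
        _ = W * V := by simp only [V]; ring
    exact le_of_mul_le_mul_left h6 (by linarith)
  have e6 : (((T * W ^ 2 : ℕ) : ℝ) / q + 1) * (Y + q * L) ≤ 3 * L * (V * (1 / P + 1 / T)) := by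
    rw [e1]
    have f1 : V * (W / q) ≤ V / P := by rw [← mul_one_div V P]; gcongr
    have f2 : 0 < V / P := by positivity
    have f3 : 0 < V / T := by positivity
    have f4 : V * (1 / P + 1 / T) = V / P + V / T := by ring
    rw [f4]
    nlinarith
  calc _ ≤ ∑ t ∈ Icc 1 T, ∑ w ∈ Icc 1 W, 2 * geomBound Y (α * ((t * w ^ 2 : ℕ) : ℝ)) :=
        sum_le_sum fun t _ => sum_le_sum fun w _ => h1 t w
    _ = 2 * ∑ t ∈ Icc 1 T, ∑ w ∈ Icc 1 W, geomBound Y (α * ((t * w ^ 2 : ℕ) : ℝ)) := by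
        simp only [mul_sum]
    _ ≤ 2 * (L * (8 * (((T * W ^ 2 : ℕ) : ℝ) / q + 1) * (Y + q * L))) := by gcongr
    _ = 16 * L * ((((T * W ^ 2 : ℕ) : ℝ) / q + 1) * (Y + q * L)) := by ring
    _ ≤ 16 * L * (3 * L * (V * (1 / P + 1 / T))) := by gcongr
    _ = _ := by ring

/-- Equidistribution of `α y w ^ 2` on average over `y` and `w`. -/
lemma sum_sum_geomBound_square_le (hL : DivBound X L) (hα : HasApprox α q) (hqX : (q : ℝ) ≤ X)
    {T Y W : ℕ} (hT : 1 ≤ T) (hY : 1 ≤ Y) (hW : 1 ≤ W)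
    (hX : 2 * (T : ℝ) * Y * W ^ 2 ≤ X) (hP : 1 ≤ P) (hPq : P ^ 3 ≤ q)
    (hqP : P ^ 3 * q ≤ T * Y * (W : ℝ) ^ 2) (hPY : W ≤ P ^ 2 → P ^ 3 ≤ Y) :
    ∑ y ∈ Icc 1 Y, ∑ w ∈ Icc 1 W, geomBound T (α * (y * (w : ℝ) ^ 2)) ≤
      6500 * L ^ 3 * (T * Y * W) * (1 / P + 1 / T) := by
  have hL2 := hL.two_le
  have hT' : (1 : ℝ) ≤ T := by exact_mod_cast hT
  have hY' : (1 : ℝ) ≤ Y := by exact_mod_cast hY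
  have hW' : (1 : ℝ) ≤ W := by exact_mod_cast hW
  have hP0 : 0 < P := by linarith
  have hX1 : 2 * (T : ℝ) * Y * W ≤ X := by
    refine le_trans ?_ hX
    have : 0 ≤ 2 * (T : ℝ) * Y * W := by positivity
    nlinarith
  have hX2 : (T : ℝ) * W ^ 2 ≤ X := by
    refine le_trans ?_ hX
    have : 0 ≤ (T : ℝ) * W ^ 2 := by positivity
    nlinarith
  have hX3 : (T : ℝ) ≤ X := by
    refine le_trans ?_ hX2
    exact le_mul_of_one_le_right (by linarith) (one_le_pow₀ hW')
  have h1 := sum_geomBound_le_sum_norm (Icc 1 Y ×ˢ Icc 1 W)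
    (fun p : ℕ × ℕ => α * (p.1 * (p.2 : ℝ) ^ 2)) hT
  rw [sum_product] at h1
  refine h1.trans ?_
  have h2 : ∑ t ∈ Icc 1 T, ‖∑ p ∈ Icc 1 Y ×ˢ Icc 1 W,
      expChar (t * (α * (p.1 * (p.2 : ℝ) ^ 2)))‖ ≤ 48 * L ^ 2 * (T * Y * W) * (1 / P + 1 / T) := by
    -- The length of w decides which variable carries the cancellation.
    rcases le_total (P ^ 2) W with hPW | hPW
    · have h3 := sum_sum_norm_sum_square_le hL hα hqX hT hY hW hX1 hP hPq hqP hPW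
      calc _ ≤ ∑ t ∈ Icc 1 T, ∑ y ∈ Icc 1 Y,
            ‖∑ w ∈ Icc 1 W, expChar (t * (α * (y * (w : ℝ) ^ 2)))‖ := by
            refine sum_le_sum fun t _ => ?_
            rw [sum_product]; exact norm_sum_le _ _
        _ ≤ _ := h3
        _ = 15 * L ^ 2 * (T * Y * W) * (1 / P) := by ring
        _ ≤ _ := by
            gcongr
            · norm_num
            · have : 0 < 1 / (T : ℝ) := by positivity
              linarith
    · have h3 := sum_sum_norm_sum_linear_le hL hα hqX hT hY hW hX2 hP hPq hqP hPW (hPY hPW)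
      refine le_trans ?_ h3
      refine sum_le_sum fun t _ => ?_
      rw [sum_product_right]; exact norm_sum_le _ _
  have h4 := hL.log_two_add_one_le hX3
  set V : ℝ := T * Y * W
  have hV0 : 0 < V := by positivity
  have h5 : ((Icc 1 Y ×ˢ Icc 1 W).card : ℝ) ≤ 2 * L ^ 2 * V * (1 / P + 1 / T) := by
    have e1 : ((Icc 1 Y ×ˢ Icc 1 W).card : ℝ) = V / T := by
      simp only [card_product, Nat.card_Icc, V]; push_cast; field_simp
    rw [e1]
    have e2 : 0 < V / T := by positivity
    have e3 : 0 < V / P := by positivity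
    have e4 : 2 * L ^ 2 * V * (1 / P + 1 / T) = 2 * L ^ 2 * (V / P + V / T) := by ring
    rw [e4]
    have : 1 ≤ 2 * L ^ 2 := by nlinarith
    nlinarith
  calc _ ≤ 128 * L * (2 * L ^ 2 * V * (1 / P + 1 / T) +
        48 * L ^ 2 * V * (1 / P + 1 / T)) := by gcongr
    _ = 6400 * L ^ 3 * V * (1 / P + 1 / T) := by ring
    _ ≤ _ := by gcongr; norm_num

/-- Two differencings in h remove the cube and leave the frequency 6tyljw²α, which is a square
average in w. That average saves P = p⁴, and the fourth root taken at the end leaves p. -/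
lemma sum_norm_sum_cubic_le (hL : DivBound X L) (hα : HasApprox α q) (hqX : (q : ℝ) ≤ X)
    {p : ℝ} {T Y H W : ℕ} (hT : 1 ≤ T) (hY : 1 ≤ Y) (hW : 1 ≤ W)
    (hX : 12 * (T : ℝ) * Y * H ^ 3 * W ^ 2 ≤ X) (hp : 1 ≤ p) (hpq : (p ^ 4) ^ 3 ≤ q)
    (hqp : (p ^ 4) ^ 3 * q ≤ T * Y * (H : ℝ) ^ 3 * (W : ℝ) ^ 2) (hpH : p ^ 4 ≤ H)
    (hpY : W ≤ (p ^ 4) ^ 2 → (p ^ 4) ^ 3 ≤ T * Y * (H : ℝ) ^ 2) :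
    ∑ t ∈ Icc 1 T, ∑ y ∈ Icc 1 Y, ∑ w ∈ Icc 1 W,
      ‖∑ h ∈ Icc 1 H, expChar (t * (α * (y * (h : ℝ) ^ 3 * (w : ℝ) ^ 2)))‖ ≤
      40 * L ^ 2 * (T * Y * H * W) / p := by
  have hL2 := hL.two_le
  have hT' : (1 : ℝ) ≤ T := by exact_mod_cast hT
  have hY' : (1 : ℝ) ≤ Y := by exact_mod_cast hY
  have hW' : (1 : ℝ) ≤ W := by exact_mod_cast hW
  have hp4 : 1 ≤ p ^ 4 := one_le_pow₀ hp
  have hH' : (1 : ℝ) ≤ H := hp4.trans hpH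
  have hH : 1 ≤ H := by exact_mod_cast hH'
  have hp0 : 0 < p := by linarith
  set E : ℕ → ℕ → ℕ → ℝ := fun t y w =>
    ‖∑ h ∈ Icc 1 H, expChar (t * (α * (y * (h : ℝ) ^ 3 * (w : ℝ) ^ 2)))‖
  have hgn : ∀ (z : ℕ), 0 ≤ ∑ w ∈ Icc 1 W, geomBound H (α * ((z : ℝ) * (w : ℝ) ^ 2)) :=
    fun _ => sum_nonneg fun _ _ => geomBound_nonneg _ _
  have h1 : ∀ t y w, E t y w ^ 4 ≤ 10 * (H : ℝ) ^ 3 + 32 * H * ∑ l ∈ Icc 1 H, ∑ j ∈ Icc 1 H,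
      geomBound H (α * (((6 * (t * y * l * j) : ℕ) : ℝ) * (w : ℝ) ^ 2)) := by
    intro t y w
    have h := norm_sum_cubic_pow_four_le H (t * α * y * (w : ℝ) ^ 2)
    have e1 : ∑ h ∈ Icc 1 H, expChar (t * (α * (y * (h : ℝ) ^ 3 * (w : ℝ) ^ 2))) =
        ∑ s ∈ range H, expChar (t * α * y * (w : ℝ) ^ 2 * ((s + 1 : ℕ) : ℝ) ^ 3) := by
      rw [sum_Icc_eq_sum_range_succ]
      refine sum_congr rfl fun s _ => ?_
      congr 1; ring
    have e2 : ∀ l j : ℕ, α * (((6 * (t * y * l * j) : ℕ) : ℝ) * (w : ℝ) ^ 2) =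
        6 * (t * α * y * (w : ℝ) ^ 2) * (l * j) := fun l j => by push_cast; ring
    simp only [E, e1, e2]
    refine h.trans ?_
    gcongr
    refine (sum_le_sum fun l _ => sum_Ico_geomBound_le_sum_Icc H H _).trans ?_
    exact sum_le_sum_of_subset_of_nonneg Ico_subset_Icc_self fun _ _ _ =>
      sum_nonneg fun _ _ => geomBound_nonneg _ _
  have hX' : ((6 * (T * Y * H * H) : ℕ) : ℝ) ≤ X := by
    push_cast
    refine le_trans ?_ hX
    have e : 12 * (T : ℝ) * Y * H ^ 3 * W ^ 2 = 6 * (T * Y * H * H) * (2 * H * W ^ 2) := by ring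
    rw [e]
    have : 1 ≤ 2 * (H : ℝ) * W ^ 2 := by nlinarith [one_le_pow₀ hW' (n := 2)]
    exact le_mul_of_one_le_right (by positivity) this
  have hXn : 6 * (T * Y * H * H) ≤ ⌊X⌋₊ := Nat.le_floor hX'
  have hle : ∀ n : ℕ, n ≤ 6 * (T * Y * H * H) → (n : ℝ) ≤ X := fun n hn =>
    le_trans (by exact_mod_cast hn) hX'
  set g : ℕ → ℝ := fun z => ∑ w ∈ Icc 1 W, geomBound H (α * ((z : ℝ) * (w : ℝ) ^ 2))
  have h2 : ∑ t ∈ Icc 1 T, ∑ y ∈ Icc 1 Y, ∑ l ∈ Icc 1 H, ∑ j ∈ Icc 1 H, g (6 * (t * y * l * j)) ≤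
      L ^ 3 * (6500 * L ^ 3 * (H * ((6 * (T * Y * H * H) : ℕ) : ℝ) * W) * (1 / p ^ 4 + 1 / H)) := by
    calc _ ≤ L * ∑ z ∈ Icc 1 (T * Y), ∑ l ∈ Icc 1 H, ∑ j ∈ Icc 1 H, g (6 * (z * l * j)) := by
          refine hL.sum_sum_mul_le T Y (hle _ ?_) (fun z => ∑ l ∈ Icc 1 H, ∑ j ∈ Icc 1 H,
            g (6 * (z * l * j))) (fun _ => sum_nonneg fun _ _ => sum_nonneg fun _ _ => hgn _)
          have := Nat.mul_pos hH hH
          nlinarith [Nat.zero_le (T * Y)]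
      _ ≤ L * (L * ∑ z ∈ Icc 1 (T * Y * H), ∑ j ∈ Icc 1 H, g (6 * (z * j))) := by
          gcongr
          refine hL.sum_sum_mul_le (T * Y) H (hle _ ?_) (fun z => ∑ j ∈ Icc 1 H,
            g (6 * (z * j))) (fun _ => sum_nonneg fun _ _ => hgn _)
          nlinarith [Nat.zero_le (T * Y * H)]
      _ ≤ L * (L * (L * ∑ z ∈ Icc 1 (T * Y * H * H), g (6 * z))) := by
          gcongr
          refine hL.sum_sum_mul_le (T * Y * H) H (hle _ ?_) (fun z => g (6 * z)) (fun _ => hgn _)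
          omega
      _ ≤ L * (L * (L * ∑ z ∈ Icc 1 (6 * (T * Y * H * H)), g z)) := by
          gcongr
          exact sum_Icc_mul_le (f := g) hgn (by norm_num) _
      _ = L ^ 3 * ∑ z ∈ Icc 1 (6 * (T * Y * H * H)), g z := by ring
      _ ≤ _ := by
          gcongr
          -- The roles change here: H is the length in `geomBound`, and the product 6tylj, of range
          -- 6TYH², takes the place of the linear variable.
          refine sum_sum_geomBound_square_le hL hα hqX hH ?_ hW ?_ hp4 hpq ?_ ?_
          · have := Nat.mul_pos (Nat.mul_pos (Nat.mul_pos hT hY) hH) hH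
            omega
          · push_cast
            refine le_trans (le_of_eq ?_) hX
            ring
          · refine hqp.trans ?_
            push_cast
            have : 0 ≤ T * Y * (H : ℝ) ^ 3 * (W : ℝ) ^ 2 := by positivity
            linarith
          · intro hw
            refine (hpY hw).trans ?_
            push_cast
            have : 0 ≤ T * Y * (H : ℝ) ^ 2 := by positivity
            linarith
  have h3 : ∑ t ∈ Icc 1 T, ∑ y ∈ Icc 1 Y, ∑ w ∈ Icc 1 W, E t y w ^ 4 ≤
      10 * (H : ℝ) ^ 3 * (T * Y * W) + 32 * H * (L ^ 3 * (6500 * L ^ 3 *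
        (H * ((6 * (T * Y * H * H) : ℕ) : ℝ) * W) * (1 / p ^ 4 + 1 / H))) := by
    refine (sum_le_sum fun t _ => sum_le_sum fun y _ => sum_le_sum fun w _ => h1 t y w).trans ?_
    simp only [sum_add_distrib, ← mul_sum]
    refine add_le_add (le_of_eq ?_) ?_
    · simp; ring
    · gcongr
      refine le_trans (le_of_eq ?_) h2
      refine sum_congr rfl fun t _ => sum_congr rfl fun y _ => ?_
      simp only [g]
      rw [sum_comm]
      refine sum_congr rfl fun l _ => ?_
      rw [sum_comm]
  set V : ℝ := T * Y * W
  have hV0 : 0 < V := by positivity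
  have h4 : ∑ t ∈ Icc 1 T, ∑ y ∈ Icc 1 Y, ∑ w ∈ Icc 1 W, E t y w ^ 4 ≤
      V * (40 * L ^ 2 * H / p) ^ 4 := by
    refine h3.trans ?_
    have e0 : 1 / (H : ℝ) ≤ 1 / p ^ 4 := by gcongr
    have e1 : (H : ℝ) ^ 3 ≤ H ^ 4 / p ^ 4 := by
      rw [le_div_iff₀ (by positivity)]
      calc (H : ℝ) ^ 3 * p ^ 4 ≤ H ^ 3 * H := by gcongr
        _ = _ := by ring
    have e2 : L ^ 6 ≤ L ^ 8 := pow_le_pow_right₀ (by linarith) (by norm_num)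
    have e3 : (1 : ℝ) ≤ L ^ 8 := one_le_pow₀ (by linarith)
    set R : ℝ := H ^ 4 / p ^ 4
    have hR : 0 < R := by positivity
    have e4 : 0 < V * R := by positivity
    calc _ ≤ 10 * R * V + 32 * H * (L ^ 3 * (6500 * L ^ 3 *
        (H * ((6 * (T * Y * H * H) : ℕ) : ℝ) * W) * (1 / p ^ 4 + 1 / p ^ 4))) := by gcongr
      _ = 10 * (V * R) + 2496000 * L ^ 6 * (V * R) := by
        simp only [V, R]; push_cast; ring
      _ ≤ 10 * (L ^ 8 * (V * R)) + 2496000 * L ^ 8 * (V * R) := by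
        refine add_le_add ?_ (by gcongr)
        have := le_mul_of_one_le_left e4.le e3
        linarith
      _ ≤ 2560000 * (L ^ 8 * (V * R)) := by
        have : 0 < L ^ 8 * (V * R) := by positivity
        linarith
      _ = _ := by simp only [R]; ring
  have h5 : (∑ t ∈ Icc 1 T, ∑ y ∈ Icc 1 Y, ∑ w ∈ Icc 1 W, E t y w) ^ 4 ≤
      V ^ 3 * ∑ t ∈ Icc 1 T, ∑ y ∈ Icc 1 Y, ∑ w ∈ Icc 1 W, E t y w ^ 4 := by
    -- The power mean inequality with exponent 4 over all triples.
    have h := pow_sum_div_card_le_sum_pow (s := Icc 1 T ×ˢ Icc 1 Y ×ˢ Icc 1 W)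
      (f := fun i => E i.1 i.2.1 i.2.2) (fun _ _ => norm_nonneg _) 3
    rw [sum_product, sum_product] at h
    simp only [sum_product] at h
    rw [div_le_iff₀ (by simp; positivity)] at h
    refine h.trans_eq ?_
    simp [V]; ring
  refine le_of_pow_le_pow_left₀ (n := 4) (by norm_num) (by positivity) ?_
  refine h5.trans ?_
  calc _ ≤ V ^ 3 * (V * (40 * L ^ 2 * H / p) ^ 4) := by gcongr
    _ = _ := by simp only [V]; field_simp

/-- Equidistribution of `α y h ^ 3 w ^ 2` on average over `y`, `h` and `w`. -/
lemma sum_geomBound_cube_square_le (hL : DivBound X L) (hα : HasApprox α q) (hqX : (q : ℝ) ≤ X)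
    {p : ℝ} {T Y H W : ℕ} (hY : 1 ≤ Y) (hW : 1 ≤ W)
    (hX : 12 * (T : ℝ) * Y * H ^ 3 * W ^ 2 ≤ X) (hp : 1 ≤ p) (hpq : (p ^ 4) ^ 3 ≤ q)
    (hqp : (p ^ 4) ^ 3 * q ≤ T * Y * (H : ℝ) ^ 3 * (W : ℝ) ^ 2) (hpH : p ^ 4 ≤ H) (hpT : p ^ 4 ≤ T)
    (hpY : W ≤ (p ^ 4) ^ 2 → (p ^ 4) ^ 3 ≤ T * Y * (H : ℝ) ^ 2) :
    ∑ y ∈ Icc 1 Y, ∑ h ∈ Icc 1 H, ∑ w ∈ Icc 1 W,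
      geomBound T (α * (y * (h : ℝ) ^ 3 * (w : ℝ) ^ 2)) ≤
      5500 * L ^ 3 * (T * Y * H * W) / p := by
  have hL2 := hL.two_le
  have hp4 : 1 ≤ p ^ 4 := one_le_pow₀ hp
  have hT' : (1 : ℝ) ≤ T := hp4.trans hpT
  have hT : 1 ≤ T := by exact_mod_cast hT'
  have hY' : (1 : ℝ) ≤ Y := by exact_mod_cast hY
  have hW' : (1 : ℝ) ≤ W := by exact_mod_cast hW
  have hH' : (1 : ℝ) ≤ H := hp4.trans hpH
  have hp0 : 0 < p := by linarith
  have h2 := sum_norm_sum_cubic_le hL hα hqX hT hY hW hX hp hpq hqp hpH hpY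
  have h1 := sum_geomBound_le_sum_norm (Icc 1 Y ×ˢ Icc 1 H ×ˢ Icc 1 W)
    (fun i : ℕ × ℕ × ℕ => α * (i.1 * (i.2.1 : ℝ) ^ 3 * (i.2.2 : ℝ) ^ 2)) hT
  rw [sum_product] at h1
  simp only [sum_product] at h1
  refine h1.trans ?_
  have h3 : ∑ t ∈ Icc 1 T, ‖∑ y ∈ Icc 1 Y, ∑ h ∈ Icc 1 H, ∑ w ∈ Icc 1 W,
      expChar (t * (α * (y * (h : ℝ) ^ 3 * (w : ℝ) ^ 2)))‖ ≤
      40 * L ^ 2 * (T * Y * H * W) / p := by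
    refine le_trans (sum_le_sum fun t _ => ?_) h2
    refine (norm_sum_le _ _).trans (sum_le_sum fun y _ => ?_)
    rw [sum_comm]
    exact norm_sum_le _ _
  have hTX : (T : ℝ) ≤ X := by
    refine le_trans ?_ hX
    have e : 12 * (T : ℝ) * Y * H ^ 3 * W ^ 2 = T * (12 * (Y * H ^ 3 * W ^ 2)) := by ring
    rw [e]
    refine le_mul_of_one_le_right (by linarith) ?_
    have : 1 ≤ Y * (H : ℝ) ^ 3 * W ^ 2 :=
      one_le_mul_of_one_le_of_one_le (one_le_mul_of_one_le_of_one_le hY' (one_le_pow₀ hH'))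
        (one_le_pow₀ hW')
    linarith
  have h4 := hL.log_two_add_one_le hTX
  set V : ℝ := T * Y * H * W
  have hV0 : 0 < V := by positivity
  have h5 : ((Icc 1 Y ×ˢ Icc 1 H ×ˢ Icc 1 W).card : ℝ) ≤ L ^ 2 * V / p := by
    have e1 : ((Icc 1 Y ×ˢ Icc 1 H ×ˢ Icc 1 W).card : ℝ) = V / T := by
      simp only [card_product, Nat.card_Icc, V]; push_cast; field_simp
    rw [e1, div_le_div_iff₀ (by linarith) hp0]
    have e2 : p ≤ T := by
      refine le_trans ?_ hpT
      exact le_self_pow₀ hp (by norm_num)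
    have e3 : V * p ≤ V * T := by gcongr
    have e4 : 0 < V * T := by positivity
    have e5 : 1 ≤ L ^ 2 := one_le_pow₀ (by linarith)
    nlinarith
  calc _ ≤ 128 * L * (L ^ 2 * V / p + 40 * L ^ 2 * V / p) := by gcongr
    _ = 5248 * (L ^ 3 * V / p) := by ring
    _ ≤ 5500 * (L ^ 3 * V / p) := by gcongr; norm_num
    _ = _ := by ring

end

/-! ### Sums over progressions, partial summation and dyadic blocks. -/

/-- A set inside one class modulo u, and convex within that class, is an arithmetic progression
running from its minimum to its maximum. -/
lemma exists_sum_eq_sum_range (A : Finset ℕ) {u : ℕ} (hu : 1 ≤ u) {M : ℝ}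
    (hA : ∀ a ∈ A, (a : ℝ) ≤ M) (hcong : ∀ a ∈ A, ∀ b ∈ A, a ≡ b [MOD u])
    (hconv : ∀ a ∈ A, ∀ b ∈ A, ∀ c, a ≤ c → c ≤ b → c ≡ a [MOD u] → c ∈ A) :
    ∃ n₀ N : ℕ, N ≤ ⌊M / u⌋₊ + 1 ∧ (∀ t < N, n₀ + u * t ∈ A) ∧
      ∀ f : ℕ → ℂ, ∑ a ∈ A, f a = ∑ t ∈ range N, f (n₀ + u * t) := by
  rcases A.eq_empty_or_nonempty with rfl | hne
  · exact ⟨0, 0, by simp, by simp, by simp⟩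
  set a := A.min' hne
  set b := A.max' hne
  have ha : a ∈ A := A.min'_mem hne
  have hb : b ∈ A := A.max'_mem hne
  have hab : a ≤ b := A.min'_le b hb
  have hmem : ∀ t < (b - a) / u + 1, a + u * t ∈ A := by
    intro t ht
    refine hconv a ha b hb _ (by omega) ?_ ?_
    · have h1 : u * t ≤ u * ((b - a) / u) := Nat.mul_le_mul_left u (by omega)
      have h2 := Nat.mul_div_le (b - a) u
      omega
    · exact (Nat.modEq_iff_dvd' (by omega)).2 ⟨t, by simp⟩ |>.symm
  have himg : A = (range ((b - a) / u + 1)).image fun t => a + u * t := by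
    ext c
    simp only [mem_image, mem_range]
    constructor
    · intro hc
      have hac : a ≤ c := A.min'_le c hc
      have hcb : c ≤ b := A.le_max' c hc
      obtain ⟨t, ht⟩ := (Nat.modEq_iff_dvd' hac).1 (hcong a ha c hc)
      refine ⟨t, ?_, by omega⟩
      rw [Nat.lt_succ_iff, Nat.le_div_iff_mul_le (by omega), mul_comm]
      omega
    · rintro ⟨t, ht, rfl⟩
      exact hmem t ht
  refine ⟨a, (b - a) / u + 1, ?_, hmem, ?_⟩
  · gcongr
    have h1 : (((b - a) / u : ℕ) : ℝ) ≤ M / u := by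
      refine Nat.cast_div_le.trans ?_
      gcongr
      exact le_trans (by exact_mod_cast Nat.sub_le b a) (hA b hb)
    exact Nat.le_floor h1
  · intro f
    conv_lhs => rw [himg]
    rw [sum_image]
    intro s _ t _ hst
    have : u * s = u * t := by simpa using hst
    exact Nat.eq_of_mul_eq_mul_left hu this

/-- Partial summation with a monotone weight. -/
lemma norm_sum_monotone_mul_le (f : ℕ → ℂ) (w : ℕ → ℝ) (N : ℕ) {B W : ℝ} (hB : 0 ≤ B) (hW' : 0 ≤ W)
    (hw : ∀ i j, i ≤ j → j < N → w i ≤ w j) (hw0 : ∀ i < N, 0 ≤ w i) (hW : ∀ i < N, w i ≤ W)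
    (hf : ∀ n ≤ N, ‖∑ t ∈ range n, f t‖ ≤ B) :
    ‖∑ t ∈ range N, (w t : ℂ) * f t‖ ≤ 2 * W * B := by
  rcases Nat.eq_zero_or_pos N with rfl | hN
  · simp; positivity
  have h := sum_range_by_parts (fun t => (w t : ℂ)) f N
  simp only [smul_eq_mul] at h
  rw [h]
  refine (norm_sub_le _ _).trans ?_
  have h1 : ‖(w (N - 1) : ℂ) * ∑ i ∈ range N, f i‖ ≤ w (N - 1) * B := by
    rw [norm_mul, Complex.norm_real, Real.norm_of_nonneg (hw0 _ (by omega))]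
    exact mul_le_mul_of_nonneg_left (hf N le_rfl) (hw0 _ (by omega))
  have h2 : ‖∑ i ∈ range (N - 1), ((w (i + 1) : ℂ) - w i) * ∑ j ∈ range (i + 1), f j‖ ≤
      ∑ i ∈ range (N - 1), (w (i + 1) - w i) * B := by
    refine (norm_sum_le _ _).trans (sum_le_sum fun i hi => ?_)
    rw [mem_range] at hi
    have h3 : 0 ≤ w (i + 1) - w i := sub_nonneg.2 (hw _ _ (by omega) (by omega))
    rw [norm_mul, ← Complex.ofReal_sub, Complex.norm_real, Real.norm_of_nonneg h3]
    exact mul_le_mul_of_nonneg_left (hf _ (by omega)) h3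
  rw [← sum_mul, sum_range_sub] at h2
  have h4 := hw0 0 hN
  have h5 := hW (N - 1) (by omega)
  nlinarith

lemma sum_nonzeroFrequencies_le (K : ℝ) (g : ℕ → ℝ) (hg : ∀ n, 0 ≤ g n) :
    ∑ k ∈ nonzeroFrequencies K, g k.natAbs ≤ 2 * ∑ k ∈ Icc 1 ⌊K⌋₊, g k := by
  classical
  have hsub : nonzeroFrequencies K ⊆ (Icc 1 ⌊K⌋₊).image (fun n : ℕ => (n : ℤ)) ∪
      (Icc 1 ⌊K⌋₊).image (fun n : ℕ => -(n : ℤ)) := by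
    intro k hk
    simp only [nonzeroFrequencies, mem_filter, mem_Icc] at hk
    have hfl : ((⌊K⌋₊ : ℕ) : ℤ) = max ⌊K⌋ 0 := by
      rw [← Int.floor_toNat, Int.toNat_eq_max]
    simp only [mem_union, mem_image, mem_Icc]
    rcases lt_or_gt_of_ne hk.2 with h | h
    · right; exact ⟨k.natAbs, by omega, by omega⟩
    · left; exact ⟨k.natAbs, by omega, by omega⟩
  calc _ ≤ ∑ k ∈ (Icc 1 ⌊K⌋₊).image (fun n : ℕ => (n : ℤ)) ∪
      (Icc 1 ⌊K⌋₊).image (fun n : ℕ => -(n : ℤ)), g k.natAbs :=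
        sum_le_sum_of_subset_of_nonneg hsub fun _ _ _ => hg _
    _ ≤ ∑ k ∈ (Icc 1 ⌊K⌋₊).image (fun n : ℕ => (n : ℤ)), g k.natAbs +
      ∑ k ∈ (Icc 1 ⌊K⌋₊).image (fun n : ℕ => -(n : ℤ)), g k.natAbs := by
        rw [← sum_union_inter]
        exact le_add_of_nonneg_right (sum_nonneg fun _ _ => hg _)
    _ = _ := by
        rw [sum_image (by intro a _ b _ h; simpa using h),
          sum_image (by intro a _ b _ h; simpa using h)]
        simp [two_mul]

lemma sum_dyadic_le (f : ℕ → ℝ) (hf : ∀ n, 0 ≤ f n) (Z : ℕ) {B : ℝ}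
    (h : ∀ i ≤ Nat.log 2 Z, ∑ n ∈ Ico (2 ^ i) (2 ^ (i + 1)), f n ≤ B) :
    ∑ n ∈ Icc 1 Z, f n ≤ ((Nat.log 2 Z : ℕ) + 1) * B := by
  have hmaps : ∀ n ∈ Icc 1 Z, Nat.log 2 n ∈ range (Nat.log 2 Z + 1) := by
    intro n hn
    rw [mem_Icc] at hn
    rw [mem_range, Nat.lt_succ_iff]
    exact Nat.log_mono_right hn.2
  rw [← sum_fiberwise_of_maps_to hmaps]
  have h1 : ∀ i ∈ range (Nat.log 2 Z + 1), ∑ n ∈ Icc 1 Z with Nat.log 2 n = i, f n ≤ B := by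
    intro i hi
    rw [mem_range] at hi
    refine le_trans ?_ (h i (by omega))
    refine sum_le_sum_of_subset_of_nonneg ?_ fun _ _ _ => hf _
    intro n hn
    simp only [mem_filter, mem_Icc] at hn
    rw [mem_Ico, ← hn.2]
    exact ⟨Nat.pow_log_le_self 2 (by omega), Nat.lt_pow_succ_log_self (by norm_num) n⟩
  refine (sum_le_sum h1).trans_eq ?_
  simp

/-- The condition `n ∼ x`, `n ≡ b (mod d)`. -/
def InDyadicProgression (x : ℝ) (b : ℤ) (d n : ℕ) : Prop :=
  x / 2 ≤ (n : ℝ) ∧ (n : ℝ) < x ∧ (n : ℤ) ≡ b [ZMOD (d : ℤ)]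

/-- The quantity bounding the square of a quadratic exponential sum of length `T` and
leading coefficient `A`. -/
noncomputable def quadBound (T : ℕ) (A : ℝ) : ℝ :=
  T + 4 * ∑ l ∈ Icc 1 T, geomBound T (2 * A * l)

lemma quadBound_nonneg (T : ℕ) (A : ℝ) : 0 ≤ quadBound T A :=
  add_nonneg (by positivity) (mul_nonneg (by norm_num) (sum_nonneg fun _ _ => geomBound_nonneg _ _))

lemma norm_sum_le_sqrt_quadBound (N T : ℕ) (h : N ≤ T) (A B C : ℝ) :
    ‖∑ t ∈ range N, expChar (A * t ^ 2 + B * t + C)‖ ≤ √(quadBound T A) := by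
  refine Real.le_sqrt_of_sq_le ((norm_sum_quadratic_sq_le N T h A B C).trans ?_)
  unfold quadBound
  have := sum_Ico_geomBound_le_sum_Icc T T fun l => 2 * A * l
  linarith

lemma quadBound_neg (T : ℕ) (A : ℝ) : quadBound T (-A) = quadBound T A := by
  unfold quadBound
  congr 2
  refine sum_congr rfl fun l _ => ?_
  rw [← geomBound_neg]; congr 1; ring

lemma quadBound_mul_natAbs (T : ℕ) (A : ℝ) (k : ℤ) :
    quadBound T (A * k) = quadBound T (A * k.natAbs) := by
  rcases Int.natAbs_eq k with h | h
  · conv_lhs => rw [h]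
    simp
  · conv_lhs => rw [h]
    rw [← quadBound_neg, Int.cast_neg, mul_neg, neg_neg]; simp

-- Since d is coprime to b, any solution forces n to be invertible modulo d, so m lies in a single
-- class. Substituting m = n₀ + dt gives a quadratic phase in t with leading coefficient α (nd)² k,
-- and the monotone weight is removed by partial summation. Only the product nd enters the bound,
-- which allows grouping by nd later.
open scoped Classical in
lemma norm_sum_progression_le {x α L : ℝ} {b k : ℤ} {d n R T : ℕ} (hd : 1 ≤ d)
    (hn : 1 ≤ n) (hco : IsCoprime (d : ℤ) b) (w : ℕ → ℝ) (hw : ∀ i j, 1 ≤ i → i ≤ j → w i ≤ w j)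
    (hw0 : ∀ i, 1 ≤ i → 0 ≤ w i) (hwL : ∀ i : ℕ, (i : ℝ) ≤ x → w i ≤ L) (hL : 0 ≤ L)
    (hT : ⌊x / (n * d : ℕ)⌋₊ + 1 ≤ T) :
    ‖∑ m ∈ Icc 1 R, if InDyadicProgression x b d (n * m) then
      (w m : ℂ) * expChar (α * ((n * m : ℕ) : ℝ) ^ 2 * k) else 0‖ ≤
    2 * L * √(quadBound T (α * ((n * d : ℕ) : ℝ) ^ 2 * k)) := by
  rw [← sum_filter]
  have hn' : (1 : ℝ) ≤ n := by exact_mod_cast hn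
  set A := (Icc 1 R).filter fun m => InDyadicProgression x b d (n * m)
  have hmem : ∀ m, m ∈ A ↔ (1 ≤ m ∧ m ≤ R) ∧ InDyadicProgression x b d (n * m) := by
    intro m; simp only [A, mem_filter, mem_Icc]
  have hcop : ∀ m ∈ A, IsCoprime (d : ℤ) n := by
    intro m hm
    have h1 := ((hmem m).1 hm).2.2.2
    have h2 : IsCoprime (d : ℤ) ((n * m : ℕ) : ℤ) := by
      obtain ⟨t, ht⟩ := h1.dvd
      have : ((n * m : ℕ) : ℤ) = b + d * (-t) := by linarith
      rw [this]
      exact hco.add_mul_left_right _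
    push_cast at h2
    exact h2.of_mul_right_left
  obtain ⟨n₀, N, hN, hNA, hsum⟩ := exists_sum_eq_sum_range A (u := d) hd (M := x / n)
    (by
      intro a ha
      have := ((hmem a).1 ha).2.2.1
      push_cast at this
      rw [le_div_iff₀ (by linarith)]; linarith)
    (by
      intro a ha c hc
      have h1 := ((hmem a).1 ha).2.2.2
      have h2 := ((hmem c).1 hc).2.2.2
      have h3 := h1.trans h2.symm
      rw [Nat.modEq_iff_dvd]
      have h4 : (d : ℤ) ∣ n * (c - a) := by
        have := h3.dvd; push_cast at this; rwa [mul_sub]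
      exact (hcop a ha).dvd_of_dvd_mul_left h4)
    (by
      intro a ha c hc m ham hmc hma
      rw [hmem] at ha hc ⊢
      refine ⟨by omega, ?_, ?_, ?_⟩
      · refine ha.2.1.trans ?_
        exact_mod_cast Nat.mul_le_mul_left n ham
      · refine lt_of_le_of_lt ?_ hc.2.2.1
        exact_mod_cast Nat.mul_le_mul_left n hmc
      · refine Int.ModEq.trans ?_ ha.2.2.2
        exact_mod_cast (Nat.ModEq.mul_left n hma))
  rw [hsum]
  have hNT : N ≤ T := by
    refine hN.trans (le_trans ?_ hT)
    rw [div_div]; push_cast; rfl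
  have hpos : ∀ t < N, 1 ≤ n₀ + d * t := fun t ht => ((hmem _).1 (hNA t ht)).1.1
  refine norm_sum_monotone_mul_le (fun t => expChar (α * ((n * (n₀ + d * t) : ℕ) : ℝ) ^ 2 * k))
    (fun t => w (n₀ + d * t)) N (Real.sqrt_nonneg _) hL ?_ ?_ ?_ ?_
  · intro i j hij hj
    exact hw _ _ (hpos i (by omega)) (by gcongr)
  · intro i hi
    exact hw0 _ (hpos i hi)
  · intro i hi
    refine hwL _ ?_
    have h1 := ((hmem _).1 (hNA i hi)).2.2.1
    push_cast at h1 ⊢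
    have h2 : (0 : ℝ) ≤ n₀ + d * i := by positivity
    nlinarith
  · intro m hm
    convert norm_sum_le_sqrt_quadBound m T (hm.trans hNT) (α * ((n * d : ℕ) : ℝ) ^ 2 * k)
      (2 * α * n ^ 2 * d * n₀ * k) (α * n ^ 2 * n₀ ^ 2 * k) using 4 with t _
    push_cast; ring

/-! ### The minor arc and the Type I estimate. -/

/-- Standing assumptions on the parameters: `α` has a rational approximation with denominator `q`,
where both `q` and `K x ^ 2 / q` are at least `p ^ 12`. -/
structure MinorArc (X L α : ℝ) (q : ℕ) (x K p : ℝ) : Prop where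
  divBound : DivBound X L
  approx : HasApprox α q
  q_le : (q : ℝ) ≤ X
  one_le_K : 1 ≤ K
  one_le_p : 1 ≤ p
  le_q : (p ^ 4) ^ 3 ≤ q
  q_mul_le : (p ^ 4) ^ 3 * q ≤ K * x ^ 2
  le_X : 20000 * K * x ^ 2 ≤ X
  p_le : p ^ 20 ≤ x

section

variable {X L α x K p : ℝ} {q : ℕ}

lemma MinorArc.one_le_x (h : MinorArc X L α q x K p) : 1 ≤ x :=
  (one_le_pow₀ h.one_le_p).trans h.p_le

lemma MinorArc.one_le_floor_K (h : MinorArc X L α q x K p) : 1 ≤ ⌊K⌋₊ :=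
  Nat.le_floor (by exact_mod_cast h.one_le_K)

lemma MinorArc.half_K_le (h : MinorArc X L α q x K p) : K / 2 ≤ (⌊K⌋₊ : ℝ) := by
  have h1 := Nat.lt_floor_add_one K
  have h2 : (1 : ℝ) ≤ ⌊K⌋₊ := by exact_mod_cast h.one_le_floor_K
  linarith

/-- Cauchy–Schwarz over U and k removes the square root. What remains is a square average with w = U
and y = 2kl. The condition on 2^i ensures T ≥ p⁴, so that the contribution 1/T is no worse than
1/p⁴; the square root then saves p². -/
lemma MinorArc.sum_sqrt_quadBound_dyadic_le (h : MinorArc X L α q x K p) {i T : ℕ}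
    (hi : 2 ^ i * p ^ 4 ≤ x) (hT : T = ⌊x / 2 ^ i⌋₊ + 1) :
    ∑ U ∈ Ico ((2 : ℕ) ^ i) (2 ^ (i + 1)), ∑ k ∈ Icc 1 ⌊K⌋₊, √(quadBound T (α * (U : ℝ) ^ 2 * k)) ≤
      920 * L ^ 2 * (K * x) / p ^ 2 := by
  have hL2 := h.divBound.two_le
  have hx := h.one_le_x
  have hK := h.one_le_K
  have hp4 : 1 ≤ p ^ 4 := one_le_pow₀ h.one_le_p
  have hp0 : 0 < p := by linarith [h.one_le_p]
  have h2i : (0 : ℝ) < 2 ^ i := by positivity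
  have hTx : x / 2 ^ i < T := by rw [hT]; push_cast; exact Nat.lt_floor_add_one _
  have hpT : p ^ 4 ≤ T := by
    refine le_trans ?_ hTx.le
    rw [le_div_iff₀ h2i]; linarith
  have hT1 : 1 ≤ T := by omega
  have hT1' : (1 : ℝ) ≤ T := by exact_mod_cast hT1
  have hxT : x ≤ 2 ^ i * T := by rw [div_lt_iff₀ h2i] at hTx; linarith
  have hTx2 : 2 ^ i * T ≤ 2 * x := by
    have h1 : ((⌊x / 2 ^ i⌋₊ : ℕ) : ℝ) ≤ x / 2 ^ i := Nat.floor_le (by positivity)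
    have h2 : (2 : ℝ) ^ i ≤ x := by nlinarith
    have h3 : 2 ^ i * (x / 2 ^ i) = x := by field_simp
    have h4 := mul_le_mul_of_nonneg_left h1 h2i.le
    rw [hT]; push_cast; linarith
  have hK' : (⌊K⌋₊ : ℝ) ≤ K := Nat.floor_le (by linarith)
  have hK1 := h.one_le_floor_K
  have hK2 := h.half_K_le
  set k₀ := ⌊K⌋₊
  set g : ℕ → ℝ := fun y =>
    ∑ U ∈ Icc 1 ((2 : ℕ) ^ (i + 1)), geomBound T (α * ((y : ℝ) * (U : ℝ) ^ 2))
  have hg : ∀ y, 0 ≤ g y := fun _ => sum_nonneg fun _ _ => geomBound_nonneg _ _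
  have hTTX : 16 * (k₀ : ℝ) * (T * 2 ^ i) ^ 2 ≤ X := by
    have hTx3 : T * 2 ^ i ≤ 2 * x := by linarith
    calc 16 * (k₀ : ℝ) * (T * 2 ^ i) ^ 2 ≤ 16 * K * (2 * x) ^ 2 := by gcongr
      _ ≤ 20000 * K * x ^ 2 := by
          nlinarith [mul_pos (by linarith : 0 < K) (by positivity : 0 < x ^ 2)]
      _ ≤ X := h.le_X
  have h2i1 : (1 : ℝ) ≤ 2 ^ i := one_le_pow₀ (by norm_num)
  have hsum : ∑ k ∈ Icc 1 k₀, ∑ l ∈ Icc 1 T, g (2 * (k * l)) ≤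
      L * (6500 * L ^ 3 * (T * ((2 * (k₀ * T) : ℕ) : ℝ) * ((2 ^ (i + 1) : ℕ) : ℝ)) *
        (1 / p ^ 4 + 1 / T)) := by
    calc _ ≤ L * ∑ z ∈ Icc 1 (k₀ * T), g (2 * z) := by
          refine h.divBound.sum_sum_mul_le k₀ T ?_ (fun z => g (2 * z)) (fun _ => hg _)
          refine le_trans ?_ hTTX
          push_cast
          have e1 : 16 * (k₀ : ℝ) * (T * 2 ^ i) ^ 2 = (k₀ * T) * (16 * T * (2 ^ i) ^ 2) := by ring
          rw [e1]
          refine le_mul_of_one_le_right (by positivity) ?_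
          nlinarith [one_le_pow₀ h2i1 (n := 2)]
      _ ≤ L * ∑ z ∈ Icc 1 (2 * (k₀ * T)), g z := by
          gcongr
          exact sum_Icc_mul_le hg one_le_two _
      _ ≤ _ := by
          gcongr
          refine sum_sum_geomBound_square_le (W := 2 ^ (i + 1)) h.divBound h.approx h.q_le hT1 ?_
            Nat.one_le_two_pow ?_ hp4 h.le_q ?_ ?_
          · have := Nat.mul_pos hK1 hT1
            omega
          · refine le_trans (le_of_eq ?_) hTTX
            push_cast; ring
          · refine h.q_mul_le.trans ?_
            push_cast
            calc K * x ^ 2 ≤ (2 * (k₀ : ℝ)) * ((2 : ℝ) ^ i * T) ^ 2 := by gcongr; linarith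
              _ ≤ 8 * (k₀ : ℝ) * ((2 : ℝ) ^ i * T) ^ 2 := by
                have : 0 ≤ (k₀ : ℝ) * (2 ^ i * T) ^ 2 := by positivity
                linarith
              _ = _ := by ring
          · intro hW
            push_cast at hW ⊢
            rw [pow_succ] at hW
            -- For short U the length T alone exceeds P³ with P = p⁴: from 2^i ≤ p⁸ and p²⁰ ≤ x one
            -- gets x / 2^i ≥ p¹². This is the reason for the exponent 20 in `p_le`.
            have h5 : (p ^ 4) ^ 3 ≤ T := by
              refine le_trans ?_ hTx.le
              rw [le_div_iff₀ h2i]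
              calc (p ^ 4) ^ 3 * 2 ^ i ≤ (p ^ 4) ^ 3 * (p ^ 4) ^ 2 := by gcongr; linarith
                _ = p ^ 20 := by ring
                _ ≤ x := h.p_le
            have h6 : (1 : ℝ) ≤ k₀ := by exact_mod_cast hK1
            nlinarith
  have hquad : ∑ U ∈ Ico ((2 : ℕ) ^ i) (2 ^ (i + 1)), ∑ k ∈ Icc 1 k₀,
      quadBound T (α * (U : ℝ) ^ 2 * k) ≤
      2 ^ i * K * T + 4 * (L * (6500 * L ^ 3 * (T * ((2 * (k₀ * T) : ℕ) : ℝ) *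
        ((2 ^ (i + 1) : ℕ) : ℝ)) * (1 / p ^ 4 + 1 / T))) := by
    unfold quadBound
    simp only [sum_add_distrib, ← mul_sum]
    have hcard : 2 ^ (i + 1) - 2 ^ i = 2 ^ i := by rw [pow_succ]; omega
    refine add_le_add ?_ ?_
    · simp only [sum_const, Nat.card_Ico, Nat.card_Icc, hcard, nsmul_eq_mul]
      push_cast
      rw [← mul_assoc]
      gcongr
    · gcongr
      refine le_trans ?_ hsum
      rw [sum_comm]
      refine sum_le_sum fun k _ => ?_
      rw [sum_comm]
      refine sum_le_sum fun l _ => ?_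
      simp only [g]
      have hsub : Ico ((2 : ℕ) ^ i) (2 ^ (i + 1)) ⊆ Icc 1 ((2 : ℕ) ^ (i + 1)) := by
        intro U hU
        rw [mem_Ico] at hU
        rw [mem_Icc]
        exact ⟨le_trans Nat.one_le_two_pow hU.1, hU.2.le⟩
      refine le_trans (le_of_eq ?_) (sum_le_sum_of_subset_of_nonneg hsub
        fun _ _ _ => geomBound_nonneg _ _)
      refine sum_congr rfl fun U _ => ?_
      congr 1; push_cast; ring
  set V : ℝ := 2 ^ i * K * T with hV
  have hV0 : 0 < V := by positivity
  have hquad' : ∑ U ∈ Ico ((2 : ℕ) ^ i) (2 ^ (i + 1)), ∑ k ∈ Icc 1 k₀,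
      quadBound T (α * (U : ℝ) ^ 2 * k) ≤ V * T * (460 * L ^ 2 / p ^ 2) ^ 2 := by
    refine hquad.trans ?_
    have e0 : 1 / (T : ℝ) ≤ 1 / p ^ 4 := by gcongr
    have e1 : V ≤ V * T / p ^ 4 := by
      rw [le_div_iff₀ (by positivity)]; gcongr
    have e2 : (1 : ℝ) ≤ L ^ 4 := one_le_pow₀ (by linarith)
    have e3 : 0 < V * T / p ^ 4 := by positivity
    calc _ ≤ V * T / p ^ 4 + 4 * (L * (6500 * L ^ 3 * (T * (2 * (K * T)) *
        (2 ^ (i + 1))) * (1 / p ^ 4 + 1 / p ^ 4))) := by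
          push_cast
          gcongr
      _ = V * T / p ^ 4 + 208000 * L ^ 4 * (V * T / p ^ 4) := by
          simp only [V]; ring
      _ ≤ 211600 * (L ^ 4 * (V * T / p ^ 4)) := by
          have := mul_le_mul_of_nonneg_right e2 e3.le
          nlinarith
      _ = _ := by ring
  have hcs : (∑ U ∈ Ico ((2 : ℕ) ^ i) (2 ^ (i + 1)), ∑ k ∈ Icc 1 k₀,
      √(quadBound T (α * (U : ℝ) ^ 2 * k))) ^ 2 ≤ (2 ^ i * K) *
      ∑ U ∈ Ico ((2 : ℕ) ^ i) (2 ^ (i + 1)), ∑ k ∈ Icc 1 k₀, quadBound T (α * (U : ℝ) ^ 2 * k) := by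
    have hcard : 2 ^ (i + 1) - 2 ^ i = 2 ^ i := by rw [pow_succ]; omega
    rw [← sum_product', ← sum_product' (f := fun (U k : ℕ) => quadBound T (α * (U : ℝ) ^ 2 * k))]
    refine sq_sum_le_card_mul_sum_sq.trans ?_
    simp only [Real.sq_sqrt (quadBound_nonneg _ _)]
    gcongr
    · exact sum_nonneg fun _ _ => quadBound_nonneg _ _
    · simp only [card_product, Nat.card_Ico, Nat.card_Icc, hcard]
      push_cast
      gcongr
  refine le_of_sq_le_sq ?_ (by positivity)
  calc _ ≤ _ := hcs
    _ ≤ (2 ^ i * K) * (V * T * (460 * L ^ 2 / p ^ 2) ^ 2) := by gcongr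
    _ = (K * (2 ^ i * T) * (460 * L ^ 2 / p ^ 2)) ^ 2 := by simp only [V]; ring
    _ ≤ (K * (2 * x) * (460 * L ^ 2 / p ^ 2)) ^ 2 := by gcongr
    _ = _ := by ring

open scoped Classical in
/-- The general term of the bilinear sums into which `WSum` is decomposed. -/
noncomputable def bilinearTerm (x α : ℝ) (b : ℤ) (lam : ℕ → ℂ) (c : ℤ → ℂ) (u v : ℕ → ℂ)
    (d : ℕ) (k : ℤ) (n m : ℕ) : ℂ :=
  if InDyadicProgression x b d (n * m) then
    lam d * c k * u n * v m * expChar (α * ((n * m : ℕ) : ℝ) ^ 2 * k) else 0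

/-- The sum over m is bounded in terms of U = nd only, so d and n merge into U at the cost of a
divisor factor, and U is then split dyadically. -/
lemma MinorArc.type_one (h : MinorArc X L α q x K p) {D N R : ℕ} {b : ℤ} {lam : ℕ → ℂ} {c : ℤ → ℂ}
    {u : ℕ → ℂ} {w : ℕ → ℝ} (hDN : (D : ℝ) * N * p ^ 4 ≤ x)
    (hlam : ∀ d ∈ Icc 1 D, ‖lam d‖ ≤ L) (hco : ∀ d ∈ Icc 1 D, lam d ≠ 0 → IsCoprime (d : ℤ) b)
    (hc : ∀ k ∈ nonzeroFrequencies K, ‖c k‖ ≤ L) (hu : ∀ n, ‖u n‖ ≤ L)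
    (huN : ∀ n, u n ≠ 0 → n ≤ N) (hw : ∀ i j, 1 ≤ i → i ≤ j → w i ≤ w j)
    (hw0 : ∀ i, 1 ≤ i → 0 ≤ w i) (hwL : ∀ i : ℕ, (i : ℝ) ≤ x → w i ≤ L) :
    ‖∑ d ∈ Icc 1 D, ∑ k ∈ nonzeroFrequencies K, ∑ n ∈ Icc 1 R, ∑ m ∈ Icc 1 R,
      bilinearTerm x α b lam c u (fun m => (w m : ℂ)) d k n m‖ ≤
      4000 * L ^ 8 * (K * x) / p ^ 2 := by
  classical
  have hL2 := h.divBound.two_le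
  have hL0 : 0 ≤ L := by linarith
  have hx := h.one_le_x
  -- The length depends only on the dyadic block of U, hence is constant where the average is taken.
  set T : ℕ → ℕ := fun U => ⌊x / 2 ^ (Nat.log 2 U)⌋₊ + 1
  set Q : ℕ → ℕ → ℝ := fun U k => √(quadBound (T U) (α * (U : ℝ) ^ 2 * k))
  have hQ : ∀ U k, 0 ≤ Q U k := fun _ _ => Real.sqrt_nonneg _
  have hterm : ∀ d ∈ Icc 1 D, ∀ k ∈ nonzeroFrequencies K, ∀ n ∈ Icc 1 R,
      ‖∑ m ∈ Icc 1 R, bilinearTerm x α b lam c u (fun m => (w m : ℂ)) d k n m‖ ≤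
      if n ∈ Icc 1 N then 2 * L ^ 4 * Q (n * d) k.natAbs else 0 := by
    intro d hd k hk n hn
    have hd1 : 1 ≤ d := (mem_Icc.1 hd).1
    have hn1 : 1 ≤ n := (mem_Icc.1 hn).1
    have e1 : ∑ m ∈ Icc 1 R, bilinearTerm x α b lam c u (fun m => (w m : ℂ)) d k n m =
        (lam d * c k * u n) * ∑ m ∈ Icc 1 R, if InDyadicProgression x b d (n * m) then
          (w m : ℂ) * expChar (α * ((n * m : ℕ) : ℝ) ^ 2 * k) else 0 := by
      rw [mul_sum]
      refine sum_congr rfl fun m _ => ?_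
      unfold bilinearTerm
      split_ifs <;> ring
    rw [e1]
    by_cases hu0 : u n = 0
    · rw [hu0]; simp only [mul_zero, zero_mul, norm_zero]
      split_ifs
      · have := hQ (n * d) k.natAbs
        positivity
      · exact le_rfl
    rw [if_pos (mem_Icc.2 ⟨hn1, huN n hu0⟩)]
    by_cases hl0 : lam d = 0
    · rw [hl0]; simp only [zero_mul, norm_zero]
      have := hQ (n * d) k.natAbs
      positivity
    have hT : ⌊x / (n * d : ℕ)⌋₊ + 1 ≤ T (n * d) := by
      simp only [T]
      gcongr
      exact_mod_cast Nat.pow_log_le_self 2 (Nat.mul_pos hn1 hd1).ne'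
    have h1 := norm_sum_progression_le (R := R) (k := k) (α := α) hd1 hn1 (hco d hd hl0) w hw
      hw0 hwL
      hL0 hT
    rw [quadBound_mul_natAbs] at h1
    rw [norm_mul, norm_mul, norm_mul]
    calc _ ≤ L * L * L * (2 * L * Q (n * d) k.natAbs) := by
          gcongr
          · exact hlam d hd
          · exact hc k hk
          · exact hu n
      _ = _ := by ring
  have hDNX : ((N * D : ℕ) : ℝ) ≤ x := by
    push_cast
    have := one_le_pow₀ h.one_le_p (n := 4)
    refine le_trans ?_ hDN
    rw [mul_comm (N : ℝ)]
    exact le_mul_of_one_le_right (by positivity) this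
  have hxX : x ≤ X := by
    refine le_trans ?_ h.le_X
    nlinarith [h.one_le_K, mul_le_mul h.one_le_K hx (by linarith) (by linarith [h.one_le_K])]
  calc _ ≤ ∑ d ∈ Icc 1 D, ∑ k ∈ nonzeroFrequencies K, ∑ n ∈ Icc 1 R,
        if n ∈ Icc 1 N then 2 * L ^ 4 * Q (n * d) k.natAbs else 0 := by
        refine (norm_sum_le _ _).trans (sum_le_sum fun d hd => ?_)
        refine (norm_sum_le _ _).trans (sum_le_sum fun k hk => ?_)
        exact (norm_sum_le _ _).trans (sum_le_sum fun n hn => hterm d hd k hk n hn)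
    _ ≤ ∑ d ∈ Icc 1 D, ∑ k ∈ nonzeroFrequencies K, ∑ n ∈ Icc 1 N,
        2 * L ^ 4 * Q (n * d) k.natAbs := by
        refine sum_le_sum fun d _ => sum_le_sum fun k _ => ?_
        rw [← sum_filter]
        refine sum_le_sum_of_subset_of_nonneg (fun n hn => (mem_filter.1 hn).2) fun n _ _ => ?_
        have := hQ (n * d) k.natAbs
        positivity
    _ = 2 * L ^ 4 * ∑ n ∈ Icc 1 N, ∑ d ∈ Icc 1 D, ∑ k ∈ nonzeroFrequencies K,
        Q (n * d) k.natAbs := by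
        simp only [mul_sum]
        rw [sum_comm (s := Icc 1 N)]
        exact sum_congr rfl fun d _ => sum_comm
    _ ≤ 2 * L ^ 4 * (L * ∑ U ∈ Icc 1 (N * D), ∑ k ∈ nonzeroFrequencies K, Q U k.natAbs) := by
        gcongr
        exact h.divBound.sum_sum_mul_le N D (hDNX.trans hxX)
          (fun U => ∑ k ∈ nonzeroFrequencies K, Q U k.natAbs)
          (fun _ => sum_nonneg fun _ _ => hQ _ _)
    _ ≤ 2 * L ^ 4 * (L * ∑ U ∈ Icc 1 (N * D), 2 * ∑ k ∈ Icc 1 ⌊K⌋₊, Q U k) := by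
        gcongr with U _
        exact sum_nonzeroFrequencies_le K (Q U) (hQ U)
    _ ≤ 2 * L ^ 4 * (L * (((Nat.log 2 (N * D) : ℕ) + 1) *
        (2 * (920 * L ^ 2 * (K * x) / p ^ 2)))) := by
        gcongr
        refine sum_dyadic_le _ (fun U => mul_nonneg zero_le_two (sum_nonneg fun _ _ => hQ _ _)) _ ?_
        intro i hi
        rw [← mul_sum]
        gcongr
        refine le_trans (le_of_eq ?_) (h.sum_sqrt_quadBound_dyadic_le (i := i) ?_ rfl)
        · refine sum_congr rfl fun U hU => ?_
          rw [mem_Ico] at hU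
          have hlog : Nat.log 2 U = i := Nat.log_eq_of_pow_le_of_lt_pow hU.1 hU.2
          simp only [Q, T, hlog]
        · rcases Nat.eq_zero_or_pos (N * D) with h0 | h0
          · rw [h0, Nat.log_zero_right, Nat.le_zero] at hi
            rw [hi, pow_zero, one_mul]
            exact (pow_le_pow_right₀ h.one_le_p (by norm_num)).trans h.p_le
          · have h1 : 2 ^ i ≤ N * D := (Nat.pow_le_pow_right two_pos hi).trans
              (Nat.pow_log_le_self 2 h0.ne')
            have h2 : (2 : ℝ) ^ i ≤ N * D := by exact_mod_cast h1
            refine le_trans ?_ hDN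
            have := h.one_le_p
            gcongr
            linarith
    _ ≤ 2 * L ^ 4 * (L * (L * (2 * (920 * L ^ 2 * (K * x) / p ^ 2)))) := by
        have := h.divBound.log_two_add_one_le (hDNX.trans hxX)
        have := h.one_le_K
        have := h.one_le_p
        gcongr
    _ = 3680 * (L ^ 8 * (K * x) / p ^ 2) := by ring
    _ ≤ 4000 * (L ^ 8 * (K * x) / p ^ 2) := by
        have := h.one_le_K
        have := h.one_le_p
        gcongr; norm_num
    _ = _ := by ring

end

/-! ### Type II sums: opening the square and congruent pairs. -/

lemma sum_norm_sum_mul_sq_le {ι κ : Type*} (I : Finset ι) (M : Finset κ) (z : ι → ℂ)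
    (f : ι → κ → ℂ) :
    ∑ m ∈ M, ‖∑ i ∈ I, z i * f i m‖ ^ 2 ≤
      ∑ i ∈ I, ∑ j ∈ I, ‖z i‖ * ‖z j‖ * ‖∑ m ∈ M, f i m * (starRingEnd ℂ) (f j m)‖ := by
  have h1 : ((∑ m ∈ M, ‖∑ i ∈ I, z i * f i m‖ ^ 2 : ℝ) : ℂ) =
      ∑ i ∈ I, ∑ j ∈ I, z i * (starRingEnd ℂ) (z j) *
        ∑ m ∈ M, f i m * (starRingEnd ℂ) (f j m) := by
    rw [Complex.ofReal_sum]
    have : ∀ m ∈ M, ((‖∑ i ∈ I, z i * f i m‖ ^ 2 : ℝ) : ℂ) = ∑ i ∈ I, ∑ j ∈ I,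
        z i * (starRingEnd ℂ) (z j) * (f i m * (starRingEnd ℂ) (f j m)) := by
      intro m _
      rw [Complex.ofReal_pow, ← Complex.mul_conj', map_sum, sum_mul_sum]
      refine sum_congr rfl fun i _ => sum_congr rfl fun j _ => ?_
      rw [map_mul]; ring
    rw [sum_congr rfl this, sum_comm]
    refine sum_congr rfl fun i _ => ?_
    rw [sum_comm]
    refine sum_congr rfl fun j _ => ?_
    rw [mul_sum]
  have h2 : ∑ m ∈ M, ‖∑ i ∈ I, z i * f i m‖ ^ 2 =
      ‖∑ i ∈ I, ∑ j ∈ I, z i * (starRingEnd ℂ) (z j) *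
        ∑ m ∈ M, f i m * (starRingEnd ℂ) (f j m)‖ := by
    rw [← h1, Complex.norm_real, Real.norm_of_nonneg (sum_nonneg fun _ _ => by positivity)]
  rw [h2]
  refine (norm_sum_le _ _).trans (sum_le_sum fun i _ => ?_)
  refine (norm_sum_le _ _).trans (sum_le_sum fun j _ => ?_)
  rw [norm_mul, norm_mul, Complex.norm_conj]

open scoped Classical in
/-- The phase `e(α (n m) ^ 2 k)` restricted to `n m ∼ x`, `n m ≡ b (mod d)`. -/
noncomputable def restrictedPhase (x α : ℝ) (b : ℤ) (k : ℤ) (d n m : ℕ) : ℂ :=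
  if InDyadicProgression x b d (n * m) then expChar (α * ((n * m : ℕ) : ℝ) ^ 2 * k) else 0

lemma InDyadicProgression.isCoprime {x : ℝ} {b : ℤ} {d n m : ℕ}
    (h : InDyadicProgression x b d (n * m)) (hco : IsCoprime (d : ℤ) b) :
    IsCoprime (d : ℤ) n ∧ IsCoprime (d : ℤ) m := by
  have h2 : IsCoprime (d : ℤ) ((n * m : ℕ) : ℤ) := by
    obtain ⟨t, ht⟩ := h.2.2.dvd
    have : ((n * m : ℕ) : ℤ) = b + d * (-t) := by linarith
    rw [this]
    exact hco.add_mul_left_right _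
  push_cast at h2
  exact ⟨h2.of_mul_right_left, h2.of_mul_right_right⟩

-- The two congruences confine m to one class modulo lcm(hs₁, hs₂) = h·lcm(s₁, s₂). Reducing both
-- modulo h gives n₁m ≡ n₂m with m invertible, so the sum is empty unless n₁ ≡ n₂ (mod h). This
-- congruence is the gain from keeping h outside the square.
open scoped Classical in
lemma norm_sum_restrictedPhase_mul_conj_le {x α : ℝ} {b k : ℤ} {h s₁ s₂ n₁ n₂ R T : ℕ}
    (hh : 1 ≤ h) (hs₁ : 1 ≤ s₁) (hs₂ : 1 ≤ s₂) {M : ℝ} (hM : ∀ m : ℕ,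
      ((n₁ * m : ℕ) : ℝ) < x → (m : ℝ) ≤ M)
    (hc₁ : IsCoprime ((h * s₁ : ℕ) : ℤ) b) (hc₂ : IsCoprime ((h * s₂ : ℕ) : ℤ) b)
    (hT : ⌊M / (h * s₁.lcm s₂ : ℕ)⌋₊ + 1 ≤ T) :
    ‖∑ m ∈ Icc 1 R, restrictedPhase x α b k (h * s₁) n₁ m *
      (starRingEnd ℂ) (restrictedPhase x α b k (h * s₂) n₂ m)‖ ≤
    if n₁ ≡ n₂ [MOD h] then
      √(quadBound T (α * ((h * s₁.lcm s₂ : ℕ) : ℝ) ^ 2 * ((n₁ : ℝ) ^ 2 - (n₂ : ℝ) ^ 2) * k))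
    else 0 := by
  set A := (Icc 1 R).filter fun m => InDyadicProgression x b (h * s₁) (n₁ * m) ∧
    InDyadicProgression x b (h * s₂) (n₂ * m)
  have hmem : ∀ m, m ∈ A ↔ (1 ≤ m ∧ m ≤ R) ∧ InDyadicProgression x b (h * s₁) (n₁ * m) ∧
    InDyadicProgression x b (h * s₂) (n₂ * m) := by
    intro m; simp only [A, mem_filter, mem_Icc]
  have hsumA : ∑ m ∈ Icc 1 R, restrictedPhase x α b k (h * s₁) n₁ m *
      (starRingEnd ℂ) (restrictedPhase x α b k (h * s₂) n₂ m) =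
      ∑ m ∈ A, expChar (α * ((n₁ : ℝ) ^ 2 - (n₂ : ℝ) ^ 2) * k * (m : ℝ) ^ 2) := by
    rw [sum_filter]
    refine sum_congr rfl fun m _ => ?_
    unfold restrictedPhase
    by_cases h1 : InDyadicProgression x b (h * s₁) (n₁ * m)
    · by_cases h2 : InDyadicProgression x b (h * s₂) (n₂ * m)
      · rw [if_pos h1, if_pos h2, if_pos ⟨h1, h2⟩, star_expChar, ← expChar_add]
        congr 1; push_cast; ring
      · simp [h1, h2]
    · simp [h1]
  rw [hsumA]
  have hu : h * s₁.lcm s₂ = (h * s₁).lcm (h * s₂) := (Nat.lcm_mul_left h s₁ s₂).symm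
  have hu1 : 1 ≤ h * s₁.lcm s₂ := Nat.mul_pos hh (Nat.lcm_pos hs₁ hs₂)
  by_cases hcong : n₁ ≡ n₂ [MOD h]
  · rw [if_pos hcong]
    have hclass : ∀ s n : ℕ, IsCoprime ((h * s : ℕ) : ℤ) b → ∀ a c : ℕ,
        InDyadicProgression x b (h * s) (n * a) → InDyadicProgression x b (h * s) (n * c) →
        a ≡ c [MOD h * s] := by
      intro s n hco a c ha hc
      have h3 := ha.2.2.trans hc.2.2.symm
      rw [Nat.modEq_iff_dvd]
      have h4 : ((h * s : ℕ) : ℤ) ∣ n * (c - a) := by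
        have := h3.dvd
        rw [mul_sub]
        simpa only [Nat.cast_mul] using this
      exact (ha.isCoprime hco).1.dvd_of_dvd_mul_left h4
    obtain ⟨m₀, N, hN, hNA, hsum⟩ := exists_sum_eq_sum_range A (u := h * s₁.lcm s₂) hu1 (M := M)
      (fun a ha => hM a ((hmem a).1 ha).2.1.2.1)
      (by
        intro a ha c hc
        rw [hmem] at ha hc
        have h1 := hclass s₁ n₁ hc₁ a c ha.2.1 hc.2.1
        have h2 := hclass s₂ n₂ hc₂ a c ha.2.2 hc.2.2
        rw [hu]
        rw [Nat.modEq_iff_dvd, Int.natCast_dvd] at h1 h2 ⊢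
        exact Nat.lcm_dvd h1 h2)
      (by
        intro a ha c hc m ham hmc hma
        rw [hmem] at ha hc ⊢
        have hstep : ∀ s n : ℕ, (h * s) ∣ h * s₁.lcm s₂ → InDyadicProgression x b (h * s) (n * a) →
            InDyadicProgression x b (h * s) (n * c) → InDyadicProgression x b (h * s) (n * m) := by
          intro s n hdvd h1 h2
          refine ⟨?_, ?_, ?_⟩
          · refine h1.1.trans ?_
            exact_mod_cast Nat.mul_le_mul_left n ham
          · refine lt_of_le_of_lt ?_ h2.2.1
            exact_mod_cast Nat.mul_le_mul_left n hmc
          · refine Int.ModEq.trans ?_ h1.2.2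
            exact_mod_cast (Nat.ModEq.mul_left n (hma.of_dvd hdvd))
        exact ⟨by omega, hstep s₁ n₁ (Nat.mul_dvd_mul_left h (Nat.dvd_lcm_left _ _)) ha.2.1 hc.2.1,
          hstep s₂ n₂ (Nat.mul_dvd_mul_left h (Nat.dvd_lcm_right _ _)) ha.2.2 hc.2.2⟩)
    rw [hsum]
    convert norm_sum_le_sqrt_quadBound N T (hN.trans hT)
      (α * ((h * s₁.lcm s₂ : ℕ) : ℝ) ^ 2 * ((n₁ : ℝ) ^ 2 - (n₂ : ℝ) ^ 2) * k)
      (2 * α * ((n₁ : ℝ) ^ 2 - (n₂ : ℝ) ^ 2) * k * m₀ * ((h * s₁.lcm s₂ : ℕ) : ℝ))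
      (α * ((n₁ : ℝ) ^ 2 - (n₂ : ℝ) ^ 2) * k * m₀ ^ 2) using 4 with t _
    push_cast; ring
  · rw [if_neg hcong]
    have : A = ∅ := by
      rw [eq_empty_iff_forall_notMem]
      intro m hm
      rw [hmem] at hm
      apply hcong
      have hred : ∀ s n : ℕ, InDyadicProgression x b (h * s) (n * m) →
          ((n * m : ℕ) : ℤ) ≡ b [ZMOD (h : ℤ)] := fun s n hp =>
        hp.2.2.of_dvd (by push_cast; exact Dvd.intro _ rfl)
      have h3 := (hred s₁ n₁ hm.2.1).trans (hred s₂ n₂ hm.2.2).symm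
      have h4 : IsCoprime (h : ℤ) m := by
        have h5 := (hm.2.1.isCoprime hc₁).2
        push_cast at h5
        exact h5.of_mul_left_left
      rw [Nat.modEq_iff_dvd]
      refine h4.dvd_of_dvd_mul_right ?_
      have := h3.dvd
      push_cast at this
      rwa [sub_mul]
    rw [this]; simp

namespace DivBound

variable {X L : ℝ}

/-- Grouping a double sum according to the least common multiple of the variables. -/
lemma sum_sum_lcm_le (h : DivBound X L) (S : ℕ) (hS : ((S ^ 2 : ℕ) : ℝ) ≤ X) (f : ℕ → ℝ)
    (hf : ∀ n, 0 ≤ f n) :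
    ∑ a ∈ Icc 1 S, ∑ b ∈ Icc 1 S, f (a.lcm b) ≤ L ^ 2 * ∑ z ∈ Icc 1 (S ^ 2), f z := by
  rw [← sum_product', mul_sum]
  have hmap : ∀ p ∈ Icc 1 S ×ˢ Icc 1 S, p.1.lcm p.2 ∈ Icc 1 (S ^ 2) := by
    intro p hp
    simp only [mem_product, mem_Icc] at hp ⊢
    refine ⟨Nat.lcm_pos hp.1.1 hp.2.1, (Nat.le_of_dvd (Nat.mul_pos hp.1.1 hp.2.1)
      (Nat.lcm_dvd_mul _ _)).trans ?_⟩
    rw [sq]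
    exact Nat.mul_le_mul hp.1.2 hp.2.2
  rw [← sum_fiberwise_of_maps_to hmap]
  refine sum_le_sum fun z hz => ?_
  rw [mem_Icc] at hz
  rw [sum_congr rfl (g := fun _ => f z) fun p hp => by rw [(mem_filter.1 hp).2], sum_const,
    nsmul_eq_mul]
  refine mul_le_mul_of_nonneg_right ?_ (hf z)
  have hcard := h.card_le z (by omega) (le_trans (by exact_mod_cast hz.2) hS)
  have h1 : #{p ∈ Icc 1 S ×ˢ Icc 1 S | p.1.lcm p.2 = z} ≤ #(z.divisors ×ˢ z.divisors) := by
    refine card_le_card fun p hp => ?_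
    rw [mem_filter] at hp
    rw [mem_product, Nat.mem_divisors, Nat.mem_divisors, ← hp.2]
    exact ⟨⟨Nat.dvd_lcm_left _ _, by rw [hp.2]; omega⟩,
      ⟨Nat.dvd_lcm_right _ _, by rw [hp.2]; omega⟩⟩
  rw [card_product] at h1
  calc ((#{p ∈ Icc 1 S ×ˢ Icc 1 S | p.1.lcm p.2 = z} : ℕ) : ℝ) ≤
        ((#z.divisors * #z.divisors : ℕ) : ℝ) := by exact_mod_cast h1
    _ = (#z.divisors : ℝ) * #z.divisors := by push_cast; rfl
    _ ≤ L * L := by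
        have := h.two_le
        gcongr
    _ = L ^ 2 := by ring

end DivBound

/-- Sums over pairs of congruent integers in a dyadic interval, in terms of the difference and the
sum of the two integers. -/
lemma sum_sum_modEq_le {𝓝 : Finset ℕ} {N : ℝ} (hN : ∀ n ∈ 𝓝, N ≤ n ∧ (n : ℝ) < 2 * N) {h : ℕ}
    {H : ℝ} (hH : 0 < H) (hHh : H ≤ h) (F : ℝ → ℝ) (hF : ∀ z, 0 ≤ F z) (heven : ∀ z, F (-z) = F z) :
    ∑ n₁ ∈ 𝓝, ∑ n₂ ∈ 𝓝, (if n₁ ≡ n₂ [MOD h] then F ((n₁ : ℝ) ^ 2 - (n₂ : ℝ) ^ 2) else 0) ≤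
      𝓝.card * F 0 + 2 * ∑ r ∈ Icc 1 ⌊N / H⌋₊, ∑ n ∈ Icc 1 ⌊4 * N⌋₊, F (h * (r * n)) := by
  set G : ℕ → ℕ → ℝ := fun n₁ n₂ =>
    if n₁ ≡ n₂ [MOD h] then F ((n₁ : ℝ) ^ 2 - (n₂ : ℝ) ^ 2) else 0
  have hG : ∀ a b, 0 ≤ G a b := by
    intro a b; simp only [G]; split_ifs; exacts [hF _, le_rfl]
  have hGsymm : ∀ a b, G a b = G b a := by
    intro a b
    simp only [G, Nat.ModEq.comm (a := a) (b := b)]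
    split_ifs
    · rw [← heven]; congr 1; ring
    · rfl
  have hGdiag : ∀ a, G a a = F 0 := by
    intro a; simp [G, Nat.ModEq.refl]
  have hh0 : 0 < h := by
    have : (0 : ℝ) < h := hH.trans_le hHh
    exact_mod_cast this
  have hlt : ∑ n₁ ∈ 𝓝, ∑ n₂ ∈ 𝓝 with n₂ < n₁, G n₁ n₂ ≤
      ∑ r ∈ Icc 1 ⌊N / H⌋₊, ∑ n ∈ Icc 1 ⌊4 * N⌋₊, F (h * (r * n)) := by
    have e1 : ∑ n₁ ∈ 𝓝, ∑ n₂ ∈ 𝓝 with n₂ < n₁, G n₁ n₂ =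
        ∑ p ∈ (𝓝 ×ˢ 𝓝).filter (fun p => p.2 < p.1 ∧ p.1 ≡ p.2 [MOD h]),
          F ((p.1 : ℝ) ^ 2 - (p.2 : ℝ) ^ 2) := by
      rw [← filter_filter, sum_filter, sum_filter, sum_product]
      simp only [sum_filter, G]
    rw [e1, ← sum_product']
    -- With j = (n₁ - n₂)/h and n = n₁ + n₂ the difference of squares becomes the product h·j·n. The
    -- pair is recovered from (j, n), and j ≤ N/H because n₁ - n₂ < N.
    set φ : ℕ × ℕ → ℕ × ℕ := fun p => ((p.1 - p.2) / h, p.1 + p.2)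
    have hdiv : ∀ p ∈ (𝓝 ×ˢ 𝓝).filter (fun p => p.2 < p.1 ∧ p.1 ≡ p.2 [MOD h]),
        h * ((p.1 - p.2) / h) = p.1 - p.2 := by
      intro p hp
      rw [mem_filter] at hp
      exact Nat.mul_div_cancel' ((Nat.modEq_iff_dvd' hp.2.1.le).1 hp.2.2.symm)
    have hinj : Set.InjOn φ ((𝓝 ×ˢ 𝓝).filter (fun p => p.2 < p.1 ∧ p.1 ≡ p.2 [MOD h]) :
        Finset (ℕ × ℕ)) := by
      intro p hp p' hp' hpp
      have h1 := hdiv p hp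
      have h2 := hdiv p' hp'
      simp only [φ, Prod.mk.injEq] at hpp
      rw [hpp.1] at h1
      have h3 := (mem_filter.1 (mem_coe.1 hp)).2.1
      have h4 := (mem_filter.1 (mem_coe.1 hp')).2.1
      ext <;> omega
    have hval : ∀ p ∈ (𝓝 ×ˢ 𝓝).filter (fun p => p.2 < p.1 ∧ p.1 ≡ p.2 [MOD h]),
        F ((p.1 : ℝ) ^ 2 - (p.2 : ℝ) ^ 2) = F (h * (((φ p).1 : ℝ) * (φ p).2)) := by
      intro p hp
      have h1 := hdiv p hp
      have h3 := (mem_filter.1 hp).2.1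
      congr 1
      have h2 : (h : ℝ) * (((p.1 - p.2) / h : ℕ) : ℝ) = (p.1 : ℝ) - p.2 := by
        rw [← Nat.cast_sub h3.le]; exact_mod_cast h1
      simp only [φ]
      rw [← mul_assoc, h2]; push_cast; ring
    rw [sum_congr rfl hval, ← sum_image (f := fun i : ℕ × ℕ => F (h * ((i.1 : ℝ) * i.2))) hinj]
    refine sum_le_sum_of_subset_of_nonneg ?_ fun _ _ _ => hF _
    intro i hi
    obtain ⟨p, hp, rfl⟩ := mem_image.1 hi
    have h1 := hdiv p hp
    rw [mem_filter, mem_product] at hp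
    have h3 := hN _ hp.1.1
    have h4 := hN _ hp.1.2
    have h5 : 1 ≤ (p.1 - p.2) / h := by
      rw [Nat.one_le_iff_ne_zero]; intro h0; rw [h0] at h1; omega
    simp only [mem_product, mem_Icc, φ]
    refine ⟨⟨h5, Nat.le_floor ?_⟩, by omega, Nat.le_floor (by push_cast; linarith)⟩
    rw [le_div_iff₀ hH]
    have h2 : (h : ℝ) * (((p.1 - p.2) / h : ℕ) : ℝ) = (p.1 : ℝ) - p.2 := by
      rw [← Nat.cast_sub hp.2.1.le]; exact_mod_cast h1
    have h6 : (((p.1 - p.2) / h : ℕ) : ℝ) * H ≤ (((p.1 - p.2) / h : ℕ) : ℝ) * h := by gcongr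
    linarith
  have hsplit : ∑ n₁ ∈ 𝓝, ∑ n₂ ∈ 𝓝, G n₁ n₂ = ∑ n₁ ∈ 𝓝, G n₁ n₁ +
      (∑ n₁ ∈ 𝓝, ∑ n₂ ∈ 𝓝 with n₂ < n₁, G n₁ n₂ + ∑ n₁ ∈ 𝓝, ∑ n₂ ∈ 𝓝 with n₁ < n₂, G n₁ n₂) := by
    rw [← sum_add_distrib, ← sum_add_distrib]
    refine sum_congr rfl fun n₁ hn₁ => ?_
    rw [sum_filter, sum_filter, ← sum_add_distrib]
    have : G n₁ n₁ = ∑ n₂ ∈ 𝓝, if n₂ = n₁ then G n₁ n₂ else 0 := by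
      rw [sum_ite_eq' 𝓝 n₁]; simp [hn₁]
    rw [this, ← sum_add_distrib]
    refine sum_congr rfl fun n₂ _ => ?_
    rcases lt_trichotomy n₂ n₁ with hlt | heq | hgt
    · simp [hlt, hlt.ne, hlt.not_gt]
    · simp [heq]
    · simp [hgt, hgt.ne', hgt.not_gt]
  have hgt : ∑ n₁ ∈ 𝓝, ∑ n₂ ∈ 𝓝 with n₁ < n₂, G n₁ n₂ =
      ∑ n₁ ∈ 𝓝, ∑ n₂ ∈ 𝓝 with n₂ < n₁, G n₁ n₂ := by
    simp only [sum_filter]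
    rw [sum_comm]
    refine sum_congr rfl fun a _ => sum_congr rfl fun b _ => ?_
    rw [hGsymm]
  rw [hsplit, hgt, sum_congr rfl fun a _ => hGdiag a, sum_const, nsmul_eq_mul]
  linarith

/-! ### Type II sums: averaging after Cauchy–Schwarz. -/

section

variable {X L α x K r : ℝ} {q : ℕ}

/-- Cauchy–Schwarz over all five variables halves the exponent of the saving r⁴. After differencing
with shift l, the variables j, n, k, l group into y = 2jnkl at the cost of L³, leaving α y a³ w².
The average over y, a, w is taken as the hypothesis `hG`, since it is proved differently for trivial
and for long ranges of a. -/
lemma MinorArc.sum_sqrt_quadBound_cube_dyadic_le (h : MinorArc X L α q x K (r ^ 4)) (hr : 1 ≤ r)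
    {N : ℝ} {H i T : ℕ} (hH : 1 ≤ H) (hHN : H ≤ N) {𝓗 : Finset ℕ}
    (h𝓗 : ∀ a ∈ 𝓗, H ≤ a ∧ a < 2 * H) (hT : T = ⌊x / N / (H * 2 ^ i : ℕ)⌋₊ + 1)
    (hrT : r ^ 4 ≤ T) (hTx : (2 : ℝ) ^ i * T ≤ 2 * (x / N) / H)
    (hG : ∑ y ∈ Icc 1 (2 * (⌊N / H⌋₊ * ⌊4 * N⌋₊ * ⌊K⌋₊ * T)), ∑ a ∈ 𝓗,
      ∑ w ∈ Icc 1 ((2 : ℕ) ^ (i + 1)), geomBound T (α * (y * (a : ℝ) ^ 3 * (w : ℝ) ^ 2)) ≤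
      26000 * L ^ 3 * (T * ((2 * (⌊N / H⌋₊ * ⌊4 * N⌋₊ * ⌊K⌋₊ * T) : ℕ) : ℝ) * H * 2 ^ i) / r ^ 4) :
    ∑ w ∈ Ico ((2 : ℕ) ^ i) (2 ^ (i + 1)), ∑ k ∈ Icc 1 ⌊K⌋₊, ∑ a ∈ 𝓗,
      ∑ j ∈ Icc 1 ⌊N / H⌋₊, ∑ n ∈ Icc 1 ⌊4 * N⌋₊,
        √(quadBound T (α * ((a * w : ℕ) : ℝ) ^ 2 * (a * (j * n)) * k)) ≤
      3660 * L ^ 3 * (K * N * x / H) / r ^ 2 := by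
  have hL2 := h.divBound.two_le
  have hx := h.one_le_x
  have hK := h.one_le_K
  have hH' : (1 : ℝ) ≤ H := by exact_mod_cast hH
  have hN1 : 1 ≤ N := hH'.trans hHN
  have hT1 : 1 ≤ T := by omega
  have hT1' : (1 : ℝ) ≤ T := by exact_mod_cast hT1
  have hK' : (⌊K⌋₊ : ℝ) ≤ K := Nat.floor_le (by linarith)
  have hNH' : (⌊N / H⌋₊ : ℝ) ≤ N / H := Nat.floor_le (by positivity)
  have h4N' : (⌊4 * N⌋₊ : ℝ) ≤ 4 * N := Nat.floor_le (by positivity)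
  set k₀ := ⌊K⌋₊
  set j₀ := ⌊N / H⌋₊
  set n₀ := ⌊4 * N⌋₊
  have h2i : (1 : ℝ) ≤ 2 ^ i := one_le_pow₀ (by norm_num)
  set g : ℕ → ℝ := fun y => ∑ a ∈ 𝓗, ∑ w ∈ Icc 1 ((2 : ℕ) ^ (i + 1)),
    geomBound T (α * (y * (a : ℝ) ^ 3 * (w : ℝ) ^ 2))
  have hg : ∀ y, 0 ≤ g y :=
    fun _ => sum_nonneg fun _ _ => sum_nonneg fun _ _ => geomBound_nonneg _ _
  have hcard𝓗 : (𝓗.card : ℝ) ≤ H := by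
    have : 𝓗 ⊆ Ico H (2 * H) := fun a ha => mem_Ico.2 (h𝓗 a ha)
    have := card_le_card this
    rw [Nat.card_Ico] at this
    exact_mod_cast this.trans (by omega)
  have hTle : (T : ℝ) ≤ 2 * x := by
    have h1 : (T : ℝ) ≤ 2 ^ i * T := le_mul_of_one_le_left (by linarith) h2i
    have h2 : 2 * (x / N) / H ≤ 2 * x := by
      rw [div_le_iff₀ (by linarith)]
      have : x / N ≤ x := div_le_self (by linarith) hN1
      nlinarith
    linarith
  have hNx : N ≤ 2 * x := by
    have h1 : (1 : ℝ) ≤ 2 * (x / N) / H := by nlinarith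
    rw [le_div_iff₀ (by linarith)] at h1
    have h2 : 1 ≤ 2 * (x / N) := by linarith
    have h3 : 2 * (x / N) = 2 * x / N := by ring
    rw [h3, le_div_iff₀ (by linarith)] at h2
    linarith
  have hNT : N * T ≤ 2 * x := by
    have h1 : (T : ℝ) ≤ 2 ^ i * T := le_mul_of_one_le_left (by linarith) h2i
    have h2 : 2 * (x / N) / H ≤ 2 * (x / N) := div_le_self (by positivity) hH'
    have h3 : (T : ℝ) ≤ 2 * x / N := by
      rw [show 2 * x / N = 2 * (x / N) by ring]; linarith
    rw [le_div_iff₀ (by linarith)] at h3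
    linarith
  have hYX : ((j₀ * n₀ * k₀ * T : ℕ) : ℝ) ≤ X := by
    push_cast
    calc (j₀ : ℝ) * n₀ * k₀ * T ≤ N * (4 * N) * K * T := by
          gcongr
          exact hNH'.trans (div_le_self (by linarith) hH')
      _ = 4 * K * N * (N * T) := by ring
      _ ≤ 4 * K * (2 * x) * (2 * x) := by gcongr
      _ ≤ 20000 * K * x ^ 2 := by
          have : 0 ≤ K * x ^ 2 := by positivity
          nlinarith
      _ ≤ X := h.le_X
  have hle : ∀ n : ℕ, n ≤ j₀ * n₀ * k₀ * T → (n : ℝ) ≤ X := fun n hn =>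
    le_trans (by exact_mod_cast hn) hYX
  have hk1 : 1 ≤ k₀ := h.one_le_floor_K
  set V : ℝ := K * N ^ 2 * 2 ^ i with hV
  have hV0 : 0 < V := by positivity
  have hsum : ∑ j ∈ Icc 1 j₀, ∑ n ∈ Icc 1 n₀, ∑ k ∈ Icc 1 k₀, ∑ l ∈ Icc 1 T,
      g (2 * (j * n * k * l)) ≤ 208000 * L ^ 6 * (V * T ^ 2 / r ^ 4) := by
    calc _ ≤ L * ∑ z ∈ Icc 1 (j₀ * n₀), ∑ k ∈ Icc 1 k₀, ∑ l ∈ Icc 1 T, g (2 * (z * k * l)) := by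
          refine h.divBound.sum_sum_mul_le j₀ n₀ (hle _ ?_) (fun z => ∑ k ∈ Icc 1 k₀,
            ∑ l ∈ Icc 1 T, g (2 * (z * k * l)))
            (fun _ => sum_nonneg fun _ _ => sum_nonneg fun _ _ => hg _)
          rw [mul_assoc _ k₀ T]
          exact Nat.le_mul_of_pos_right _ (Nat.mul_pos hk1 hT1)
      _ ≤ L * (L * ∑ z ∈ Icc 1 (j₀ * n₀ * k₀), ∑ l ∈ Icc 1 T, g (2 * (z * l))) := by
          gcongr
          refine h.divBound.sum_sum_mul_le (j₀ * n₀) k₀ (hle _ ?_) (fun z => ∑ l ∈ Icc 1 T,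
            g (2 * (z * l))) (fun _ => sum_nonneg fun _ _ => hg _)
          exact Nat.le_mul_of_pos_right _ hT1
      _ ≤ L * (L * (L * ∑ z ∈ Icc 1 (j₀ * n₀ * k₀ * T), g (2 * z))) := by
          gcongr
          exact h.divBound.sum_sum_mul_le (j₀ * n₀ * k₀) T (hle _ le_rfl) (fun z => g (2 * z))
            (fun _ => hg _)
      _ ≤ L * (L * (L * ∑ z ∈ Icc 1 (2 * (j₀ * n₀ * k₀ * T)), g z)) := by
          gcongr
          exact sum_Icc_mul_le hg one_le_two _
      _ ≤ L * (L * (L * (26000 * L ^ 3 *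
          (T * ((2 * (j₀ * n₀ * k₀ * T) : ℕ) : ℝ) * H * 2 ^ i) / r ^ 4))) := by
          gcongr
      _ ≤ L * (L * (L * (26000 * L ^ 3 *
          (T * (2 * (N / H * (4 * N) * K * T)) * H * 2 ^ i) / r ^ 4))) := by
          push_cast
          gcongr
      _ = _ := by simp only [V]; field_simp; norm_num
  have hsub : Ico ((2 : ℕ) ^ i) (2 ^ (i + 1)) ⊆ Icc 1 ((2 : ℕ) ^ (i + 1)) := by
    intro U hU
    rw [mem_Ico] at hU
    rw [mem_Icc]
    exact ⟨le_trans Nat.one_le_two_pow hU.1, hU.2.le⟩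
  set I := Ico ((2 : ℕ) ^ i) (2 ^ (i + 1)) ×ˢ Icc 1 k₀ ×ˢ 𝓗 ×ˢ Icc 1 j₀ ×ˢ Icc 1 n₀
  have hcardI : (I.card : ℝ) ≤ 4 * V := by
    have hcard : 2 ^ (i + 1) - 2 ^ i = 2 ^ i := by rw [pow_succ]; omega
    simp only [I, card_product, Nat.card_Ico, Nat.card_Icc, hcard, Nat.add_sub_cancel]
    push_cast
    calc (2 : ℝ) ^ i * (k₀ * (𝓗.card * (j₀ * n₀))) ≤ 2 ^ i * (K * (H * (N / H * (4 * N)))) := by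
          gcongr
      _ = _ := by simp only [V]; field_simp
  have hquad : ∑ w ∈ Ico ((2 : ℕ) ^ i) (2 ^ (i + 1)), ∑ k ∈ Icc 1 k₀, ∑ a ∈ 𝓗,
      ∑ j ∈ Icc 1 j₀, ∑ n ∈ Icc 1 n₀,
        quadBound T (α * ((a * w : ℕ) : ℝ) ^ 2 * (a * (j * n)) * k) ≤
      4 * V * T + 4 * (208000 * L ^ 6 * (V * T ^ 2 / r ^ 4)) := by
    unfold quadBound
    simp only [sum_add_distrib, ← mul_sum]
    refine add_le_add ?_ ?_
    · refine le_trans (le_of_eq ?_) (mul_le_mul_of_nonneg_right hcardI (by linarith : (0 : ℝ) ≤ T))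
      simp only [I, card_product, sum_const, nsmul_eq_mul]
      push_cast; ring
    · gcongr
      refine le_trans ?_ hsum
      have hre : ∑ j ∈ Icc 1 j₀, ∑ n ∈ Icc 1 n₀, ∑ k ∈ Icc 1 k₀, ∑ l ∈ Icc 1 T,
          g (2 * (j * n * k * l)) = ∑ w ∈ Icc 1 ((2 : ℕ) ^ (i + 1)), ∑ k ∈ Icc 1 k₀, ∑ a ∈ 𝓗,
          ∑ j ∈ Icc 1 j₀, ∑ n ∈ Icc 1 n₀, ∑ l ∈ Icc 1 T,
          geomBound T (2 * (α * ((a * w : ℕ) : ℝ) ^ 2 * (a * (j * n)) * k) * l) := by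
        have e : ∀ a w j n k l : ℕ, 2 * (α * ((a * w : ℕ) : ℝ) ^ 2 * (a * (j * n)) * k) * l =
            α * (((2 * (j * n * k * l) : ℕ) : ℝ) * (a : ℝ) ^ 3 * (w : ℝ) ^ 2) := by
          intro a w j n k l; push_cast; ring
        simp only [g, e]
        simp only [← sum_product']
        refine sum_nbij' (fun z => (z.2.2.2.2.2, z.2.2.1, z.2.2.2.2.1, z.1, z.2.1, z.2.2.2.1))
          (fun z => (z.2.2.2.1, z.2.2.2.2.1, z.2.1, z.2.2.2.2.2, z.2.2.1, z.1)) ?_ ?_ ?_ ?_ ?_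
        · intro z hz; simp only [mem_product] at hz ⊢; tauto
        · intro z hz; simp only [mem_product] at hz ⊢; tauto
        · intro z _; rfl
        · intro z _; rfl
        · intro z _; rfl
      rw [hre]
      exact sum_le_sum_of_subset_of_nonneg hsub fun _ _ _ => sum_nonneg fun _ _ =>
        sum_nonneg fun _ _ => sum_nonneg fun _ _ => sum_nonneg fun _ _ => sum_nonneg fun _ _ =>
        geomBound_nonneg _ _
  have hquad' : 4 * V * T + 4 * (208000 * L ^ 6 * (V * T ^ 2 / r ^ 4)) ≤
      913 ^ 2 * L ^ 6 * (V * T ^ 2 / r ^ 4) := by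
    have e1 : V * T ≤ V * T ^ 2 / r ^ 4 := by
      rw [le_div_iff₀ (by positivity), sq, ← mul_assoc]
      gcongr
    have e2 : (1 : ℝ) ≤ L ^ 6 := one_le_pow₀ (by linarith)
    have e3 : 0 < V * T ^ 2 / r ^ 4 := by positivity
    have e4 := mul_le_mul_of_nonneg_right e2 e3.le
    linarith
  have hcs : (∑ w ∈ Ico ((2 : ℕ) ^ i) (2 ^ (i + 1)), ∑ k ∈ Icc 1 k₀, ∑ a ∈ 𝓗,
      ∑ j ∈ Icc 1 j₀, ∑ n ∈ Icc 1 n₀,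
        √(quadBound T (α * ((a * w : ℕ) : ℝ) ^ 2 * (a * (j * n)) * k))) ^ 2 ≤
      4 * V * (4 * V * T + 4 * (208000 * L ^ 6 * (V * T ^ 2 / r ^ 4))) := by
    refine le_trans ?_ (mul_le_mul hcardI hquad (sum_nonneg fun _ _ => sum_nonneg fun _ _ =>
      sum_nonneg fun _ _ => sum_nonneg fun _ _ => sum_nonneg fun _ _ => quadBound_nonneg _ _)
      (by positivity))
    simp only [← sum_product']
    refine sq_sum_le_card_mul_sum_sq.trans_eq ?_
    simp only [Real.sq_sqrt (quadBound_nonneg _ _), I]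
  refine le_of_sq_le_sq ?_ (by positivity)
  calc _ ≤ _ := hcs
    _ ≤ 4 * V * (913 ^ 2 * L ^ 6 * (V * T ^ 2 / r ^ 4)) := by
        gcongr
    _ = (1826 * L ^ 3 * (K * N ^ 2 * (2 ^ i * T)) / r ^ 2) ^ 2 := by simp only [V]; ring
    _ ≤ (1830 * L ^ 3 * (K * N ^ 2 * (2 * (x / N) / H)) / r ^ 2) ^ 2 := by
        gcongr; norm_num
    _ = _ := by congr 1; field_simp; norm_num

/-- This collects the diagonal n₁ = n₂, estimated trivially, and the off-diagonal pairs, estimated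
on average, over dyadic blocks of w = lcm(s₁, s₂). -/
lemma MinorArc.sum_pairs_le (h : MinorArc X L α q x K (r ^ 4)) (hr : 1 ≤ r)
    {N : ℝ} {H S : ℕ} (hH : 1 ≤ H) (hHN : H * r ^ 2 ≤ N) {𝓗 : Finset ℕ}
    (h𝓗 : ∀ a ∈ 𝓗, H ≤ a ∧ a < 2 * H) {cardN : ℝ} (hcardN : cardN ≤ 2 * N)
    (hM : (H : ℝ) * S ^ 2 * (r ^ 4) ^ 4 ≤ x / N) (hS : 1 ≤ S)
    (hG : ∀ i ≤ Nat.log 2 (S ^ 2), ∀ T : ℕ, T = ⌊x / N / (H * 2 ^ i : ℕ)⌋₊ + 1 →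
      ∑ y ∈ Icc 1 (2 * (⌊N / H⌋₊ * ⌊4 * N⌋₊ * ⌊K⌋₊ * T)), ∑ a ∈ 𝓗,
      ∑ w ∈ Icc 1 ((2 : ℕ) ^ (i + 1)), geomBound T (α * (y * (a : ℝ) ^ 3 * (w : ℝ) ^ 2)) ≤
      26000 * L ^ 3 * (T * ((2 * (⌊N / H⌋₊ * ⌊4 * N⌋₊ * ⌊K⌋₊ * T) : ℕ) : ℝ) * H * 2 ^ i) / r ^ 4)
    {T : ℕ → ℕ} (hT : ∀ w, T w = ⌊x / N / (H * 2 ^ Nat.log 2 w : ℕ)⌋₊ + 1) :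
    ∑ w ∈ Icc 1 (S ^ 2), ∑ k ∈ Icc 1 ⌊K⌋₊, ∑ a ∈ 𝓗,
      (cardN * √(quadBound (T w) (α * ((a * w : ℕ) : ℝ) ^ 2 * 0 * k)) +
        2 * ∑ j ∈ Icc 1 ⌊N / H⌋₊, ∑ n ∈ Icc 1 ⌊4 * N⌋₊,
        √(quadBound (T w) (α * ((a * w : ℕ) : ℝ) ^ 2 * (a * (j * n)) * k))) ≤
      7400 * L ^ 4 * (K * N * x / H) / r ^ 2 := by
  have hL2 := h.divBound.two_le
  have hx := h.one_le_x
  have hK := h.one_le_K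
  have hH' : (1 : ℝ) ≤ H := by exact_mod_cast hH
  have hS' : (1 : ℝ) ≤ S := by exact_mod_cast hS
  have hr2 : 1 ≤ r ^ 2 := one_le_pow₀ hr
  have hr4 : 1 ≤ r ^ 4 := one_le_pow₀ hr
  have hHN' : (H : ℝ) ≤ N := by nlinarith
  have hN1 : 1 ≤ N := hH'.trans hHN'
  have hK' : (⌊K⌋₊ : ℝ) ≤ K := Nat.floor_le (by linarith)
  have hr16 : r ^ 4 ≤ (r ^ 4) ^ 4 := le_self_pow₀ hr4 (by norm_num)
  have hS2x : ((S ^ 2 : ℕ) : ℝ) ≤ X := by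
    have h1 : (S : ℝ) ^ 2 ≤ x / N := by
      refine le_trans ?_ hM
      have : (1 : ℝ) ≤ (r ^ 4) ^ 4 := one_le_pow₀ hr4
      calc (S : ℝ) ^ 2 = 1 * S ^ 2 * 1 := by ring
        _ ≤ _ := by gcongr
    have h2 : x / N ≤ x := div_le_self (by linarith) hN1
    have h3 : x ≤ 20000 * K * x ^ 2 := by nlinarith [mul_le_mul hK hx (by linarith) (by linarith)]
    push_cast
    linarith [h.le_X]
  have hlog := h.divBound.log_two_add_one_le hS2x
  have hcard𝓗 : (𝓗.card : ℝ) ≤ H := by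
    have : 𝓗 ⊆ Ico H (2 * H) := fun a ha => mem_Ico.2 (h𝓗 a ha)
    have := card_le_card this
    rw [Nat.card_Ico] at this
    exact_mod_cast this.trans (by omega)
  have hnn : ∀ w, 0 ≤ ∑ k ∈ Icc 1 ⌊K⌋₊, ∑ a ∈ 𝓗,
      (2 * N * √(quadBound (T w) (α * ((a * w : ℕ) : ℝ) ^ 2 * 0 * k)) +
        2 * ∑ j ∈ Icc 1 ⌊N / H⌋₊, ∑ n ∈ Icc 1 ⌊4 * N⌋₊,
        √(quadBound (T w) (α * ((a * w : ℕ) : ℝ) ^ 2 * (a * (j * n)) * k))) := fun w =>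
    sum_nonneg fun _ _ => sum_nonneg fun _ _ => add_nonneg
      (mul_nonneg (by linarith) (Real.sqrt_nonneg _)) (mul_nonneg zero_le_two
      (sum_nonneg fun _ _ => sum_nonneg fun _ _ => Real.sqrt_nonneg _))
  have hdy : ∀ i ≤ Nat.log 2 (S ^ 2), ∑ w ∈ Ico ((2 : ℕ) ^ i) (2 ^ (i + 1)),
      ∑ k ∈ Icc 1 ⌊K⌋₊, ∑ a ∈ 𝓗,
      (2 * N * √(quadBound (T w) (α * ((a * w : ℕ) : ℝ) ^ 2 * 0 * k)) +
        2 * ∑ j ∈ Icc 1 ⌊N / H⌋₊, ∑ n ∈ Icc 1 ⌊4 * N⌋₊,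
        √(quadBound (T w) (α * ((a * w : ℕ) : ℝ) ^ 2 * (a * (j * n)) * k))) ≤
      7400 * L ^ 3 * (K * N * x / H) / r ^ 2 := by
    intro i hi
    set t := ⌊x / N / (H * 2 ^ i : ℕ)⌋₊ + 1 with ht
    have h2i : (1 : ℝ) ≤ 2 ^ i := one_le_pow₀ (by norm_num)
    have h2iS : (2 : ℝ) ^ i ≤ S ^ 2 := by
      have h1 : 2 ^ i ≤ S ^ 2 := (Nat.pow_le_pow_right two_pos hi).trans
        (Nat.pow_log_le_self 2 (by positivity))
      exact_mod_cast h1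
    have hMi : (H : ℝ) * 2 ^ i * r ^ 4 ≤ x / N := by
      refine le_trans ?_ hM
      gcongr
    have hHi : (0 : ℝ) < H * 2 ^ i := by positivity
    have hrt : r ^ 4 ≤ t := by
      have h1 : x / N / (H * 2 ^ i : ℕ) < t := by
        rw [ht]; push_cast; exact Nat.lt_floor_add_one _
      refine le_trans ?_ h1.le
      push_cast
      rw [le_div_iff₀ hHi]; linarith
    have htx : (2 : ℝ) ^ i * t ≤ 2 * (x / N) / H := by
      rw [le_div_iff₀ (by linarith)]
      have h1 : ((⌊x / N / (H * 2 ^ i : ℕ)⌋₊ : ℕ) : ℝ) ≤ x / N / (H * 2 ^ i) := by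
        have := Nat.floor_le (show 0 ≤ x / N / ((H * 2 ^ i : ℕ) : ℝ) by positivity)
        push_cast at this ⊢
        exact this
      rw [le_div_iff₀ hHi] at h1
      have h2 : (H : ℝ) * 2 ^ i ≤ x / N := le_trans (le_mul_of_one_le_right hHi.le hr4) hMi
      rw [ht]; push_cast
      push_cast at h1
      nlinarith
    have hTw : ∀ w ∈ Ico ((2 : ℕ) ^ i) (2 ^ (i + 1)), T w = t := by
      intro w hw
      rw [mem_Ico] at hw
      rw [hT, Nat.log_eq_of_pow_le_of_lt_pow hw.1 hw.2]
    have hoff := h.sum_sqrt_quadBound_cube_dyadic_le hr hH hHN' h𝓗 ht hrt htx (hG i hi t ht)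
    have ht1 : (1 : ℝ) ≤ t := hr4.trans hrt
    -- The phase vanishes on the diagonal, so only the trivial t + 4t² ≤ (3t)² is available.
    have hdiag : ∀ (a w k : ℕ), √(quadBound t (α * ((a * w : ℕ) : ℝ) ^ 2 * 0 * k)) ≤ 3 * t := by
      intro a w k
      rw [Real.sqrt_le_left (by positivity)]
      unfold quadBound
      have h1 : ∑ l ∈ Icc 1 t, geomBound t (2 * (α * ((a * w : ℕ) : ℝ) ^ 2 * 0 * k) * l) ≤
          ∑ l ∈ Icc 1 t, (t : ℝ) := sum_le_sum fun l _ => geomBound_le (by exact_mod_cast ht1) _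
      simp only [sum_const, Nat.card_Icc, Nat.add_sub_cancel, nsmul_eq_mul] at h1
      nlinarith
    have hcard : 2 ^ (i + 1) - 2 ^ i = 2 ^ i := by rw [pow_succ]; omega
    set Z : ℝ := K * N * x / H
    have hZ0 : 0 < Z := by positivity
    calc _ ≤ ∑ w ∈ Ico ((2 : ℕ) ^ i) (2 ^ (i + 1)), ∑ k ∈ Icc 1 ⌊K⌋₊, ∑ a ∈ 𝓗,
        (2 * N * (3 * t) + 2 * ∑ j ∈ Icc 1 ⌊N / H⌋₊, ∑ n ∈ Icc 1 ⌊4 * N⌋₊,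
          √(quadBound t (α * ((a * w : ℕ) : ℝ) ^ 2 * (a * (j * n)) * k))) := by
          refine sum_le_sum fun w hw => ?_
          rw [hTw w hw]
          gcongr
          exact hdiag _ _ _
      _ ≤ 2 ^ i * (K * (H * (2 * N * (3 * t)))) + 2 * (3660 * L ^ 3 * Z / r ^ 2) := by
          simp only [sum_add_distrib]
          refine add_le_add ?_ ?_
          · simp only [sum_const, Nat.card_Ico, Nat.card_Icc, hcard, Nat.add_sub_cancel,
              nsmul_eq_mul]
            push_cast
            gcongr
          · simp only [← mul_sum]
            gcongr
      _ = 6 * (K * N * H) * (2 ^ i * t) + 7320 * L ^ 3 * (Z / r ^ 2) := by ring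
      _ ≤ 6 * (K * N * H) * (2 * (x / N) / H) + 7320 * L ^ 3 * (Z / r ^ 2) := by gcongr
      _ = 12 * (K * x) + 7320 * L ^ 3 * (Z / r ^ 2) := by field_simp; ring
      -- H r² ≤ N is what makes the diagonal small enough here.
      _ ≤ 12 * (Z / r ^ 2) + 7320 * L ^ 3 * (Z / r ^ 2) := by
          gcongr
          simp only [Z]
          rw [le_div_iff₀ (by positivity), le_div_iff₀ (by positivity)]
          calc K * x * r ^ 2 * H = K * x * (H * r ^ 2) := by ring
            _ ≤ K * x * N := by gcongr
            _ = _ := by ring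
      _ ≤ 7400 * L ^ 3 * (Z / r ^ 2) := by
          have e2 : (1 : ℝ) ≤ L ^ 3 := one_le_pow₀ (by linarith)
          have e3 : 0 < Z / r ^ 2 := by positivity
          have e4 := mul_le_mul_of_nonneg_right e2 e3.le
          linarith
      _ = _ := by ring
  calc _ ≤ ∑ w ∈ Icc 1 (S ^ 2), ∑ k ∈ Icc 1 ⌊K⌋₊, ∑ a ∈ 𝓗,
      (2 * N * √(quadBound (T w) (α * ((a * w : ℕ) : ℝ) ^ 2 * 0 * k)) +
        2 * ∑ j ∈ Icc 1 ⌊N / H⌋₊, ∑ n ∈ Icc 1 ⌊4 * N⌋₊,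
        √(quadBound (T w) (α * ((a * w : ℕ) : ℝ) ^ 2 * (a * (j * n)) * k))) := by
        gcongr
    _ ≤ ((Nat.log 2 (S ^ 2) : ℕ) + 1) * (7400 * L ^ 3 * (K * N * x / H) / r ^ 2) :=
        sum_dyadic_le _ hnn _ hdy
    _ ≤ L * (7400 * L ^ 3 * (K * N * x / H) / r ^ 2) := by gcongr
    _ = _ := by ring

/-- Cauchy–Schwarz with (k, a, m) outside and (s, n) inside. Opening the square loses nothing in a,
and the resulting pairs (s₁, s₂) enter only through their least common multiple. The saving r² for
the square becomes r. -/
lemma MinorArc.type_two_core (h : MinorArc X L α q x K (r ^ 4)) (hr : 1 ≤ r)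
    {N : ℝ} {H S : ℕ} (hH : 1 ≤ H) (hHN : H * r ^ 2 ≤ N) {𝓗 𝓝 : Finset ℕ}
    (h𝓗 : ∀ a ∈ 𝓗, H ≤ a ∧ a < 2 * H) (h𝓝 : ∀ n ∈ 𝓝, N ≤ n ∧ (n : ℝ) < 2 * N)
    (hM : (H : ℝ) * S ^ 2 * (r ^ 4) ^ 4 ≤ x / N) (hS : 1 ≤ S)
    (hG : ∀ i ≤ Nat.log 2 (S ^ 2), ∀ T : ℕ, T = ⌊x / N / (H * 2 ^ i : ℕ)⌋₊ + 1 →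
      ∑ y ∈ Icc 1 (2 * (⌊N / H⌋₊ * ⌊4 * N⌋₊ * ⌊K⌋₊ * T)), ∑ a ∈ 𝓗,
      ∑ w ∈ Icc 1 ((2 : ℕ) ^ (i + 1)), geomBound T (α * (y * (a : ℝ) ^ 3 * (w : ℝ) ^ 2)) ≤
      26000 * L ^ 3 * (T * ((2 * (⌊N / H⌋₊ * ⌊4 * N⌋₊ * ⌊K⌋₊ * T) : ℕ) : ℝ) * H * 2 ^ i) / r ^ 4)
    {b : ℤ} {lam : ℕ → ℕ → ℂ} {c : ℤ → ℂ} {u v : ℕ → ℂ} (hlam : ∀ a s, ‖lam a s‖ ≤ L)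
    (hco : ∀ a s, lam a s ≠ 0 → IsCoprime ((a * s : ℕ) : ℤ) b)
    (hc : ∀ k ∈ nonzeroFrequencies K, ‖c k‖ ≤ L) (hu : ∀ n ∈ Icc 1 ⌊x / N⌋₊, ‖u n‖ ≤ L)
    (hv : ∀ n ∈ 𝓝, ‖v n‖ ≤ L) :
    ‖∑ k ∈ nonzeroFrequencies K, ∑ a ∈ 𝓗, ∑ m ∈ Icc 1 ⌊x / N⌋₊, (c k * u m) *
      ∑ s ∈ Icc 1 S, ∑ n ∈ 𝓝, (lam a s * v n) * restrictedPhase x α b k (a * s) n m‖ ≤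
      173 * L ^ 7 * (K * x) / r := by
  have hL2 := h.divBound.two_le
  have hL0 : 0 ≤ L := by linarith
  have hx := h.one_le_x
  have hK := h.one_le_K
  have hH' : (1 : ℝ) ≤ H := by exact_mod_cast hH
  have hr2 : 1 ≤ r ^ 2 := one_le_pow₀ hr
  have hr4 : 1 ≤ r ^ 4 := one_le_pow₀ hr
  have hHN' : (H : ℝ) ≤ N := by nlinarith
  have hN1 : 1 ≤ N := hH'.trans hHN'
  have hN0 : 0 < N := by linarith
  have hS' : (1 : ℝ) ≤ S := by exact_mod_cast hS
  have hK' : (⌊K⌋₊ : ℝ) ≤ K := Nat.floor_le (by linarith)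
  have hcard𝓗 : (𝓗.card : ℝ) ≤ H := by
    have : 𝓗 ⊆ Ico H (2 * H) := fun a ha => mem_Ico.2 (h𝓗 a ha)
    have := card_le_card this
    rw [Nat.card_Ico] at this
    exact_mod_cast this.trans (by omega)
  have hcard𝓝 : (𝓝.card : ℝ) ≤ 2 * N := by
    have h1 : 𝓝 ⊆ Ico ⌈N⌉₊ ⌈2 * N⌉₊ := fun n hn =>
      mem_Ico.2 ⟨Nat.ceil_le.2 (h𝓝 n hn).1, Nat.lt_ceil.2 (h𝓝 n hn).2⟩
    have h2 := card_le_card h1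
    rw [Nat.card_Ico] at h2
    have h3 : (𝓝.card : ℝ) ≤ ((⌈2 * N⌉₊ - ⌈N⌉₊ : ℕ) : ℝ) := by exact_mod_cast h2
    have h4 : ⌈N⌉₊ ≤ ⌈2 * N⌉₊ := Nat.ceil_mono (by linarith)
    rw [Nat.cast_sub h4] at h3
    have h5 := Nat.ceil_lt_add_one (show 0 ≤ 2 * N by linarith)
    have h6 := Nat.le_ceil N
    linarith
  set R := ⌊x / N⌋₊
  have hR : (R : ℝ) ≤ x / N := Nat.floor_le (by positivity)
  set T : ℕ → ℕ := fun w => ⌊x / N / (H * 2 ^ Nat.log 2 w : ℕ)⌋₊ + 1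
  set B : ℤ → ℕ → ℕ → ℂ := fun k a m =>
    ∑ s ∈ Icc 1 S, ∑ n ∈ 𝓝, (lam a s * v n) * restrictedPhase x α b k (a * s) n m
  set J := nonzeroFrequencies K ×ˢ 𝓗 ×ˢ Icc 1 R
  have hcs : ‖∑ k ∈ nonzeroFrequencies K, ∑ a ∈ 𝓗, ∑ m ∈ Icc 1 R, (c k * u m) * B k a m‖ ^ 2 ≤
      (∑ j ∈ J, ‖c j.1 * u j.2.2‖ ^ 2) * ∑ k ∈ nonzeroFrequencies K, ∑ a ∈ 𝓗, ∑ m ∈ Icc 1 R,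
        ‖B k a m‖ ^ 2 := by
    have e1 : ∑ k ∈ nonzeroFrequencies K, ∑ a ∈ 𝓗, ∑ m ∈ Icc 1 R, (c k * u m) * B k a m =
        ∑ j ∈ J, (c j.1 * u j.2.2) * B j.1 j.2.1 j.2.2 := by
      simp only [J, sum_product]
    have e2 : ∑ k ∈ nonzeroFrequencies K, ∑ a ∈ 𝓗, ∑ m ∈ Icc 1 R, ‖B k a m‖ ^ 2 =
        ∑ j ∈ J, ‖B j.1 j.2.1 j.2.2‖ ^ 2 := by
      simp only [J, sum_product]
    rw [e1, e2]
    refine le_trans ?_ (sum_mul_sq_le_sq_mul_sq J _ _)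
    gcongr
    refine (norm_sum_le _ _).trans_eq ?_
    simp only [norm_mul]
  have hfirst : ∑ j ∈ J, ‖c j.1 * u j.2.2‖ ^ 2 ≤ 2 * L ^ 4 * (K * (H * (x / N))) := by
    have h1 : ∀ j ∈ J, ‖c j.1 * u j.2.2‖ ^ 2 ≤ L ^ 4 := by
      intro j hj
      simp only [J, mem_product] at hj
      rw [norm_mul]
      calc (‖c j.1‖ * ‖u j.2.2‖) ^ 2 ≤ (L * L) ^ 2 := by
            gcongr
            · exact hc _ hj.1
            · exact hu _ hj.2.2
        _ = L ^ 4 := by ring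
    refine (sum_le_sum h1).trans ?_
    have h2 : ((nonzeroFrequencies K).card : ℝ) ≤ 2 * K := by
      have := sum_nonzeroFrequencies_le K (fun _ => 1) (fun _ => zero_le_one)
      simp only [sum_const, nsmul_eq_mul, mul_one, Nat.card_Icc, Nat.add_sub_cancel] at this
      linarith
    simp only [J, sum_const, card_product, nsmul_eq_mul, Nat.card_Icc, Nat.add_sub_cancel]
    push_cast
    calc ((nonzeroFrequencies K).card : ℝ) * (𝓗.card * R) * L ^ 4 ≤
          (2 * K) * (H * (x / N)) * L ^ 4 := by gcongr
      _ = _ := by ring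
  have hexpand : ∀ k ∈ nonzeroFrequencies K, ∀ a ∈ 𝓗, ∑ m ∈ Icc 1 R, ‖B k a m‖ ^ 2 ≤
      L ^ 4 * ∑ s₁ ∈ Icc 1 S, ∑ s₂ ∈ Icc 1 S, ∑ n₁ ∈ 𝓝, ∑ n₂ ∈ 𝓝, if n₁ ≡ n₂ [MOD a] then
        √(quadBound (T (s₁.lcm s₂)) (α * ((a * s₁.lcm s₂ : ℕ) : ℝ) ^ 2 *
          ((n₁ : ℝ) ^ 2 - (n₂ : ℝ) ^ 2) * k.natAbs)) else 0 := by
    intro k _ a ha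
    have ha' := h𝓗 a ha
    have h1 := sum_norm_sum_mul_sq_le (Icc 1 S ×ˢ 𝓝) (Icc 1 R)
      (fun i : ℕ × ℕ => lam a i.1 * v i.2)
      (fun i m => restrictedPhase x α b k (a * i.1) i.2 m)
    simp only [sum_product] at h1
    refine h1.trans ?_
    rw [mul_sum]
    refine sum_le_sum fun s₁ hs₁ => ?_
    rw [sum_comm, mul_sum]
    refine sum_le_sum fun s₂ hs₂ => ?_
    rw [mul_sum]
    refine sum_le_sum fun n₁ hn₁ => ?_
    rw [mul_sum]
    refine sum_le_sum fun n₂ hn₂ => ?_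
    rw [mem_Icc] at hs₁ hs₂
    set w := s₁.lcm s₂
    have hrhs : 0 ≤ (if n₁ ≡ n₂ [MOD a] then
        √(quadBound (T w) (α * ((a * w : ℕ) : ℝ) ^ 2 *
          ((n₁ : ℝ) ^ 2 - (n₂ : ℝ) ^ 2) * k.natAbs)) else 0) := by
      split_ifs
      · exact Real.sqrt_nonneg _
      · exact le_rfl
    -- Coprimality to b is known only on the support of the coefficients.
    by_cases h01 : lam a s₁ = 0
    · rw [h01]; simp only [zero_mul, norm_zero]; positivity
    by_cases h02 : lam a s₂ = 0
    · rw [h02]; simp only [zero_mul, mul_zero, norm_zero]; positivity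
    have hw1 : 1 ≤ w := Nat.lcm_pos hs₁.1 hs₂.1
    have hTw : ⌊x / N / (a * w : ℕ)⌋₊ + 1 ≤ T w := by
      simp only [T]
      gcongr
      · exact ha'.1
      · exact Nat.pow_log_le_self 2 (by omega)
    have hMn : ∀ m : ℕ, ((n₁ * m : ℕ) : ℝ) < x → (m : ℝ) ≤ x / N := by
      intro m hm
      rw [le_div_iff₀ hN0]
      push_cast at hm
      have := (h𝓝 n₁ hn₁).1
      have hm0 : (0 : ℝ) ≤ m := by positivity
      nlinarith
    have h2 := norm_sum_restrictedPhase_mul_conj_le (R := R) (n₂ := n₂) (k := k) (α := α)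
      (by omega : 1 ≤ a) hs₁.1 hs₂.1 hMn (hco a s₁ h01) (hco a s₂ h02) hTw
    rw [quadBound_mul_natAbs] at h2
    rw [norm_mul, norm_mul]
    calc _ ≤ L * L * (L * L) * (if n₁ ≡ n₂ [MOD a] then
        √(quadBound (T w) (α * ((a * w : ℕ) : ℝ) ^ 2 *
          ((n₁ : ℝ) ^ 2 - (n₂ : ℝ) ^ 2) * k.natAbs)) else 0) := by
          gcongr
          · exact hlam _ _
          · exact hv _ hn₁
          · exact hlam _ _
          · exact hv _ hn₂
      _ = _ := by ring
  set Ψ : ℕ → ℕ → ℕ → ℝ := fun w k a =>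
    (𝓝.card : ℝ) * √(quadBound (T w) (α * ((a * w : ℕ) : ℝ) ^ 2 * 0 * k)) +
        2 * ∑ j ∈ Icc 1 ⌊N / H⌋₊, ∑ n ∈ Icc 1 ⌊4 * N⌋₊,
        √(quadBound (T w) (α * ((a * w : ℕ) : ℝ) ^ 2 * (a * (j * n)) * k))
  have hΨ : ∀ w k a, 0 ≤ Ψ w k a := fun w k a => add_nonneg
      (mul_nonneg (by positivity) (Real.sqrt_nonneg _)) (mul_nonneg zero_le_two
      (sum_nonneg fun _ _ => sum_nonneg fun _ _ => Real.sqrt_nonneg _))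
  have hS2x : ((S ^ 2 : ℕ) : ℝ) ≤ X := by
    have h1 : (S : ℝ) ^ 2 ≤ x / N := by
      refine le_trans ?_ hM
      have : (1 : ℝ) ≤ (r ^ 4) ^ 4 := one_le_pow₀ hr4
      calc (S : ℝ) ^ 2 = 1 * S ^ 2 * 1 := by ring
        _ ≤ _ := by gcongr
    have h2 : x / N ≤ x := div_le_self (by linarith) hN1
    have h3 : x ≤ 20000 * K * x ^ 2 := by nlinarith [mul_le_mul hK hx (by linarith) (by linarith)]
    push_cast
    linarith [h.le_X]
  have hsecond : ∑ k ∈ nonzeroFrequencies K, ∑ a ∈ 𝓗, ∑ m ∈ Icc 1 R, ‖B k a m‖ ^ 2 ≤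
      14800 * L ^ 10 * (K * N * x / H) / r ^ 2 := by
    calc _ ≤ ∑ k ∈ nonzeroFrequencies K, ∑ a ∈ 𝓗, L ^ 4 * ∑ s₁ ∈ Icc 1 S, ∑ s₂ ∈ Icc 1 S,
          Ψ (s₁.lcm s₂) k.natAbs a := by
          refine sum_le_sum fun k hk => sum_le_sum fun a ha => (hexpand k hk a ha).trans ?_
          gcongr with s₁ _ s₂ _
          refine sum_sum_modEq_le h𝓝 (by linarith) (by exact_mod_cast (h𝓗 a ha).1)
            (fun z => √(quadBound (T (s₁.lcm s₂)) (α * ((a * s₁.lcm s₂ : ℕ) : ℝ) ^ 2 *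
              z * k.natAbs))) (fun _ => Real.sqrt_nonneg _) ?_
          intro z
          rw [← quadBound_neg]; congr 2; ring
      _ = L ^ 4 * ∑ s₁ ∈ Icc 1 S, ∑ s₂ ∈ Icc 1 S, ∑ k ∈ nonzeroFrequencies K, ∑ a ∈ 𝓗,
          Ψ (s₁.lcm s₂) k.natAbs a := by
          simp only [mul_sum]
          simp only [← sum_product']
          refine sum_nbij' (fun z => (z.2.2.1, z.2.2.2, z.1, z.2.1))
            (fun z => (z.2.2.1, z.2.2.2, z.1, z.2.1)) ?_ ?_ ?_ ?_ ?_
          · intro z hz; simp only [mem_product] at hz ⊢; tauto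
          · intro z hz; simp only [mem_product] at hz ⊢; tauto
          · intro z _; rfl
          · intro z _; rfl
          · intro z _; rfl
      _ ≤ L ^ 4 * (L ^ 2 * ∑ w ∈ Icc 1 (S ^ 2), ∑ k ∈ nonzeroFrequencies K, ∑ a ∈ 𝓗,
          Ψ w k.natAbs a) := by
          gcongr
          exact h.divBound.sum_sum_lcm_le S hS2x (fun w => ∑ k ∈ nonzeroFrequencies K, ∑ a ∈ 𝓗,
            Ψ w k.natAbs a) (fun _ => sum_nonneg fun _ _ => sum_nonneg fun _ _ => hΨ _ _ _)
      _ ≤ L ^ 4 * (L ^ 2 * ∑ w ∈ Icc 1 (S ^ 2), 2 * ∑ k ∈ Icc 1 ⌊K⌋₊, ∑ a ∈ 𝓗, Ψ w k a) := by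
          gcongr with w _
          exact sum_nonzeroFrequencies_le K (fun k => ∑ a ∈ 𝓗, Ψ w k a)
            (fun _ => sum_nonneg fun _ _ => hΨ _ _ _)
      _ ≤ L ^ 4 * (L ^ 2 * (2 * (7400 * L ^ 4 * (K * N * x / H) / r ^ 2))) := by
          rw [← mul_sum]
          gcongr
          exact h.sum_pairs_le hr hH hHN h𝓗 hcard𝓝 hM hS hG (fun _ => rfl)
      _ = _ := by ring
  refine le_of_sq_le_sq ?_ (by positivity)
  calc _ ≤ _ := hcs
    _ ≤ (2 * L ^ 4 * (K * (H * (x / N)))) * (14800 * L ^ 10 * (K * N * x / H) / r ^ 2) := by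
        gcongr
    _ = 29600 * (L ^ 7 * (K * x) / r) ^ 2 := by field_simp; norm_num
    _ ≤ 173 ^ 2 * (L ^ 7 * (K * x) / r) ^ 2 := by gcongr; norm_num
    _ = _ := by ring

end

/-! ### Type II sums: verifying the averages and a single block. -/

section

variable {X L α x K r : ℝ} {q : ℕ}

/-- Data shared by the two applications of the bounds for sums of `geomBound`. -/
lemma MinorArc.size_bounds (h : MinorArc X L α q x K (r ^ 4)) (hr : 1 ≤ r) {N : ℝ} {H S : ℕ}
    (hH : 1 ≤ H) (hHN : H * r ^ 2 ≤ N) (hM : (H : ℝ) * S ^ 2 * (r ^ 4) ^ 4 ≤ x / N) (hS : 1 ≤ S)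
    {i T Y : ℕ} (hi : i ≤ Nat.log 2 (S ^ 2)) (hT : T = ⌊x / N / (H * 2 ^ i : ℕ)⌋₊ + 1)
    (hY : Y = 2 * (⌊N / H⌋₊ * ⌊4 * N⌋₊ * ⌊K⌋₊ * T)) :
    (r ^ 4) ^ 4 ≤ x / N / (H * 2 ^ i : ℕ) ∧ x / N / (H * 2 ^ i : ℕ) ≤ T ∧
      (T : ℝ) ≤ 2 * (x / N / (H * 2 ^ i : ℕ)) ∧
      N ^ 2 * K * (x / N / (H * 2 ^ i : ℕ)) / H ≤ Y ∧
      (Y : ℝ) ≤ 16 * (N ^ 2 * K * (x / N / (H * 2 ^ i : ℕ)) / H) := by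
  have hx := h.one_le_x
  have hK := h.one_le_K
  have hH' : (1 : ℝ) ≤ H := by exact_mod_cast hH
  have hr2 : 1 ≤ r ^ 2 := one_le_pow₀ hr
  have hHN' : (H : ℝ) ≤ N := by nlinarith
  have hN : 1 ≤ N := hH'.trans hHN'
  have hN0 : 0 < N := by linarith
  have h2i : ((2 : ℝ) ^ i) ≤ S ^ 2 := by
    have h1 : 2 ^ i ≤ 2 ^ Nat.log 2 (S ^ 2) := Nat.pow_le_pow_right (by norm_num) hi
    have h2 : 2 ^ Nat.log 2 (S ^ 2) ≤ S ^ 2 := Nat.pow_log_le_self 2 (by positivity)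
    exact_mod_cast h1.trans h2
  have hP : 1 ≤ (r ^ 4) ^ 4 := one_le_pow₀ (one_le_pow₀ hr)
  set Z := x / N / (H * 2 ^ i : ℕ) with hZ
  have hZP : (r ^ 4) ^ 4 ≤ Z := by
    rw [hZ, le_div_iff₀ (by positivity)]
    refine le_trans ?_ hM
    push_cast
    calc (r ^ 4) ^ 4 * (H * (2 : ℝ) ^ i) ≤ (r ^ 4) ^ 4 * (H * S ^ 2) := by gcongr
      _ = _ := by ring
  have hZ1 : 1 ≤ Z := hP.trans hZP
  have hTl : Z ≤ T := by rw [hT]; push_cast; exact (Nat.lt_floor_add_one Z).le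
  have hTu : (T : ℝ) ≤ 2 * Z := by
    rw [hT]; push_cast
    have := Nat.floor_le (by linarith : 0 ≤ Z)
    linarith
  -- Each floor loses at most a factor 2. The prefactor 2 and the 4 in 4N compensate for this, so
  -- the lower bound for Y carries no constant.
  have half : ∀ y : ℝ, 1 ≤ y → y / 2 ≤ ⌊y⌋₊ := by
    intro y hy
    have h1 := Nat.lt_floor_add_one y
    have h2 : (1 : ℝ) ≤ ⌊y⌋₊ := by exact_mod_cast Nat.le_floor (by exact_mod_cast hy)
    linarith
  have a1 : N / H / 2 ≤ ⌊N / H⌋₊ := half _ ((one_le_div (by linarith)).2 hHN')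
  have a2 : 4 * N / 2 ≤ ⌊4 * N⌋₊ := half _ (by linarith)
  have a3 : K / 2 ≤ ⌊K⌋₊ := half _ hK
  have b1 : (⌊N / H⌋₊ : ℝ) ≤ N / H := Nat.floor_le (by positivity)
  have b2 : (⌊4 * N⌋₊ : ℝ) ≤ 4 * N := Nat.floor_le (by positivity)
  have b3 : (⌊K⌋₊ : ℝ) ≤ K := Nat.floor_le (by positivity)
  refine ⟨hZP, hTl, hTu, ?_, ?_⟩
  · rw [hY]; push_cast
    calc N ^ 2 * K * Z / H = 2 * (N / H / 2 * (4 * N / 2) * (K / 2) * Z) := by field_simp; norm_num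
      _ ≤ _ := by gcongr
  · rw [hY]; push_cast
    calc 2 * ((⌊N / H⌋₊ : ℝ) * ⌊4 * N⌋₊ * ⌊K⌋₊ * T) ≤ 2 * (N / H * (4 * N) * K * (2 * Z)) := by
          gcongr
      _ = _ := by field_simp; norm_num

/-- With H = 1 there is no cubic variable and the square average applies directly. The range of y is
at least N² Z ≥ r³² · r¹⁶ = P³ for P = r¹⁶, whatever the length of w. -/
lemma MinorArc.sum_geomBound_unit_le (h : MinorArc X L α q x K (r ^ 4)) (hr : 1 ≤ r) {N : ℝ}
    {S : ℕ} (hHN : r ^ 2 ≤ N) (hPN : r ^ 16 ≤ N) (hM : (S : ℝ) ^ 2 * (r ^ 4) ^ 4 ≤ x / N)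
    (hS : 1 ≤ S) {i T Y : ℕ} (hi : i ≤ Nat.log 2 (S ^ 2))
    (hT : T = ⌊x / N / (1 * 2 ^ i : ℕ)⌋₊ + 1)
    (hY : Y = 2 * (⌊N / (1 : ℕ)⌋₊ * ⌊4 * N⌋₊ * ⌊K⌋₊ * T)) :
    ∑ y ∈ Icc 1 Y, ∑ w ∈ Icc 1 ((2 : ℕ) ^ (i + 1)), geomBound T (α * (y * (w : ℝ) ^ 2)) ≤
      26000 * L ^ 3 * (T * (Y : ℝ) * (1 : ℕ) * 2 ^ i) / r ^ 4 := by
  have hx := h.one_le_x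
  have hK := h.one_le_K
  obtain ⟨hZP, hTl, hTu, hYl, hYu⟩ := h.size_bounds hr le_rfl (by simpa using hHN)
    (by simpa using hM) hS hi hT hY
  set Z := x / N / (1 * 2 ^ i : ℕ) with hZ
  have hP : 1 ≤ (r ^ 4) ^ 4 := one_le_pow₀ (one_le_pow₀ hr)
  have hr4 : 1 ≤ r ^ 4 := one_le_pow₀ hr
  have hr2 : 1 ≤ r ^ 2 := one_le_pow₀ hr
  have hZ1 : 1 ≤ Z := hP.trans hZP
  have hN : 1 ≤ N := hr2.trans hHN
  have hN0 : 0 < N := by linarith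
  have hZN : N * Z * 2 ^ i = x := by
    rw [hZ]; push_cast; field_simp
  have hYl' : N ^ 2 * K * Z ≤ Y := by simpa using hYl
  have hYu' : (Y : ℝ) ≤ 16 * (N ^ 2 * K * Z) := by simpa using hYu
  have hP3 : ((r ^ 4) ^ 4) ^ 3 ≤ Y := by
    have e : (r ^ 4) ^ 4 = r ^ 16 := by ring
    calc ((r ^ 4) ^ 4) ^ 3 = (r ^ 16) ^ 2 * 1 * (r ^ 4) ^ 4 := by ring
      _ ≤ N ^ 2 * K * Z := by gcongr
      _ ≤ Y := hYl'
  have hY1 : (1 : ℝ) ≤ Y := (one_le_pow₀ hP).trans hP3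
  have hT1 : (1 : ℝ) ≤ T := hZ1.trans hTl
  have hL2 := h.divBound.two_le
  refine (sum_sum_geomBound_square_le h.divBound h.approx h.q_le (T := T) (Y := Y)
    (W := 2 ^ (i + 1)) (P := (r ^ 4) ^ 4) (by exact_mod_cast hT1) (by exact_mod_cast hY1)
    Nat.one_le_two_pow ?_ hP h.le_q ?_ (fun _ => hP3)).trans ?_
  · refine le_trans ?_ h.le_X
    calc 2 * (T : ℝ) * Y * ((2 ^ (i + 1) : ℕ) : ℝ) ^ 2 ≤
        2 * (2 * Z) * (16 * (N ^ 2 * K * Z)) * ((2 ^ (i + 1) : ℕ) : ℝ) ^ 2 := by gcongr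
      _ = 256 * K * (N * Z * 2 ^ i) ^ 2 := by push_cast; ring
      _ ≤ 20000 * K * x ^ 2 := by rw [hZN]; gcongr; norm_num
  · refine h.q_mul_le.trans ?_
    calc K * x ^ 2 = K * (N * Z * 2 ^ i) ^ 2 := by rw [hZN]
      _ ≤ 4 * (K * (N * Z * 2 ^ i) ^ 2) := by
          have : 0 ≤ K * (N * Z * 2 ^ i) ^ 2 := by positivity
          linarith
      _ = Z * (N ^ 2 * K * Z) * ((2 ^ (i + 1) : ℕ) : ℝ) ^ 2 := by push_cast; ring
      _ ≤ _ := by gcongr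
  · have h1 : 1 / (r ^ 4) ^ 4 + 1 / (T : ℝ) ≤ 2 / r ^ 4 := by
      have e1 : 1 / (r ^ 4) ^ 4 ≤ 1 / r ^ 4 := by
        gcongr
        exact le_self_pow₀ hr (by norm_num)
      have e2 : 1 / (T : ℝ) ≤ 1 / (r ^ 4) ^ 4 := by
        gcongr
        exact hZP.trans hTl
      calc _ ≤ 1 / r ^ 4 + 1 / r ^ 4 := by linarith
        _ = _ := by ring
    calc _ ≤ 6500 * L ^ 3 * (T * Y * ((2 ^ (i + 1) : ℕ) : ℝ)) * (2 / r ^ 4) := by gcongr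
      _ = _ := by push_cast; ring

/-- The cubic average with p = r⁴. It needs a cubic variable of length at least p⁴ = r¹⁶, which is
the hypothesis on 2H once the dyadic range of a is enlarged to all of [1, 2H]. -/
lemma MinorArc.sum_geomBound_dyadic_le (h : MinorArc X L α q x K (r ^ 4)) (hr : 1 ≤ r) {N : ℝ}
    {H S : ℕ} (hH : 1 ≤ H) (hHN : H * r ^ 2 ≤ N) (hPH : r ^ 16 ≤ 2 * H)
    (hM : (H : ℝ) * S ^ 2 * (r ^ 4) ^ 4 ≤ x / N) (hS : 1 ≤ S)
    {i T Y : ℕ} (hi : i ≤ Nat.log 2 (S ^ 2)) (hT : T = ⌊x / N / (H * 2 ^ i : ℕ)⌋₊ + 1)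
    (hY : Y = 2 * (⌊N / H⌋₊ * ⌊4 * N⌋₊ * ⌊K⌋₊ * T)) :
    ∑ y ∈ Icc 1 Y, ∑ a ∈ Ico H (2 * H), ∑ w ∈ Icc 1 ((2 : ℕ) ^ (i + 1)),
      geomBound T (α * (y * (a : ℝ) ^ 3 * (w : ℝ) ^ 2)) ≤
      26000 * L ^ 3 * (T * (Y : ℝ) * H * 2 ^ i) / r ^ 4 := by
  have hx := h.one_le_x
  have hK := h.one_le_K
  obtain ⟨hZP, hTl, hTu, hYl, hYu⟩ := h.size_bounds hr hH hHN hM hS hi hT hY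
  set Z := x / N / (H * 2 ^ i : ℕ) with hZ
  have hH' : (1 : ℝ) ≤ H := by exact_mod_cast hH
  have hP : 1 ≤ (r ^ 4) ^ 4 := one_le_pow₀ (one_le_pow₀ hr)
  have hr4 : 1 ≤ r ^ 4 := one_le_pow₀ hr
  have hr2 : 1 ≤ r ^ 2 := one_le_pow₀ hr
  have hZ1 : 1 ≤ Z := hP.trans hZP
  have hHN' : (H : ℝ) ≤ N := by nlinarith
  have hN : 1 ≤ N := hH'.trans hHN'
  have hN0 : 0 < N := by linarith
  have hZN : N * Z * (H * 2 ^ i) = x := by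
    rw [hZ]; push_cast; field_simp
  have hT1 : (1 : ℝ) ≤ T := hZ1.trans hTl
  have hY0 : (0 : ℝ) < Y := lt_of_lt_of_le (by positivity) hYl
  have hL2 := h.divBound.two_le
  have hsub : ∑ y ∈ Icc 1 Y, ∑ a ∈ Ico H (2 * H), ∑ w ∈ Icc 1 ((2 : ℕ) ^ (i + 1)),
      geomBound T (α * (y * (a : ℝ) ^ 3 * (w : ℝ) ^ 2)) ≤
      ∑ y ∈ Icc 1 Y, ∑ a ∈ Icc 1 (2 * H), ∑ w ∈ Icc 1 ((2 : ℕ) ^ (i + 1)),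
      geomBound T (α * (y * (a : ℝ) ^ 3 * (w : ℝ) ^ 2)) := by
    refine sum_le_sum fun y _ => sum_le_sum_of_subset_of_nonneg ?_
      fun _ _ _ => sum_nonneg fun _ _ => geomBound_nonneg _ _
    intro a ha
    rw [mem_Ico] at ha
    rw [mem_Icc]
    omega
  refine hsub.trans ((sum_geomBound_cube_square_le h.divBound h.approx h.q_le (T := T) (Y := Y)
    (H := 2 * H) (W := 2 ^ (i + 1)) (p := r ^ 4) (by exact_mod_cast hY0)
    Nat.one_le_two_pow ?_ hr4 h.le_q ?_ ?_ (hZP.trans hTl) fun _ => ?_).trans ?_)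
  · refine le_trans ?_ h.le_X
    calc 12 * (T : ℝ) * Y * ((2 * H : ℕ) : ℝ) ^ 3 * ((2 ^ (i + 1) : ℕ) : ℝ) ^ 2 ≤
        12 * (2 * Z) * (16 * (N ^ 2 * K * Z / H)) * ((2 * H : ℕ) : ℝ) ^ 3 *
          ((2 ^ (i + 1) : ℕ) : ℝ) ^ 2 := by gcongr
      -- This range of grouped variables dictates the size of the constant 20000 in `le_X`.
      _ = 12288 * K * (N * Z * (H * 2 ^ i)) ^ 2 := by push_cast; field_simp; ring
      _ ≤ 20000 * K * x ^ 2 := by rw [hZN]; gcongr; norm_num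
  · refine h.q_mul_le.trans ?_
    calc K * x ^ 2 = K * (N * Z * (H * 2 ^ i)) ^ 2 := by rw [hZN]
      _ ≤ 32 * (K * (N * Z * (H * 2 ^ i)) ^ 2) := by
          have : 0 ≤ K * (N * Z * (H * 2 ^ i)) ^ 2 := by positivity
          linarith
      _ = Z * (N ^ 2 * K * Z / H) * ((2 * H : ℕ) : ℝ) ^ 3 * ((2 ^ (i + 1) : ℕ) : ℝ) ^ 2 := by
          push_cast; field_simp; ring
      _ ≤ _ := by gcongr
  · push_cast
    calc (r ^ 4) ^ 4 = r ^ 16 := by ring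
      _ ≤ _ := hPH
  · calc ((r ^ 4) ^ 4) ^ 3 = (r ^ 4) ^ 4 * (1 * 1 * (r ^ 4) ^ 4) * r ^ 16 := by ring
      _ ≤ Z * (N ^ 2 * K * Z) * (2 * H) := by
          gcongr
          exact one_le_pow₀ hN
      _ ≤ 2 * (Z * (N ^ 2 * K * Z) * (2 * H)) := by
          have : 0 ≤ Z * (N ^ 2 * K * Z) * (2 * H) := by positivity
          linarith
      _ = Z * (N ^ 2 * K * Z / H) * ((2 * H : ℕ) : ℝ) ^ 2 := by push_cast; field_simp
      _ ≤ _ := by gcongr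
  · calc 5500 * L ^ 3 * (T * Y * ((2 * H : ℕ) : ℝ) * ((2 ^ (i + 1) : ℕ) : ℝ)) / r ^ 4 =
        22000 * L ^ 3 * (T * (Y : ℝ) * H * 2 ^ i) / r ^ 4 := by push_cast; ring
      _ ≤ _ := by gcongr; norm_num

/-- The bilinear sum over one dyadic block of `n` and over moduli `d = hh d * ss d` with `hh d`
in one dyadic block. -/
lemma MinorArc.type_two_block (h : MinorArc X L α q x K (r ^ 4)) (hr : 1 ≤ r) {N : ℝ}
    {H S R : ℕ} (hH : 1 ≤ H) (hHN : H * r ^ 2 ≤ N) (hPN : r ^ 16 ≤ N)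
    (hPH : H = 1 ∨ r ^ 16 ≤ 2 * H) (hM : (H : ℝ) * S ^ 2 * (r ^ 4) ^ 4 ≤ x / N) (hS : 1 ≤ S)
    (hR : x ≤ R) {E 𝓝 : Finset ℕ} {hh ss : ℕ → ℕ} (hE : ∀ d ∈ E, d = hh d * ss d)
    (hhE : ∀ d ∈ E, H ≤ hh d ∧ hh d < 2 * H) (hsE : ∀ d ∈ E, 1 ≤ ss d ∧ ss d ≤ S)
    (h𝓝 : ∀ n ∈ 𝓝, N ≤ n ∧ (n : ℝ) < 2 * N)
    {b : ℤ} {lam : ℕ → ℂ} {c : ℤ → ℂ} {u v : ℕ → ℂ} (hlam : ∀ d ∈ E, ‖lam d‖ ≤ L)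
    (hco : ∀ d ∈ E, lam d ≠ 0 → IsCoprime (d : ℤ) b)
    (hc : ∀ k ∈ nonzeroFrequencies K, ‖c k‖ ≤ L) (hu : ∀ n, ‖u n‖ ≤ L) (hv : ∀ n, ‖v n‖ ≤ L) :
    ‖∑ d ∈ E, ∑ k ∈ nonzeroFrequencies K, ∑ n ∈ 𝓝, ∑ m ∈ Icc 1 R,
      bilinearTerm x α b lam c v u d k n m‖ ≤ 173 * L ^ 7 * (K * x) / r := by
  classical
  have hx := h.one_le_x
  have hL2 := h.divBound.two_le
  have hH' : (1 : ℝ) ≤ H := by exact_mod_cast hH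
  have hr2 : 1 ≤ r ^ 2 := one_le_pow₀ hr
  have hHN' : (H : ℝ) ≤ N := by nlinarith
  have hN : 1 ≤ N := hH'.trans hHN'
  have hN0 : 0 < N := by linarith
  -- The coefficient lives on the chosen factorizations only, so each d is counted once although it
  -- may factor in many ways.
  set lam' : ℕ → ℕ → ℂ := fun a s =>
    if a * s ∈ E ∧ hh (a * s) = a ∧ ss (a * s) = s then lam (a * s) else 0
  have hcore := h.type_two_core hr hH hHN (𝓗 := Ico H (2 * H)) (fun a ha => by simpa using ha) h𝓝
    hM hS ?_ (b := b) (lam := lam') (c := c) (u := u) (v := v) ?_ ?_ hc (fun n _ => hu n)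
    (fun n _ => hv n)
  · refine le_trans (le_of_eq ?_) hcore
    congr 1
    have hMR : Icc 1 ⌊x / N⌋₊ ⊆ Icc 1 R := by
      refine Icc_subset_Icc_right ?_
      have : (⌊x / N⌋₊ : ℝ) ≤ R :=
        (Nat.floor_le (by positivity)).trans ((div_le_self (by linarith) hN).trans hR)
      exact_mod_cast this
    rw [sum_comm]
    refine sum_congr rfl fun k _ => ?_
    have hm : ∀ d, ∀ n ∈ 𝓝, ∑ m ∈ Icc 1 R, bilinearTerm x α b lam c v u d k n m =
        ∑ m ∈ Icc 1 ⌊x / N⌋₊, (c k * u m) * ((lam d * v n) * restrictedPhase x α b k d n m) := by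
      intro d n hn
      rw [← sum_subset hMR]
      · refine sum_congr rfl fun m _ => ?_
        unfold bilinearTerm restrictedPhase
        split_ifs <;> ring
      · intro m hmR hmM
        unfold bilinearTerm
        rw [if_neg]
        rintro ⟨-, h2, -⟩
        rw [mem_Icc] at hmR hmM
        refine hmM ⟨hmR.1, Nat.le_floor ?_⟩
        rw [le_div_iff₀ hN0]
        push_cast at h2
        have := (h𝓝 n hn).1
        have hm0 : (0 : ℝ) ≤ m := by positivity
        nlinarith
    calc _ = ∑ d ∈ E, ∑ m ∈ Icc 1 ⌊x / N⌋₊, ∑ n ∈ 𝓝,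
          (c k * u m) * ((lam d * v n) * restrictedPhase x α b k d n m) := by
          refine sum_congr rfl fun d _ => ?_
          exact (sum_congr rfl fun n hn => hm d n hn).trans sum_comm
      _ = ∑ z ∈ Ico H (2 * H) ×ˢ Icc 1 S, ∑ m ∈ Icc 1 ⌊x / N⌋₊, ∑ n ∈ 𝓝,
          (c k * u m) * ((lam' z.1 z.2 * v n) * restrictedPhase x α b k (z.1 * z.2) n m) := by
          refine sum_of_injOn (fun d => (hh d, ss d)) ?_ ?_ ?_ ?_
          · intro d hd d' hd' heq
            simp only [Prod.mk.injEq] at heq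
            rw [hE d hd, hE d' hd', heq.1, heq.2]
          · intro d hd
            have h1 := hhE d hd
            have h2 := hsE d hd
            simp only [coe_product, Set.mem_prod, mem_coe, mem_Ico, mem_Icc]
            exact ⟨h1, h2⟩
          · rintro ⟨a, s⟩ - hne
            have : lam' a s = 0 := by
              simp only [lam']
              rw [if_neg]
              rintro ⟨h1, h2, h3⟩
              exact hne ⟨a * s, h1, by simp [h2, h3]⟩
            simp [this]
          · intro d hd
            have h1 := hE d hd
            have : lam' (hh d) (ss d) = lam d := by
              simp only [lam', ← h1]
              simp [hd]
            simp only [this, ← h1]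
      _ = _ := by
          rw [sum_product]
          refine sum_congr rfl fun a _ => ?_
          rw [sum_comm]
          refine sum_congr rfl fun m _ => ?_
          rw [mul_sum]
          refine sum_congr rfl fun s _ => ?_
          rw [mul_sum]
  · intro i hi T hT
    rcases hPH with rfl | hPH
    · have := h.sum_geomBound_unit_le hr (by simpa using hHN) hPN (by simpa using hM) hS hi hT rfl
      simpa using this
    · exact h.sum_geomBound_dyadic_le hr hH hHN hPH hM hS hi hT rfl
  · intro a s
    simp only [lam']
    split_ifs with h1
    · exact hlam _ h1.1
    · rw [norm_zero]; linarith
  · intro a s h1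
    simp only [lam', ne_eq, ite_eq_right_iff, Classical.not_imp] at h1
    exact hco _ h1.1.1 h1.2

end

/-! ### Type II sums: choosing the factorization of the moduli. -/

section

variable {X L α x K r : ℝ} {q : ℕ}

lemma bilinearTerm_eq_zero_of_left {b : ℤ} {lam : ℕ → ℂ} {c : ℤ → ℂ} {u v : ℕ → ℂ} {d : ℕ} {k : ℤ}
    {n m : ℕ} (h : lam d = 0) : bilinearTerm x α b lam c u v d k n m = 0 := by
  unfold bilinearTerm
  simp [h]

lemma bilinearTerm_eq_zero_of_fst {b : ℤ} {lam : ℕ → ℂ} {c : ℤ → ℂ} {u v : ℕ → ℂ} {d : ℕ} {k : ℤ}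
    {n m : ℕ} (h : u n = 0) : bilinearTerm x α b lam c u v d k n m = 0 := by
  unfold bilinearTerm
  simp [h]

/-- Well-separability is used once, with levels adapted to N: h must be small enough for the
diagonal (h r² ≤ N), and s small enough that m still covers many periods h·lcm(s₁, s₂). Moduli are
then sorted by the size of h. -/
lemma MinorArc.type_two_dyadic (h : MinorArc X L α q x K (r ^ 4)) (hr : 1 ≤ r) (hxr : r ^ 96 ≤ x)
    {D N : ℝ} (hD : (D * r ^ 32) ^ 2 ≤ x) (hPN : r ^ 16 ≤ N) (hNx : N ^ 2 ≤ x) {R : ℕ} (hR : x ≤ R)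
    {𝓝 : Finset ℕ} (h𝓝 : ∀ n ∈ 𝓝, N ≤ n ∧ (n : ℝ) < 2 * N)
    {b : ℤ} {lam : ℕ → ℂ} {c : ℤ → ℂ} {u v : ℕ → ℂ} (hlam : ∀ d ∈ Icc 1 ⌊D⌋₊, ‖lam d‖ ≤ L)
    (hsep : ∀ d ∈ Icc 1 ⌊D⌋₊, lam d ≠ 0 → IsWellSeparable D d)
    (hco : ∀ d ∈ Icc 1 ⌊D⌋₊, lam d ≠ 0 → IsCoprime (d : ℤ) b)
    (hc : ∀ k ∈ nonzeroFrequencies K, ‖c k‖ ≤ L) (hu : ∀ n, ‖u n‖ ≤ L) (hv : ∀ n, ‖v n‖ ≤ L) :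
    ‖∑ d ∈ Icc 1 ⌊D⌋₊, ∑ k ∈ nonzeroFrequencies K, ∑ n ∈ 𝓝, ∑ m ∈ Icc 1 R,
      bilinearTerm x α b lam c v u d k n m‖ ≤ (L + 1) * (173 * L ^ 7 * (K * x) / r) := by
  classical
  have hx := h.one_le_x
  have hK := h.one_le_K
  have hL2 := h.divBound.two_le
  have hr0 : 0 < r := by linarith
  set B := 173 * L ^ 7 * (K * x) / r with hB
  have hB0 : 0 ≤ B := by positivity
  rcases lt_or_ge D 1 with hD1 | hD1
  · rw [Nat.floor_eq_zero.2 hD1]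
    simp only [Icc_eq_empty_of_lt zero_lt_one, sum_empty, norm_zero]
    positivity
  have hr1 : ∀ n : ℕ, 1 ≤ r ^ n := fun n => one_le_pow₀ hr
  have hN1 : 1 ≤ N := (hr1 16).trans hPN
  have hN0 : 0 < N := by linarith
  have hDx : D ^ 2 * r ^ 64 ≤ x := by
    calc D ^ 2 * r ^ 64 = (D * r ^ 32) ^ 2 := by ring
      _ ≤ x := hD
  have hr2N : r ^ 2 ≤ N := (pow_le_pow_right₀ hr (by norm_num)).trans hPN
  -- The smallest admissible level for s with (D / S₀) r² ≤ N.
  set S₀ := max 1 (r ^ 2 * D / N) with hS₀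
  have hS1 : 1 ≤ S₀ := le_max_left _ _
  have hS0 : 0 < S₀ := by linarith
  have hH1 : 1 ≤ D / S₀ := by
    rw [one_le_div hS0, hS₀, max_le_iff]
    refine ⟨hD1, ?_⟩
    rw [div_le_iff₀ hN0]
    nlinarith
  have hHN : D / S₀ * r ^ 2 ≤ N := by
    rw [div_mul_eq_mul_div, div_le_iff₀ hS0]
    have : r ^ 2 * D / N ≤ S₀ := le_max_right _ _
    rw [div_le_iff₀ hN0] at this
    linarith
  set E := (Icc 1 ⌊D⌋₊).filter fun d => lam d ≠ 0
  have hEmem : ∀ d ∈ E, d ∈ Icc 1 ⌊D⌋₊ ∧ lam d ≠ 0 := fun d hd => mem_filter.1 hd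
  have hfac : ∀ d, ∃ f : ℕ × ℕ, d ∈ E → (f.1 : ℝ) ≤ D / S₀ ∧ (f.2 : ℝ) ≤ S₀ ∧ d = f.1 * f.2 := by
    intro d
    by_cases hd : d ∈ E
    · obtain ⟨a, s, h1, h2, h3⟩ := hsep d (hEmem d hd).1 (hEmem d hd).2 (D / S₀) S₀ hH1 hS1
        (div_mul_cancel₀ _ hS0.ne')
      exact ⟨(a, s), fun _ => ⟨h1, h2, h3⟩⟩
    · exact ⟨(0, 0), fun hd' => absurd hd' hd⟩
  choose f hf using hfac
  have hpos : ∀ d ∈ E, 1 ≤ (f d).1 ∧ 1 ≤ (f d).2 := by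
    intro d hd
    have h1 := (mem_Icc.1 (hEmem d hd).1).1
    have h2 := (hf d hd).2.2
    constructor <;> rw [Nat.one_le_iff_ne_zero] <;> intro h0 <;> rw [h0] at h2 <;> omega
  set F : ℕ → ℂ := fun d => ∑ k ∈ nonzeroFrequencies K, ∑ n ∈ 𝓝, ∑ m ∈ Icc 1 R,
      bilinearTerm x α b lam c v u d k n m with hF
  have hFE : ∑ d ∈ Icc 1 ⌊D⌋₊, F d = ∑ d ∈ E, F d := by
    refine (sum_filter_of_ne (p := fun d => lam d ≠ 0) fun d _ hne h0 => hne ?_).symm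
    simp only [F, bilinearTerm_eq_zero_of_left h0, sum_const_zero]
  change ‖∑ d ∈ Icc 1 ⌊D⌋₊, F d‖ ≤ _
  -- An h below r¹⁶ is too short for the cubic average. Here the factorization 1 · d is used
  -- instead, with s-range r¹⁶ S₀.
  have hsmall : ‖∑ d ∈ E.filter fun d => ((f d).1 : ℝ) < r ^ 16, F d‖ ≤ B := by
    have hfl : 1 ≤ ⌊r ^ 16 * S₀⌋₊ := by
      refine Nat.le_floor ?_
      have := hr1 16
      push_cast
      nlinarith
    refine h.type_two_block hr le_rfl (by simpa using hr2N) hPN (Or.inl rfl)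
      (S := ⌊r ^ 16 * S₀⌋₊) ?_ hfl hR (hh := fun _ => 1) (ss := id) (fun d _ => by simp)
      (fun d _ => by norm_num) ?_ h𝓝
      (fun d hd => hlam d (hEmem d (mem_filter.1 hd).1).1)
      (fun d hd => hco d (hEmem d (mem_filter.1 hd).1).1) hc hu hv
    · rw [le_div_iff₀ hN0]
      have h1 : (⌊r ^ 16 * S₀⌋₊ : ℝ) ≤ r ^ 16 * S₀ := Nat.floor_le (by positivity)
      calc ((1 : ℕ) : ℝ) * (⌊r ^ 16 * S₀⌋₊ : ℝ) ^ 2 * (r ^ 4) ^ 4 * N ≤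
          ((1 : ℕ) : ℝ) * (r ^ 16 * S₀) ^ 2 * (r ^ 4) ^ 4 * N := by gcongr
        _ = r ^ 48 * (S₀ ^ 2 * N) := by push_cast; ring
        _ ≤ x := by
          -- If S₀ = 1, then r⁴⁸ and N are both at most √x. Otherwise the factor N cancels and D²
          -- r⁵² / N remains.
          rcases max_choice 1 (r ^ 2 * D / N) with h2 | h2 <;> rw [← hS₀] at h2 <;> rw [h2]
          · have : (r ^ 48) ^ 2 ≤ x := by rw [← pow_mul]; exact hxr
            nlinarith [sq_nonneg (r ^ 48 - N)]
          · calc r ^ 48 * ((r ^ 2 * D / N) ^ 2 * N) = D ^ 2 * r ^ 52 / N := by field_simp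
              _ ≤ D ^ 2 * r ^ 52 / 1 := by gcongr
              _ ≤ D ^ 2 * r ^ 64 := by
                  rw [div_one]
                  gcongr
                  norm_num
              _ ≤ x := hDx
    · intro d hd
      rw [mem_filter] at hd
      obtain ⟨h1, h2, h3⟩ := hf d hd.1
      refine ⟨(mem_Icc.1 (hEmem d hd.1).1).1, Nat.le_floor ?_⟩
      simp only [id]
      rw [h3]
      push_cast
      gcongr
      exact hd.2.le
  have hlarge : ∀ j : ℕ, ‖∑ d ∈ (E.filter fun d => ¬ ((f d).1 : ℝ) < r ^ 16) with
      Nat.log 2 (f d).1 = j, F d‖ ≤ B := by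
    intro j
    set E' := (E.filter fun d => ¬ ((f d).1 : ℝ) < r ^ 16).filter fun d => Nat.log 2 (f d).1 = j
    have hE' : ∀ d ∈ E', d ∈ E ∧ r ^ 16 ≤ ((f d).1 : ℝ) ∧ 2 ^ j ≤ (f d).1 ∧
        (f d).1 < 2 * 2 ^ j := by
      intro d hd
      rw [mem_filter, mem_filter, not_lt] at hd
      refine ⟨hd.1.1, hd.1.2, ?_, ?_⟩
      · rw [← hd.2]
        exact Nat.pow_log_le_self 2 (by have := (hpos d hd.1.1).1; omega)
      · rw [← hd.2, ← pow_succ']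
        exact Nat.lt_pow_succ_log_self (by norm_num) _
    rcases E'.eq_empty_or_nonempty with he | ⟨d₀, hd₀⟩
    · rw [he]; simpa using hB0
    obtain ⟨hd₀E, hd₀P, hd₀l, hd₀u⟩ := hE' d₀ hd₀
    have hHD : ((2 ^ j : ℕ) : ℝ) ≤ D / S₀ :=
      le_trans (by exact_mod_cast hd₀l) (hf d₀ hd₀E).1
    refine h.type_two_block hr Nat.one_le_two_pow ?_ hPN (Or.inr ?_) (S := ⌊S₀⌋₊) ?_
      (Nat.le_floor (by exact_mod_cast hS1)) hR (hh := fun d => (f d).1) (ss := fun d => (f d).2)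
      (fun d hd => (hf d (hE' d hd).1).2.2) (fun d hd => (hE' d hd).2.2)
      (fun d hd => ⟨(hpos d (hE' d hd).1).2, Nat.le_floor (hf d (hE' d hd).1).2.1⟩) h𝓝
      (fun d hd => hlam d (hEmem d (hE' d hd).1).1)
      (fun d hd => hco d (hEmem d (hE' d hd).1).1) hc hu hv
    · refine le_trans ?_ hHN
      gcongr
    · refine hd₀P.trans ?_
      exact_mod_cast hd₀u.le
    · rw [le_div_iff₀ hN0]
      have h1 : (⌊S₀⌋₊ : ℝ) ≤ S₀ := Nat.floor_le hS0.le
      calc ((2 ^ j : ℕ) : ℝ) * (⌊S₀⌋₊ : ℝ) ^ 2 * (r ^ 4) ^ 4 * N ≤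
          D / S₀ * S₀ ^ 2 * (r ^ 4) ^ 4 * N := by gcongr
        _ = D * r ^ 16 * (S₀ * N) := by field_simp
        _ ≤ x := by
          rcases max_choice 1 (r ^ 2 * D / N) with h2 | h2 <;> rw [← hS₀] at h2 <;> rw [h2]
          -- If S₀ = 1, the factors D r¹⁶ and N are both at most √x.
          · have h3 : (D * r ^ 16) ^ 2 ≤ x := by
              refine le_trans ?_ hD
              gcongr
              norm_num
            nlinarith [sq_nonneg (D * r ^ 16 - N)]
          · calc D * r ^ 16 * (r ^ 2 * D / N * N) = D ^ 2 * r ^ 18 := by field_simp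
              _ ≤ D ^ 2 * r ^ 64 := by
                  gcongr
                  norm_num
              _ ≤ x := hDx
  have hDX : ((⌊D⌋₊ : ℕ) : ℝ) ≤ X := by
    have h1 : (⌊D⌋₊ : ℝ) ≤ D := Nat.floor_le (by linarith)
    have h2 : D ≤ x := by
      refine le_trans ?_ hDx
      have := hr1 64
      nlinarith
    have h3 : x ≤ 20000 * K * x ^ 2 := by nlinarith [mul_le_mul hK hx (by linarith) (by linarith)]
    linarith [h.le_X]
  rw [hFE, ← sum_filter_add_sum_filter_not E fun d => ((f d).1 : ℝ) < r ^ 16]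
  rw [← sum_fiberwise_of_maps_to (s := E.filter fun d => ¬ ((f d).1 : ℝ) < r ^ 16)
    (t := range (Nat.log 2 ⌊D⌋₊ + 1)) (g := fun d => Nat.log 2 (f d).1)]
  · calc _ ≤ B + ∑ j ∈ range (Nat.log 2 ⌊D⌋₊ + 1), B := by
          refine (norm_add_le _ _).trans (add_le_add hsmall ?_)
          exact (norm_sum_le _ _).trans (sum_le_sum fun j _ => hlarge j)
      _ = (((Nat.log 2 ⌊D⌋₊ : ℕ) : ℝ) + 1 + 1) * B := by
          rw [sum_const, card_range, nsmul_eq_mul]; push_cast; ring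
      _ ≤ (L + 1) * B := by
          gcongr
          exact h.divBound.log_two_add_one_le hDX
  · intro d hd
    have hdE := (mem_filter.1 hd).1
    rw [mem_range, Nat.lt_succ_iff]
    refine Nat.log_mono_right ?_
    refine le_trans ?_ (mem_Icc.1 (hEmem d hdE).1).2
    conv_rhs => rw [(hf d hdE).2.2]
    exact Nat.le_mul_of_pos_right _ (hpos d hdE).2

/-- The Type II estimate. -/
lemma MinorArc.type_two (h : MinorArc X L α q x K (r ^ 4)) (hr : 1 ≤ r) (hxr : r ^ 96 ≤ x)
    {D V : ℝ} (hD : (D * r ^ 32) ^ 2 ≤ x) (hV : 2 * r ^ 16 ≤ V) {R : ℕ} (hR : x ≤ R)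
    (hRX : (R : ℝ) ≤ X)
    {b : ℤ} {lam : ℕ → ℂ} {c : ℤ → ℂ} {u v : ℕ → ℂ} (hlam : ∀ d ∈ Icc 1 ⌊D⌋₊, ‖lam d‖ ≤ L)
    (hsep : ∀ d ∈ Icc 1 ⌊D⌋₊, lam d ≠ 0 → IsWellSeparable D d)
    (hco : ∀ d ∈ Icc 1 ⌊D⌋₊, lam d ≠ 0 → IsCoprime (d : ℤ) b)
    (hc : ∀ k ∈ nonzeroFrequencies K, ‖c k‖ ≤ L) (hu : ∀ n, ‖u n‖ ≤ L) (hv : ∀ n, ‖v n‖ ≤ L)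
    (hvs : ∀ n, v n ≠ 0 → V ≤ n ∧ (n : ℝ) ^ 2 ≤ x) :
    ‖∑ d ∈ Icc 1 ⌊D⌋₊, ∑ k ∈ nonzeroFrequencies K, ∑ n ∈ Icc 1 R, ∑ m ∈ Icc 1 R,
      bilinearTerm x α b lam c v u d k n m‖ ≤ 300 * L ^ 9 * (K * x) / r := by
  classical
  have hx := h.one_le_x
  have hK := h.one_le_K
  have hL2 := h.divBound.two_le
  have hr0 : 0 < r := by linarith
  set B := 173 * L ^ 7 * (K * x) / r with hB
  have hB0 : 0 ≤ B := by positivity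
  set G : Finset ℕ → ℂ := fun 𝓝 => ∑ d ∈ Icc 1 ⌊D⌋₊, ∑ k ∈ nonzeroFrequencies K, ∑ n ∈ 𝓝,
    ∑ m ∈ Icc 1 R, bilinearTerm x α b lam c v u d k n m with hG
  have hGsum : ∀ 𝓝, G 𝓝 = ∑ n ∈ 𝓝, G {n} := by
    intro 𝓝
    simp only [G, sum_singleton]
    exact (sum_congr rfl fun d _ => sum_comm).trans sum_comm
  set 𝓥 := (Icc 1 R).filter fun n => v n ≠ 0
  have hG𝓥 : G (Icc 1 R) = G 𝓥 := by
    rw [hGsum, hGsum 𝓥]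
    refine (sum_filter_of_ne (p := fun n => v n ≠ 0) fun n _ hne h0 => hne ?_).symm
    simp only [G, sum_singleton, bilinearTerm_eq_zero_of_fst h0, sum_const_zero]
  have hblock : ∀ i : ℕ, ‖G (𝓥.filter fun n => Nat.log 2 n = i)‖ ≤ (L + 1) * B := by
    intro i
    set 𝓝 := 𝓥.filter fun n => Nat.log 2 n = i
    have h𝓝 : ∀ n ∈ 𝓝, v n ≠ 0 ∧ ((2 : ℝ) ^ i) ≤ n ∧ (n : ℝ) < 2 * 2 ^ i := by
      intro n hn
      rw [mem_filter, mem_filter, mem_Icc] at hn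
      refine ⟨hn.1.2, ?_, ?_⟩
      · rw [← hn.2]
        exact_mod_cast Nat.pow_log_le_self 2 (by omega)
      · rw [← hn.2, ← pow_succ']
        exact_mod_cast Nat.lt_pow_succ_log_self (by norm_num) _
    rcases 𝓝.eq_empty_or_nonempty with he | ⟨n₀, hn₀⟩
    · rw [he]
      simp only [G, sum_empty, sum_const_zero, norm_zero]
      positivity
    obtain ⟨h1, h2, h3⟩ := h𝓝 n₀ hn₀
    obtain ⟨h4, h5⟩ := hvs n₀ h1
    -- A block containing some n₀ ≥ V has 2^i > V/2, so the factor 2 in `hV` yields r¹⁶ ≤ 2^i.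
    refine h.type_two_dyadic hr hxr hD (N := 2 ^ i) (by linarith) ?_ hR
      (fun n hn => (h𝓝 n hn).2) hlam hsep hco hc hu hv
    refine le_trans ?_ h5
    gcongr
  change ‖G (Icc 1 R)‖ ≤ _
  rw [hG𝓥, hGsum, ← sum_fiberwise_of_maps_to (t := range (Nat.log 2 R + 1))
    (g := fun n => Nat.log 2 n)]
  · calc _ ≤ ∑ i ∈ range (Nat.log 2 R + 1), (L + 1) * B := by
          refine (norm_sum_le _ _).trans (sum_le_sum fun i _ => ?_)
          rw [← hGsum]
          exact hblock i
      _ = (((Nat.log 2 R : ℕ) : ℝ) + 1) * ((L + 1) * B) := by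
          rw [sum_const, card_range, nsmul_eq_mul]; push_cast; ring
      _ ≤ L * (3 / 2 * L * B) := by
          gcongr
          · exact h.divBound.log_two_add_one_le hRX
          · linarith
      _ = 259.5 * L ^ 9 * (K * x) / r := by rw [hB]; ring
      _ ≤ 300 * L ^ 9 * (K * x) / r := by gcongr; norm_num
  · intro n hn
    rw [mem_range, Nat.lt_succ_iff]
    exact Nat.log_mono_right (mem_Icc.1 (mem_filter.1 hn).1).2

end

/-! ### Vaughan's identity and its bilinear sums. -/

section

open scoped ArithmeticFunction.vonMangoldt ArithmeticFunction.Moebius ArithmeticFunction.zeta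

variable {X L α x K r : ℝ} {q : ℕ}

lemma arithmeticFunction_sub_apply (f g : ArithmeticFunction ℝ) (n : ℕ) :
    (f - g) n = f n - g n := by
  rw [sub_eq_add_neg, ArithmeticFunction.add_apply, sub_eq_add_neg]
  rfl

/-- The restriction of an arithmetic function to the arguments `n ≤ V`. -/
noncomputable def truncateAbove (V : ℝ) (f : ArithmeticFunction ℝ) : ArithmeticFunction ℝ :=
  ⟨fun n => if (n : ℝ) ≤ V then f n else 0, by simp⟩

lemma truncateAbove_apply (V : ℝ) (f : ArithmeticFunction ℝ) (n : ℕ) :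
    truncateAbove V f n = if (n : ℝ) ≤ V then f n else 0 := rfl

lemma sub_truncateAbove_apply (V : ℝ) (f : ArithmeticFunction ℝ) (n : ℕ) :
    (f - truncateAbove V f) n = if (n : ℝ) ≤ V then 0 else f n := by
  rw [arithmeticFunction_sub_apply, truncateAbove_apply]
  split_ifs <;> simp

/-- Vaughan's identity. -/
lemma vaughan_identity (V : ℝ) :
    truncateAbove V μ * ArithmeticFunction.log - truncateAbove V μ * truncateAbove V Λ * ζ +
      (μ - truncateAbove V μ) * ((Λ - truncateAbove V Λ) * ζ) = Λ - truncateAbove V Λ := by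
  have h1 : (ArithmeticFunction.log) = Λ * ζ := ArithmeticFunction.vonMangoldt_mul_zeta.symm
  have h2 : (μ * ζ : ArithmeticFunction ℝ) = 1 := ArithmeticFunction.coe_moebius_mul_coe_zeta
  rw [h1]
  -- With log = Λ * ζ the left side collapses to (Λ - Λ_V) * (μ * ζ).
  linear_combination (Λ - truncateAbove V Λ) * h2

lemma abs_truncateAbove_moebius_le (V : ℝ) (n : ℕ) :
    |truncateAbove V (μ : ArithmeticFunction ℝ) n| ≤ 1 := by
  rw [truncateAbove_apply, ArithmeticFunction.intCoe_apply]
  split_ifs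
  · exact_mod_cast ArithmeticFunction.abs_moebius_le_one
  · simp

lemma abs_sub_truncateAbove_moebius_le (V : ℝ) (n : ℕ) :
    |((μ : ArithmeticFunction ℝ) - truncateAbove V μ) n| ≤ 1 := by
  rw [sub_truncateAbove_apply, ArithmeticFunction.intCoe_apply]
  split_ifs
  · simp
  · exact_mod_cast ArithmeticFunction.abs_moebius_le_one

lemma abs_truncateAbove_mul_le (V : ℝ) (n : ℕ) :
    |(truncateAbove V (μ : ArithmeticFunction ℝ) * truncateAbove V Λ) n| ≤ Real.log n := by
  rw [ArithmeticFunction.mul_apply, ← ArithmeticFunction.vonMangoldt_sum,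
    ← Nat.map_div_left_divisors, sum_map]
  refine (abs_sum_le_sum_abs _ _).trans (sum_le_sum fun d _ => ?_)
  have h2 : |truncateAbove V Λ d| ≤ Λ d := by
    rw [truncateAbove_apply]
    split_ifs
    · rw [abs_of_nonneg ArithmeticFunction.vonMangoldt_nonneg]
    · simp
  rw [abs_mul]
  calc _ ≤ 1 * Λ d := by
        gcongr
        · exact abs_truncateAbove_moebius_le V _
        · exact h2
    _ = _ := one_mul _

lemma truncateAbove_mul_ne_zero {V : ℝ} {n : ℕ}
    (hn : (truncateAbove V (μ : ArithmeticFunction ℝ) * truncateAbove V Λ) n ≠ 0) :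
    (n : ℝ) ≤ V * V := by
  rw [ArithmeticFunction.mul_apply] at hn
  obtain ⟨⟨a, b⟩, hab, hne⟩ := exists_ne_zero_of_sum_ne_zero hn
  rw [Nat.mem_divisorsAntidiagonal] at hab
  simp only [truncateAbove_apply, ne_eq, mul_eq_zero, ite_eq_right_iff, not_or,
    Classical.not_imp] at hne
  rw [← hab.1]
  push_cast
  have := hne.1.1
  have := hne.2.1
  gcongr
  exact le_trans (by positivity) this

lemma abs_sub_truncateAbove_mul_zeta_le (V : ℝ) (n : ℕ) :
    |(((Λ : ArithmeticFunction ℝ) - truncateAbove V Λ) * ζ) n| ≤ Real.log n := by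
  rw [ArithmeticFunction.coe_mul_zeta_apply, ← ArithmeticFunction.vonMangoldt_sum]
  refine (abs_sum_le_sum_abs _ _).trans (sum_le_sum fun d _ => ?_)
  rw [sub_truncateAbove_apply]
  split_ifs
  · simp
  · rw [abs_of_nonneg ArithmeticFunction.vonMangoldt_nonneg]

lemma sub_truncateAbove_mul_zeta_ne_zero {V : ℝ} {n : ℕ}
    (hn : (((Λ : ArithmeticFunction ℝ) - truncateAbove V Λ) * ζ) n ≠ 0) : V ≤ n := by
  rw [ArithmeticFunction.coe_mul_zeta_apply] at hn
  obtain ⟨d, hd, hne⟩ := exists_ne_zero_of_sum_ne_zero hn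
  rw [sub_truncateAbove_apply] at hne
  have h1 : V < d := by
    by_contra h
    rw [if_pos (not_lt.1 h)] at hne
    exact hne rfl
  have h2 : (d : ℝ) ≤ n := by
    rw [Nat.mem_divisors] at hd
    exact_mod_cast Nat.le_of_dvd (by omega) hd.1
  linarith

lemma mem_dyadicProgression {b : ℤ} {d n : ℕ} :
    n ∈ dyadicProgression x b d ↔ InDyadicProgression x b d n := by
  unfold dyadicProgression InDyadicProgression
  rw [mem_filter, mem_range, Nat.lt_ceil]
  tauto

lemma sum_dyadicProgression_mul (hx : 1 ≤ x) {R : ℕ} (hR : x ≤ R) (b : ℤ) (d : ℕ)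
    (f g : ArithmeticFunction ℝ) (φ : ℕ → ℂ) :
    ∑ n ∈ dyadicProgression x b d, φ n * (((f * g) n : ℝ) : ℂ) =
      ∑ n ∈ Icc 1 R, ∑ m ∈ Icc 1 R,
        open scoped Classical in
        if InDyadicProgression x b d (n * m) then φ (n * m) * (f n * g m) else 0 := by
  classical
  rw [← sum_product', ← sum_filter]
  rw [← sum_fiberwise_of_maps_to (t := dyadicProgression x b d) (g := fun z : ℕ × ℕ => z.1 * z.2)]
  · refine sum_congr rfl fun n hn => ?_
    rw [mem_dyadicProgression] at hn
    have hn0 : n ≠ 0 := by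
      rintro rfl
      have := hn.1
      norm_num at this
      linarith
    have hnR : n ≤ R := by
      have := hn.2.1.trans_le hR
      exact_mod_cast this.le
    rw [ArithmeticFunction.mul_apply]
    push_cast
    rw [mul_sum]
    refine sum_congr ?_ ?_
    · ext ⟨a, m⟩
      simp only [Nat.mem_divisorsAntidiagonal, mem_filter, mem_product, mem_Icc]
      constructor
      · rintro ⟨rfl, -⟩
        have ha : a ≠ 0 := left_ne_zero_of_mul hn0
        have hm : m ≠ 0 := right_ne_zero_of_mul hn0
        refine ⟨⟨⟨⟨by omega, ?_⟩, by omega, ?_⟩, hn⟩, rfl⟩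
        · exact (Nat.le_mul_of_pos_right a (by omega)).trans hnR
        · exact (Nat.le_mul_of_pos_left m (by omega)).trans hnR
      · rintro ⟨-, rfl⟩
        exact ⟨rfl, hn0⟩
    · rintro ⟨a, m⟩ ha
      rw [(mem_filter.1 ha).2]
  · intro z hz
    rw [mem_dyadicProgression]
    exact (mem_filter.1 hz).2

/-- The bilinear sum over all moduli `d ≤ D` and frequencies `k`. -/
noncomputable def bilinearSum (x K α : ℝ) (b : ℤ) (D R : ℕ) (lam : ℕ → ℂ) (c : ℤ → ℂ)
    (u v : ℕ → ℂ) : ℂ :=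
  ∑ d ∈ Icc 1 D, ∑ k ∈ nonzeroFrequencies K, ∑ n ∈ Icc 1 R, ∑ m ∈ Icc 1 R,
    bilinearTerm x α b lam c u v d k n m

/-- The sum of `F` over progressions, twisted by quadratic phases. -/
noncomputable def progressionSum (x K α : ℝ) (b : ℤ) (D : ℕ) (lam : ℕ → ℂ) (c : ℤ → ℂ)
    (F : ArithmeticFunction ℝ) : ℂ :=
  ∑ d ∈ Icc 1 D, lam d * ∑ k ∈ nonzeroFrequencies K, c k * ∑ n ∈ dyadicProgression x b d,
    expChar (α * (n : ℝ) ^ 2 * k) * ((F n : ℝ) : ℂ)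

lemma progressionSum_add (b : ℤ) (D : ℕ) (lam : ℕ → ℂ) (c : ℤ → ℂ) (F G : ArithmeticFunction ℝ) :
    progressionSum x K α b D lam c (F + G) =
      progressionSum x K α b D lam c F + progressionSum x K α b D lam c G := by
  simp only [progressionSum, ArithmeticFunction.add_apply, Complex.ofReal_add, mul_add,
    sum_add_distrib]

lemma progressionSum_sub (b : ℤ) (D : ℕ) (lam : ℕ → ℂ) (c : ℤ → ℂ) (F G : ArithmeticFunction ℝ) :
    progressionSum x K α b D lam c (F - G) =
      progressionSum x K α b D lam c F - progressionSum x K α b D lam c G := by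
  simp only [progressionSum, arithmeticFunction_sub_apply, Complex.ofReal_sub, mul_sub,
    sum_sub_distrib]

lemma progressionSum_mul (hx : 1 ≤ x) {R : ℕ} (hR : x ≤ R) (b : ℤ) (D : ℕ) (lam : ℕ → ℂ)
    (c : ℤ → ℂ) (f g : ArithmeticFunction ℝ) :
    progressionSum x K α b D lam c (f * g) =
      bilinearSum x K α b D R lam c (fun n => (f n : ℂ)) (fun m => (g m : ℂ)) := by
  unfold progressionSum bilinearSum
  refine sum_congr rfl fun d _ => ?_
  rw [mul_sum]
  refine sum_congr rfl fun k _ => ?_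
  rw [sum_dyadicProgression_mul hx hR b d f g fun n => expChar (α * (n : ℝ) ^ 2 * k)]
  rw [mul_sum, mul_sum]
  refine sum_congr rfl fun n _ => ?_
  rw [mul_sum, mul_sum]
  refine sum_congr rfl fun m _ => ?_
  unfold bilinearTerm
  split_ifs
  · ring
  · simp

/-- Splitting a bilinear sum according to which variable is at most `√x`. -/
lemma bilinearSum_eq_add (b : ℤ) (D R : ℕ) (lam : ℕ → ℂ) (c : ℤ → ℂ) (u v : ℕ → ℂ) :
    bilinearSum x K α b D R lam c u v =
      bilinearSum x K α b D R lam c (fun n => if (n : ℝ) ^ 2 ≤ x then u n else 0)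
        (fun n => if (n : ℝ) ≤ x then v n else 0) +
      bilinearSum x K α b D R lam c (fun n => if (n : ℝ) ^ 2 ≤ x then v n else 0)
        (fun n => if (n : ℝ) ^ 2 ≤ x then 0 else u n) := by
  unfold bilinearSum
  rw [← sum_add_distrib]
  refine sum_congr rfl fun d _ => ?_
  rw [← sum_add_distrib]
  refine sum_congr rfl fun k _ => ?_
  conv_rhs => enter [2]; rw [sum_comm]
  rw [← sum_add_distrib]
  refine sum_congr rfl fun n hn => ?_
  rw [← sum_add_distrib]
  refine sum_congr rfl fun m hm => ?_
  rw [mem_Icc] at hn hm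
  unfold bilinearTerm
  rw [mul_comm m n]
  by_cases h1 : InDyadicProgression x b d (n * m)
  · have h2 := h1.2.1
    push_cast at h2
    have hn1 : (1 : ℝ) ≤ n := by exact_mod_cast hn.1
    have hm0 : (0 : ℝ) ≤ m := by positivity
    -- Truncating the long variable at x changes nothing on the support, but keeps logarithmic
    -- coefficients bounded for every argument.
    have hmx : (m : ℝ) ≤ x := by nlinarith
    by_cases h3 : (n : ℝ) ^ 2 ≤ x
    · simp [h1, h3, hmx]
    · have hm2 : (m : ℝ) ^ 2 ≤ x := by nlinarith
      simp [h1, h3, hm2]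
      left; ring
  · simp [h1]

end

/-! ### Estimates for coprime and for non-coprime moduli. -/

section

open scoped ArithmeticFunction.vonMangoldt ArithmeticFunction.Moebius ArithmeticFunction.zeta

variable {X L α x K r : ℝ} {q : ℕ}

lemma MinorArc.log_le (h : MinorArc X L α q x K r) {n : ℕ} (hn : (n : ℝ) ≤ x) :
    Real.log n ≤ L := by
  have hx := h.one_le_x
  have hK := h.one_le_K
  have h3 : x ≤ 20000 * K * x ^ 2 := by nlinarith [mul_le_mul hK hx (by linarith) (by linarith)]
  have hX := Real.log_nonneg h.divBound.one_le
  have hL := h.divBound.log_le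
  rcases Nat.eq_zero_or_pos n with rfl | hn0
  · simp
    linarith
  have : Real.log n ≤ Real.log X :=
    Real.log_le_log (by exact_mod_cast hn0) (hn.trans (h3.trans h.le_X))
  linarith

/-- The Vaughan decomposition gives the estimate for moduli coprime to the residue class. -/
lemma MinorArc.norm_progressionSum_le (h : MinorArc X L α q x K (r ^ 4)) (hr : 1 ≤ r)
    (hxr : r ^ 96 ≤ x) {D V : ℝ} (hD : (D * r ^ 32) ^ 2 ≤ x) (hV : 2 * r ^ 16 ≤ V)
    (hVx : V ^ 4 ≤ x)
    {b : ℤ} {lam : ℕ → ℂ} {c : ℤ → ℂ} (hlam : ∀ d ∈ Icc 1 ⌊D⌋₊, ‖lam d‖ ≤ L)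
    (hsep : ∀ d ∈ Icc 1 ⌊D⌋₊, lam d ≠ 0 → IsWellSeparable D d)
    (hco : ∀ d ∈ Icc 1 ⌊D⌋₊, lam d ≠ 0 → IsCoprime (d : ℤ) b)
    (hc : ∀ k ∈ nonzeroFrequencies K, ‖c k‖ ≤ L) :
    ‖progressionSum x K α b ⌊D⌋₊ lam c Λ‖ ≤ 8600 * L ^ 9 * (K * x) / r := by
  have hx := h.one_le_x
  have hK := h.one_le_K
  have hL2 := h.divBound.two_le
  have hr0 : 0 < r := by linarith
  have hr1 : ∀ n : ℕ, 1 ≤ r ^ n := fun n => one_le_pow₀ hr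
  have hV2 : 2 ≤ V := by linarith [hr1 16]
  have hB0 : 0 ≤ L ^ 9 * (K * x) / r := by positivity
  set R := ⌈x⌉₊
  have hR : x ≤ R := Nat.le_ceil x
  have hRX : (R : ℝ) ≤ X := by
    have h1 := Nat.ceil_lt_add_one (by linarith : 0 ≤ x)
    have h3 : x ≤ K * x ^ 2 := by nlinarith [mul_le_mul hK hx (by linarith) (by linarith)]
    have := h.le_X
    linarith
  -- All n in the sum satisfy n ≥ x/2 > V, because 8V ≤ V⁴ ≤ x, so the truncated part of Λ is not
  -- seen.
  have hΛ : progressionSum x K α b ⌊D⌋₊ lam c Λ =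
      progressionSum x K α b ⌊D⌋₊ lam c (Λ - truncateAbove V Λ) := by
    unfold progressionSum
    refine sum_congr rfl fun d _ => ?_
    congr 1
    refine sum_congr rfl fun k _ => ?_
    congr 1
    refine sum_congr rfl fun n hn => ?_
    rw [mem_dyadicProgression] at hn
    rw [sub_truncateAbove_apply, if_neg]
    rw [not_le]
    have h1 := hn.1
    have h2 : V * 2 ^ 3 ≤ V ^ 4 := by
      calc V * 2 ^ 3 ≤ V * V ^ 3 := by gcongr
        _ = V ^ 4 := by ring
    linarith
  rw [hΛ, ← vaughan_identity, progressionSum_add, progressionSum_sub]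
  have hN : ((⌊D⌋₊ : ℕ) : ℝ) * ⌊V * V⌋₊ * (r ^ 4) ^ 4 ≤ x := by
    rcases lt_or_ge D 0 with hD0 | hD0
    · rw [Nat.floor_of_nonpos hD0.le]
      simp
      linarith
    have h1 : (⌊D⌋₊ : ℝ) ≤ D := Nat.floor_le hD0
    have h2 : (⌊V * V⌋₊ : ℝ) ≤ V * V := Nat.floor_le (by positivity)
    have h3 : (D * r ^ 16) ^ 2 ≤ x := by
      refine le_trans ?_ hD
      gcongr
      norm_num
    calc _ ≤ D * (V * V) * (r ^ 4) ^ 4 := by gcongr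
      _ = (D * r ^ 16) * V ^ 2 := by ring
      -- Both D r¹⁶ and V² have square at most x, so their product is at most x.
      _ ≤ x := by nlinarith [sq_nonneg (D * r ^ 16 - V ^ 2)]
  have hterm : 4000 * L ^ 8 * (K * x) / (r ^ 4) ^ 2 ≤ 4000 * L ^ 9 * (K * x) / r := by
    gcongr
    · linarith
    · norm_num
    · rw [← pow_mul]
      exact le_self_pow₀ hr (by norm_num)
  have hVx' : V ≤ x := by
    refine le_trans ?_ hVx
    exact le_self_pow₀ (by linarith) (by norm_num)
  have hVVx : V * V ≤ x := by
    refine le_trans ?_ hVx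
    nlinarith [sq_nonneg (V * V - 1)]
  have hI1 : ‖progressionSum x K α b ⌊D⌋₊ lam c (truncateAbove V μ * ArithmeticFunction.log)‖ ≤
      4000 * L ^ 9 * (K * x) / r := by
    rw [progressionSum_mul hx hR]
    refine le_trans (h.type_one hN hlam hco hc ?_ ?_ ?_ ?_ ?_) hterm
    · intro n
      rw [Complex.norm_real, Real.norm_eq_abs]
      linarith [abs_truncateAbove_moebius_le V n]
    · intro n hn
      rw [Complex.ofReal_ne_zero, truncateAbove_apply, ne_eq, ite_eq_right_iff,
        Classical.not_imp] at hn
      refine Nat.le_floor (hn.1.trans ?_)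
      nlinarith
    · intro i j hi hij
      simp only [ArithmeticFunction.log_apply]
      gcongr
    · intro i hi
      simp only [ArithmeticFunction.log_apply]
      exact Real.log_nonneg (by exact_mod_cast hi)
    · intro i hi
      simp only [ArithmeticFunction.log_apply]
      exact h.log_le hi
  have hI2 : ‖progressionSum x K α b ⌊D⌋₊ lam c (truncateAbove V μ * truncateAbove V Λ * ζ)‖ ≤
      4000 * L ^ 9 * (K * x) / r := by
    rw [progressionSum_mul hx hR]
    -- The weight ζ is replaced by the constant 1, which agrees with it for m ≥ 1 and is visibly
    -- monotone.
    have hζ : bilinearSum x K α b ⌊D⌋₊ R lam c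
        (fun n => ((truncateAbove V (μ : ArithmeticFunction ℝ) * truncateAbove V Λ) n : ℂ))
        (fun m => (((ζ : ArithmeticFunction ℝ) m : ℝ) : ℂ)) = bilinearSum x K α b ⌊D⌋₊ R lam c
        (fun n => ((truncateAbove V (μ : ArithmeticFunction ℝ) * truncateAbove V Λ) n : ℂ))
        (fun m => ((1 : ℝ) : ℂ)) := by
      unfold bilinearSum
      refine sum_congr rfl fun d _ => sum_congr rfl fun k _ => sum_congr rfl fun n _ =>
        sum_congr rfl fun m hm => ?_
      unfold bilinearTerm
      have hm0 : m ≠ 0 := by rw [mem_Icc] at hm; omega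
      simp [ArithmeticFunction.natCoe_apply, ArithmeticFunction.zeta_apply, hm0]
    rw [hζ]
    have hsupp : ∀ n, (truncateAbove V (μ : ArithmeticFunction ℝ) * truncateAbove V Λ) n ≠ 0 →
        n ≤ ⌊V * V⌋₊ := fun n hn => Nat.le_floor (truncateAbove_mul_ne_zero hn)
    refine le_trans (h.type_one (w := fun _ => 1) hN hlam hco hc ?_ ?_ (fun _ _ _ _ => le_rfl)
      (fun _ _ => zero_le_one) (fun _ _ => by linarith)) hterm
    · intro n
      rw [Complex.norm_real, Real.norm_eq_abs]
      by_cases hn : (truncateAbove V (μ : ArithmeticFunction ℝ) * truncateAbove V Λ) n = 0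
      · rw [hn, abs_zero]; linarith
      · refine (abs_truncateAbove_mul_le V n).trans (h.log_le ?_)
        exact (truncateAbove_mul_ne_zero hn).trans hVVx
    · intro n hn
      exact hsupp n (Complex.ofReal_ne_zero.1 hn)
  have hII : ‖progressionSum x K α b ⌊D⌋₊ lam c
      ((μ - truncateAbove V μ) * ((Λ - truncateAbove V Λ) * ζ))‖ ≤
      300 * L ^ 9 * (K * x) / r + 300 * L ^ 9 * (K * x) / r := by
    rw [progressionSum_mul hx hR, bilinearSum_eq_add]
    refine (norm_add_le _ _).trans (add_le_add ?_ ?_)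
    · refine h.type_two hr hxr hD hV hR hRX hlam hsep hco hc ?_ ?_ ?_
      · intro n
        split_ifs with hn
        · rw [Complex.norm_real, Real.norm_eq_abs]
          exact (abs_sub_truncateAbove_mul_zeta_le V n).trans (h.log_le hn)
        · rw [norm_zero]; linarith
      · intro n
        split_ifs
        · rw [Complex.norm_real, Real.norm_eq_abs]
          linarith [abs_sub_truncateAbove_moebius_le V n]
        · rw [norm_zero]; linarith
      · intro n hn
        rw [ne_eq, ite_eq_right_iff, Classical.not_imp, Complex.ofReal_eq_zero,
          sub_truncateAbove_apply, ite_eq_left_iff, Classical.not_imp, not_le] at hn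
        exact ⟨hn.2.1.le, hn.1⟩
    · refine h.type_two hr hxr hD hV hR hRX hlam hsep hco hc ?_ ?_ ?_
      · intro n
        split_ifs
        · rw [norm_zero]; linarith
        · rw [Complex.norm_real, Real.norm_eq_abs]
          linarith [abs_sub_truncateAbove_moebius_le V n]
      · intro n
        split_ifs with hn
        · rw [Complex.norm_real, Real.norm_eq_abs]
          refine (abs_sub_truncateAbove_mul_zeta_le V n).trans (h.log_le ?_)
          nlinarith
        · rw [norm_zero]; linarith
      · intro n hn
        rw [ne_eq, ite_eq_right_iff, Classical.not_imp, Complex.ofReal_eq_zero] at hn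
        exact ⟨sub_truncateAbove_mul_zeta_ne_zero hn.2, hn.1⟩
  calc _ ≤ (4000 * L ^ 9 * (K * x) / r + 4000 * L ^ 9 * (K * x) / r) +
        (300 * L ^ 9 * (K * x) / r + 300 * L ^ 9 * (K * x) / r) :=
        (norm_add_le _ _).trans (add_le_add ((norm_sub_le _ _).trans (add_le_add hI1 hI2)) hII)
    _ = _ := by ring

/-- Prime powers in `[x/2, x)` are determined by the prime. -/
lemma card_primePow_dyadicProgression_le {b : ℤ} {d : ℕ} (hd : d ≠ 0)
    (hco : ¬ IsCoprime (d : ℤ) b) :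
    ((dyadicProgression x b d).filter IsPrimePow).card ≤ d.divisors.card := by
  refine card_le_card_of_injOn Nat.minFac ?_ ?_
  · intro n hn
    simp only [coe_filter, Set.mem_ofPred_eq, mem_dyadicProgression] at hn
    obtain ⟨⟨-, -, hmod⟩, hpp⟩ := hn
    rw [mem_coe, Nat.mem_divisors]
    refine ⟨?_, hd⟩
    obtain ⟨p, k, hp, hk, rfl⟩ := hpp
    rw [← Nat.prime_iff] at hp
    rw [Nat.Prime.pow_minFac hp hk.ne']
    -- If p did not divide d, then p^k, and with it b, would be coprime to d.
    by_contra hpd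
    refine hco ?_
    have h1 : IsCoprime (d : ℤ) ((p ^ k : ℕ) : ℤ) := by
      rw [Nat.isCoprime_iff_coprime]
      exact (((Nat.Prime.coprime_iff_not_dvd hp).2 hpd).pow_left k).symm
    obtain ⟨t, ht⟩ := (Int.modEq_iff_dvd.1 hmod)
    rw [sub_eq_iff_eq_add] at ht
    rw [ht, mul_comm]
    simpa [add_comm] using h1.add_mul_right_right t
  · intro n hn m hm hnm
    simp only [coe_filter, Set.mem_ofPred_eq, mem_dyadicProgression] at hn hm
    obtain ⟨⟨hn1, hn2, -⟩, p, k, hp, hk, rfl⟩ := hn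
    obtain ⟨⟨hm1, hm2, -⟩, p', j, hp', hj, rfl⟩ := hm
    rw [← Nat.prime_iff] at hp hp'
    rw [Nat.Prime.pow_minFac hp hk.ne', Nat.Prime.pow_minFac hp' hj.ne'] at hnm
    subst hnm
    have key : ∀ i j : ℕ, x / 2 ≤ ((p ^ i : ℕ) : ℝ) → ((p ^ j : ℕ) : ℝ) < x → j ≤ i := by
      intro i j h1 h2
      by_contra! hij
      have h3 : 2 * p ^ i ≤ p ^ j := by
        calc 2 * p ^ i ≤ p * p ^ i := by gcongr; exact hp.two_le
          _ = p ^ (i + 1) := by ring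
          _ ≤ p ^ j := Nat.pow_le_pow_right hp.pos hij
      have h4 : 2 * ((p ^ i : ℕ) : ℝ) ≤ ((p ^ j : ℕ) : ℝ) := by exact_mod_cast h3
      linarith
    rw [le_antisymm (key j k hm1 hn2) (key k j hn1 hm2)]

lemma sum_vonMangoldt_dyadicProgression_le (hx : 1 ≤ x) {b : ℤ} {d : ℕ} (hd : d ≠ 0)
    (hco : ¬ IsCoprime (d : ℤ) b) :
    ∑ n ∈ dyadicProgression x b d, Λ n ≤ d.divisors.card * Real.log x := by
  classical
  have h1 : ∑ n ∈ dyadicProgression x b d, Λ n =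
      ∑ n ∈ (dyadicProgression x b d).filter IsPrimePow, Λ n :=
    (sum_filter_of_ne fun n _ hne => ArithmeticFunction.vonMangoldt_ne_zero_iff.1 hne).symm
  rw [h1]
  refine (sum_le_card_nsmul _ _ (Real.log x) ?_).trans ?_
  · intro n hn
    obtain ⟨hn1, hn2, -⟩ := mem_dyadicProgression.1 (mem_filter.1 hn).1
    refine ArithmeticFunction.vonMangoldt_le_log.trans (Real.log_le_log (by linarith) hn2.le)
  · rw [nsmul_eq_mul]
    have := Real.log_nonneg hx
    refine mul_le_mul_of_nonneg_right ?_ this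
    exact_mod_cast card_primePow_dyadicProgression_le hd hco

end

/-! ### The trivial bound, the full minor arc bound and the divisor bound. -/

section

open scoped ArithmeticFunction.vonMangoldt

variable {X L α x K r : ℝ} {q : ℕ}

lemma card_nonzeroFrequencies_le (hK : 0 ≤ K) : ((nonzeroFrequencies K).card : ℝ) ≤ 2 * K := by
  have h1 := sum_nonzeroFrequencies_le K (fun _ => 1) (fun _ => zero_le_one)
  simp only [sum_const, nsmul_eq_mul, mul_one, Nat.card_Icc, Nat.add_sub_cancel] at h1
  have := Nat.floor_le hK
  linarith

lemma card_dyadicProgression_le (hx : 0 ≤ x) (b : ℤ) {d : ℕ} (hd : d ≠ 0) :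
    ((dyadicProgression x b d).card : ℝ) ≤ x / d + 1 := by
  have h1 : (dyadicProgression x b d).card ≤ (range (⌊x / d⌋₊ + 1)).card := by
    refine card_le_card_of_injOn (fun n => n / d) ?_ ?_
    · intro n hn
      rw [mem_coe, mem_dyadicProgression] at hn
      simp only [coe_range, Set.mem_Iio, Nat.lt_succ_iff]
      refine Nat.le_floor ((Nat.cast_div_le).trans ?_)
      have := hn.2.1.le
      gcongr
    · intro n hn m hm hnm
      rw [mem_coe, mem_dyadicProgression] at hn hm
      have h2 : n % d = m % d := by
        have := hn.2.2.trans hm.2.2.symm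
        exact (Int.natCast_modEq_iff.1 this)
      rw [← Nat.div_add_mod n d, ← Nat.div_add_mod m d, h2]
      simp only at hnm
      rw [hnm]
  rw [card_range] at h1
  calc ((dyadicProgression x b d).card : ℝ) ≤ ((⌊x / d⌋₊ + 1 : ℕ) : ℝ) := by exact_mod_cast h1
    _ ≤ _ := by push_cast; gcongr; exact Nat.floor_le (by positivity)

lemma norm_sum_frequencies_le {b : ℤ} {d : ℕ} {c : ℤ → ℂ} {β M : ℝ} (hK : 0 ≤ K) (hL : 0 ≤ L)
    (hc : ∀ k ∈ nonzeroFrequencies K, ‖c k‖ ≤ L) (hM : ∑ n ∈ dyadicProgression x b d, Λ n ≤ M) :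
    ‖∑ k ∈ nonzeroFrequencies K, c k * ∑ n ∈ dyadicProgression x b d,
      expChar ((α * (n : ℝ) ^ 2 + β) * (k : ℝ)) * ((Λ n : ℝ) : ℂ)‖ ≤ 2 * K * (L * M) := by
  have hM0 : 0 ≤ M := le_trans (sum_nonneg fun _ _ => ArithmeticFunction.vonMangoldt_nonneg) hM
  have hk : ∀ k ∈ nonzeroFrequencies K, ‖c k * ∑ n ∈ dyadicProgression x b d,
      expChar ((α * (n : ℝ) ^ 2 + β) * (k : ℝ)) * ((Λ n : ℝ) : ℂ)‖ ≤ L * M := by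
    intro k hk
    rw [norm_mul]
    refine mul_le_mul (hc k hk) ((norm_sum_le _ _).trans (le_trans (le_of_eq ?_) hM))
      (norm_nonneg _) hL
    refine sum_congr rfl fun n _ => ?_
    rw [norm_mul, norm_expChar, one_mul, Complex.norm_real, Real.norm_eq_abs,
      abs_of_nonneg ArithmeticFunction.vonMangoldt_nonneg]
  calc _ ≤ ∑ k ∈ nonzeroFrequencies K, L * M := (norm_sum_le _ _).trans (sum_le_sum hk)
    _ = (nonzeroFrequencies K).card * (L * M) := by rw [sum_const, nsmul_eq_mul]
    _ ≤ _ := by gcongr; exact card_nonzeroFrequencies_le hK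

/-- The trivial bound. -/
lemma DivBound.norm_WSum_le (h : DivBound X L) (hx : 1 ≤ x) (hxX : x ≤ X) (hK : 0 ≤ K) {D : ℝ}
    (hD : D ≤ x) {b : ℤ} {β : ℝ} {lam : ℕ → ℂ} {c : ℤ → ℂ} (hlam : ∀ d ∈ Icc 1 ⌊D⌋₊, ‖lam d‖ ≤ L)
    (hc : ∀ k ∈ nonzeroFrequencies K, ‖c k‖ ≤ L) :
    ‖WSum D K x b α β lam c‖ ≤ 4 * L ^ 4 * (K * x) := by
  have hL2 := h.two_le
  have hlogx : Real.log x ≤ L := by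
    have h1 := Real.log_le_log (by linarith) hxX
    have h2 := Real.log_nonneg h.one_le
    linarith [h.log_le]
  have hfl : (⌊D⌋₊ : ℝ) ≤ x := by
    rcases lt_or_ge D 0 with hD0 | hD0
    · rw [Nat.floor_of_nonpos hD0.le]; simp; linarith
    · exact (Nat.floor_le hD0).trans hD
  have hd : ∀ d ∈ Icc 1 ⌊D⌋₊, ∑ n ∈ dyadicProgression x b d, Λ n ≤ (2 * x) * L * (1 / d) := by
    intro d hd
    rw [mem_Icc] at hd
    have hd1 : (1 : ℝ) ≤ d := by exact_mod_cast hd.1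
    have hdx : (d : ℝ) ≤ x := le_trans (by exact_mod_cast hd.2) hfl
    refine (sum_le_card_nsmul _ _ L ?_).trans ?_
    · intro n hn
      obtain ⟨hn1, hn2, -⟩ := mem_dyadicProgression.1 hn
      exact ArithmeticFunction.vonMangoldt_le_log.trans
        ((Real.log_le_log (by linarith) hn2.le).trans hlogx)
    · rw [nsmul_eq_mul]
      have h1 := card_dyadicProgression_le (x := x) (by linarith) b (d := d) (by omega)
      have h2 : 1 ≤ x / d := (one_le_div (by linarith)).2 hdx
      calc _ ≤ (x / d + x / d) * L := by gcongr; linarith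
        _ = _ := by ring
  unfold WSum
  calc _ ≤ ∑ d ∈ Icc 1 ⌊D⌋₊, L * (2 * K * (L * ((2 * x) * L * (1 / d)))) := by
        refine (norm_sum_le _ _).trans (sum_le_sum fun d hd' => ?_)
        rw [norm_mul]
        exact mul_le_mul (hlam d hd') (norm_sum_frequencies_le hK (by linarith) hc (hd d hd'))
          (norm_nonneg _) (by linarith)
    _ = 4 * L ^ 3 * (K * x) * ∑ d ∈ Icc 1 ⌊D⌋₊, (1 : ℝ) / d := by
        rw [mul_sum]
        refine sum_congr rfl fun d _ => ?_
        ring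
    _ ≤ 4 * L ^ 3 * (K * x) * L := by
        gcongr
        exact h.sum_inv_le (hfl.trans hxX)
    _ = _ := by ring

/-- The factor e(βk) does not depend on n and is absorbed into c(k). The moduli are split by
coprimality to b; each non-coprime one contributes O(K) up to powers of L, and D r ≤ x makes their
total negligible. -/
lemma MinorArc.norm_WSum_le (h : MinorArc X L α q x K (r ^ 4)) (hr : 1 ≤ r)
    (hxr : r ^ 96 ≤ x) {D V : ℝ} (hD : (D * r ^ 32) ^ 2 ≤ x) (hV : 2 * r ^ 16 ≤ V)
    (hVx : V ^ 4 ≤ x)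
    {b : ℤ} {β : ℝ} {lam : ℕ → ℂ} {c : ℤ → ℂ} (hlam : ∀ d ∈ Icc 1 ⌊D⌋₊, ‖lam d‖ ≤ L)
    (hsep : ∀ d ∈ Icc 1 ⌊D⌋₊, lam d ≠ 0 → IsWellSeparable D d)
    (hc : ∀ k ∈ nonzeroFrequencies K, ‖c k‖ ≤ L) :
    ‖WSum D K x b α β lam c‖ ≤ 8602 * L ^ 9 * (K * x) / r := by
  classical
  have hx := h.one_le_x
  have hK := h.one_le_K
  have hL2 := h.divBound.two_le
  have hr0 : 0 < r := by linarith
  have hxX : x ≤ X := by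
    have h3 : x ≤ 20000 * K * x ^ 2 := by nlinarith [mul_le_mul hK hx (by linarith) (by linarith)]
    exact h3.trans h.le_X
  have hlogx : Real.log x ≤ L := by
    have h1 := Real.log_le_log (by linarith) hxX
    have h2 := Real.log_nonneg h.divBound.one_le
    linarith [h.divBound.log_le]
  have hfl : (⌊D⌋₊ : ℝ) * r ≤ x := by
    rcases lt_or_ge D 0 with hD0 | hD0
    · rw [Nat.floor_of_nonpos hD0.le]; simp; linarith
    · have h1 : (D * r) ^ 2 ≤ x := by
        refine le_trans ?_ hD
        gcongr
        exact le_self_pow₀ hr (by norm_num)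
      have h2 : D * r ≤ x := by
        by_contra! h3
        nlinarith
      refine le_trans ?_ h2
      gcongr
      exact Nat.floor_le hD0
  set lam₁ : ℕ → ℂ := fun d => if IsCoprime (d : ℤ) b then lam d else 0
  set lam₂ : ℕ → ℂ := fun d => if IsCoprime (d : ℤ) b then 0 else lam d
  have hsplit : WSum D K x b α β lam c = progressionSum x K α b ⌊D⌋₊ lam₁
      (fun k => c k * expChar (β * k)) Λ + WSum D K x b α β lam₂ c := by
    unfold WSum progressionSum
    rw [← sum_add_distrib]
    refine sum_congr rfl fun d _ => ?_
    have e : ∑ k ∈ nonzeroFrequencies K, c k * ∑ n ∈ dyadicProgression x b d,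
        expChar ((α * (n : ℝ) ^ 2 + β) * (k : ℝ)) * ((Λ n : ℝ) : ℂ) =
        ∑ k ∈ nonzeroFrequencies K, c k * expChar (β * k) * ∑ n ∈ dyadicProgression x b d,
        expChar (α * (n : ℝ) ^ 2 * (k : ℝ)) * ((Λ n : ℝ) : ℂ) := by
      refine sum_congr rfl fun k _ => ?_
      rw [mul_assoc, mul_sum (s := dyadicProgression x b d) (a := expChar (β * k))]
      congr 1
      refine sum_congr rfl fun n _ => ?_
      rw [add_mul, expChar_add]
      ring
    rw [e]
    simp only [lam₁, lam₂]
    split_ifs <;> simp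
  have h1 : ‖progressionSum x K α b ⌊D⌋₊ lam₁ (fun k => c k * expChar (β * k)) Λ‖ ≤
      8600 * L ^ 9 * (K * x) / r := by
    refine h.norm_progressionSum_le hr hxr hD hV hVx ?_ ?_ ?_ ?_
    · intro d hd
      simp only [lam₁]
      split_ifs
      · exact hlam d hd
      · rw [norm_zero]; linarith
    · intro d hd hne
      refine hsep d hd fun h0 => hne ?_
      simp [lam₁, h0]
    · intro d hd hne
      by_contra hco
      exact hne (by simp [lam₁, hco])
    · intro k hk
      rw [norm_mul, norm_expChar, mul_one]
      exact hc k hk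
  have h2 : ‖WSum D K x b α β lam₂ c‖ ≤ 2 * L ^ 9 * (K * x) / r := by
    unfold WSum
    calc _ ≤ ∑ d ∈ Icc 1 ⌊D⌋₊, L * (2 * K * (L * (L * L))) := by
          refine (norm_sum_le _ _).trans (sum_le_sum fun d hd => ?_)
          simp only [lam₂]
          split_ifs with hco
          · rw [zero_mul, norm_zero]; positivity
          · rw [norm_mul]
            have hd' := mem_Icc.1 hd
            have hdx : (d : ℝ) ≤ X := by
              refine le_trans ?_ hxX
              refine le_trans ?_ hfl
              have : (d : ℝ) ≤ (⌊D⌋₊ : ℝ) := by exact_mod_cast hd'.2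
              have : (0 : ℝ) ≤ (⌊D⌋₊ : ℝ) := by positivity
              nlinarith
            refine mul_le_mul (hlam d hd) (norm_sum_frequencies_le (by linarith) (by linarith) hc
              ((sum_vonMangoldt_dyadicProgression_le hx (by omega) hco).trans ?_))
              (norm_nonneg _) (by linarith)
            have := Real.log_nonneg hx
            gcongr
            exact h.divBound.card_le d (by omega) hdx
      _ = 2 * L ^ 4 * K * (⌊D⌋₊ : ℝ) := by
          rw [sum_const, nsmul_eq_mul, Nat.card_Icc, Nat.add_sub_cancel]; ring
      _ ≤ 2 * L ^ 9 * K * (x / r) := by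
          gcongr
          · linarith
          · norm_num
          · rwa [le_div_iff₀ hr0]
      _ = _ := by ring
  rw [hsplit]
  refine (norm_add_le _ _).trans ((add_le_add h1 h2).trans (le_of_eq ?_))
  ring

/-- The divisor bound. -/
lemma exists_card_divisors_le {η : ℝ} (hη : 0 < η) :
    ∃ C : ℝ, 1 ≤ C ∧ ∀ n : ℕ, n ≠ 0 → (n.divisors.card : ℝ) ≤ C * (n : ℝ) ^ η := by
  -- Primes p ≥ P satisfy p^η ≥ 2, so a + 1 ≤ 2^a ≤ p^{aη} without loss. Each of the fewer than P
  -- smaller primes costs at most the factor M.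
  set P : ℕ := ⌈(2 : ℝ) ^ (1 / η)⌉₊
  set M : ℝ := 1 + 1 / (η * Real.log 2)
  have hlog := Real.log_pos (one_lt_two : (1 : ℝ) < 2)
  have hM : 1 ≤ M := by
    have : 0 ≤ 1 / (η * Real.log 2) := by positivity
    simp only [M]
    linarith
  refine ⟨M ^ P, one_le_pow₀ hM, fun n hn => ?_⟩
  have hsmall : ∀ p a : ℕ, p.Prime → ((a : ℝ) + 1) ≤ M * ((p : ℝ) ^ a) ^ η := by
    intro p a hp
    have hp2 : (2 : ℝ) ≤ p := by exact_mod_cast hp.two_le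
    have h1 : ((2 : ℝ) ^ a) ^ η ≤ ((p : ℝ) ^ a) ^ η := by gcongr
    have h2 : (a : ℝ) * (η * Real.log 2) + 1 ≤ ((2 : ℝ) ^ a) ^ η := by
      rw [Real.rpow_def_of_pos (by positivity), Real.log_pow]
      refine le_trans (le_of_eq ?_) (Real.add_one_le_exp _)
      ring
    calc (a : ℝ) + 1 ≤ M * (a * (η * Real.log 2) + 1) := by
          have : M * (a * (η * Real.log 2) + 1) =
              a * (η * Real.log 2) + 1 + a + 1 / (η * Real.log 2) := by
            simp only [M]; field_simp; ring
          rw [this]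
          have h3 : 0 ≤ (a : ℝ) * (η * Real.log 2) := by positivity
          have h4 : 0 ≤ 1 / (η * Real.log 2) := by positivity
          linarith
      _ ≤ _ := by gcongr; exact h2.trans h1
  have hlarge : ∀ p a : ℕ, P ≤ p → ((a : ℝ) + 1) ≤ ((p : ℝ) ^ a) ^ η := by
    intro p a hp
    have h1 : (2 : ℝ) ^ (1 / η) ≤ p := (Nat.le_ceil _).trans (by exact_mod_cast hp)
    have h2 : (2 : ℝ) ≤ (p : ℝ) ^ η := by
      calc (2 : ℝ) = ((2 : ℝ) ^ (1 / η)) ^ η := by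
            rw [← Real.rpow_mul zero_le_two, one_div_mul_cancel hη.ne', Real.rpow_one]
        _ ≤ _ := by gcongr
    calc (a : ℝ) + 1 ≤ 2 ^ a := by exact_mod_cast Nat.lt_two_pow_self
      _ ≤ ((p : ℝ) ^ η) ^ a := by gcongr
      _ = _ := by
          rw [← Real.rpow_natCast, ← Real.rpow_natCast, ← Real.rpow_mul (by positivity),
            ← Real.rpow_mul (by positivity), mul_comm]
  rw [Nat.card_divisors hn]
  have hprod : (n : ℝ) ^ η = ∏ p ∈ n.primeFactors, ((p : ℝ) ^ n.factorization p) ^ η := by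
    rw [Real.finsetProd_rpow _ _ (fun p _ => by positivity)]
    congr 1
    conv_lhs => rw [← Nat.prod_factorization_pow_eq_self hn]
    rw [Finsupp.prod]
    push_cast
    rfl
  rw [hprod]
  push_cast
  calc ∏ p ∈ n.primeFactors, ((n.factorization p : ℝ) + 1) ≤
      ∏ p ∈ n.primeFactors, (if p < P then M else 1) * ((p : ℝ) ^ n.factorization p) ^ η := by
        refine prod_le_prod (fun p _ => by positivity) fun p hp => ?_
        split_ifs with h
        · exact hsmall p _ (Nat.prime_of_mem_primeFactors hp)
        · rw [one_mul]; exact hlarge p _ (not_lt.1 h)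
    _ = M ^ (n.primeFactors.filter (· < P)).card *
        ∏ p ∈ n.primeFactors, ((p : ℝ) ^ n.factorization p) ^ η := by
        rw [prod_mul_distrib, prod_ite, prod_const, prod_const_one, mul_one]
    _ ≤ _ := by
        gcongr
        calc _ ≤ (range P).card := card_le_card fun p hp => by
              rw [mem_range]; exact (mem_filter.1 hp).2
          _ = P := card_range P

end

/-! ### Parameters and assembly. -/

section

open Finset Filter

/-- An admissible `L = C₀ x^η` for the range `X = x⁴`. -/
lemma exists_divBound {η : ℝ} (hη : 0 < η) (A B : ℝ) :
    ∃ C : ℝ, 0 ≤ C ∧ ∀ x : ℝ, 1 ≤ x → DivBound (x ^ 4) (C * x ^ (4 * η)) ∧ B ≤ C * x ^ (4 * η) ∧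
      ∀ n : ℕ, n ≠ 0 → (n : ℝ) ≤ x ^ 4 → A * (n.divisors.card : ℝ) ≤ C * x ^ (4 * η) := by
  obtain ⟨C₁, hC₁, hdiv⟩ := exists_card_divisors_le hη
  have hη' : 0 ≤ 1 / η := by positivity
  refine ⟨2 * (1 + 1 / η) + C₁ * (1 + |A|) + |B|, by positivity, fun x hx => ?_⟩
  set y := x ^ (4 * η)
  have hy : 1 ≤ y := Real.one_le_rpow hx (by positivity)
  have hxy : (x ^ 4) ^ η = y := by
    rw [← Real.rpow_natCast, ← Real.rpow_mul (by linarith)]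
    norm_num [y]
  have hx4 : 1 ≤ x ^ 4 := one_le_pow₀ hx
  have hlog : Real.log (x ^ 4) ≤ 1 / η * y := by
    have := Real.log_le_rpow_div (by linarith : 0 ≤ x ^ 4) hη
    rw [hxy] at this
    calc _ ≤ _ := this
      _ = _ := by ring
  have hτ : ∀ n : ℕ, n ≠ 0 → (n : ℝ) ≤ x ^ 4 → (n.divisors.card : ℝ) ≤ C₁ * y := by
    intro n hn hnx
    refine (hdiv n hn).trans ?_
    rw [← hxy]
    gcongr
  have e1 : 0 ≤ C₁ * (1 + |A|) * y := by positivity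
  have e2 : 0 ≤ |B| * y := by positivity
  have e3 : 0 ≤ 2 * (1 + 1 / η) * y := by positivity
  refine ⟨⟨hx4, ?_, fun n hn hnx => (hτ n hn hnx).trans ?_⟩, ?_, fun n hn hnx => ?_⟩
  · nlinarith
  · have : 0 ≤ C₁ * |A| * y := by positivity
    nlinarith
  · have : |B| * 1 ≤ |B| * y := by gcongr
    have := le_abs_self B
    nlinarith
  · have h1 : A * (n.divisors.card : ℝ) ≤ |A| * (C₁ * y) := by
      calc _ ≤ |A| * (n.divisors.card : ℝ) := by gcongr; exact le_abs_self A
        _ ≤ _ := by gcongr; exact hτ n hn hnx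
    have : 0 ≤ C₁ * y := by positivity
    nlinarith

/-- The last inequality is 2 r¹⁶ ≤ V for r = x^{ρ/32} and V = x^{1/4}; it holds for large x because
ρ < 1/2. -/
lemma eventually_parameters {θ : ℝ} (hθ : 0 < θ) (hθ' : θ < 1 / 200) {ρ : ℝ} (hρ : ρ < 11 / 54) :
    ∀ᶠ x : ℝ in atTop, 20000 ≤ x ∧ 1 ≤ KParam θ x ∧ KParam θ x ≤ x ∧
      2 * x ^ (ρ / 2) ≤ x ^ (1 / 4 : ℝ) := by
  have h1 : ∀ᶠ x : ℝ in atTop, Real.log x ^ (2 : ℝ) ≤ x ^ (1 / 2 : ℝ) := by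
    have := (isLittleO_log_rpow_rpow_atTop 2 (by norm_num : (0 : ℝ) < 1 / 2)).bound zero_lt_one
    filter_upwards [this, eventually_ge_atTop 1] with x hx hx1
    rw [one_mul, Real.norm_of_nonneg (Real.rpow_nonneg (Real.log_nonneg hx1) _),
      Real.norm_of_nonneg (by positivity)] at hx
    exact hx
  have h2 : ∀ᶠ x : ℝ in atTop, (2 : ℝ) ≤ x ^ (1 / 4 - ρ / 2) :=
    (tendsto_rpow_atTop (by linarith : 0 < 1 / 4 - ρ / 2)).eventually_ge_atTop 2
  filter_upwards [h1, h2, eventually_ge_atTop 20000, eventually_ge_atTop (Real.exp 1)]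
    with x hx1 hx2 hx3 hx4
  have hx0 : 0 < x := by linarith
  have hlog : 1 ≤ Real.log x := (Real.le_log_iff_exp_le hx0).2 hx4
  have hK : KParam θ x = x ^ θ * Real.log x ^ 2 := by
    unfold KParam deltaParam
    rw [Real.rpow_neg hx0.le, inv_inv]
  have hxθ : 1 ≤ x ^ θ := Real.one_le_rpow (by linarith) hθ.le
  refine ⟨hx3, ?_, ?_, ?_⟩
  · rw [hK]
    exact one_le_mul_of_one_le_of_one_le hxθ (one_le_pow₀ hlog)
  · rw [hK]
    have hx1' : Real.log x ^ 2 ≤ x ^ (1 / 2 : ℝ) := by exact_mod_cast hx1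
    calc x ^ θ * Real.log x ^ 2 ≤ x ^ (1 / 2 : ℝ) * x ^ (1 / 2 : ℝ) := by
          gcongr <;> linarith
      _ = x := by rw [← Real.rpow_add hx0]; norm_num
  · calc 2 * x ^ (ρ / 2) ≤ x ^ (1 / 4 - ρ / 2) * x ^ (ρ / 2) := by gcongr
      _ = x ^ (1 / 4 : ℝ) := by rw [← Real.rpow_add hx0]; congr 1; ring

lemma norm_le_of_mem_nonzeroFrequencies {K B : ℝ} {c : ℤ → ℂ}
    (hc : ∀ k : ℤ, k ≠ 0 → |(k : ℝ)| ≤ K → ‖c k‖ ≤ B) : ∀ k ∈ nonzeroFrequencies K, ‖c k‖ ≤ B := by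
  intro k hk
  rw [nonzeroFrequencies, mem_filter, mem_Icc] at hk
  refine hc k hk.2 (abs_le.2 ⟨?_, ?_⟩)
  · have h1 : (-⌊K⌋ : ℝ) ≤ k := by exact_mod_cast hk.1.1
    have := Int.floor_le K
    linarith
  · have h1 : (k : ℝ) ≤ ⌊K⌋ := by exact_mod_cast hk.1.2
    exact h1.trans (Int.floor_le K)

/-- If `q` lies outside the range of the minor arc estimate, then one of the last two terms of the
bound exceeds the trivial bound. -/
lemma le_add_of_not_minor {x K r q : ℝ} (hx : 1 ≤ x) (hK : 1 ≤ K) (hr : 1 ≤ r) (hq : 1 ≤ q)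
    (h : q < r ^ 48 ∨ K * x ^ 2 < r ^ 48 * q) :
    x * K ≤ x * (r ^ 32) ^ (1 / 2 : ℝ) * K / q ^ (1 / 4 : ℝ) +
      x ^ (1 / 2 : ℝ) * (r ^ 32) ^ (1 / 2 : ℝ) * K ^ (3 / 4 : ℝ) * q ^ (1 / 4 : ℝ) := by
  have hr0 : 0 < r := by linarith
  have hx0 : 0 < x := by linarith
  have hK0 : 0 < K := by linarith
  have hq0 : 0 < q := by linarith
  have e1 : (r ^ 32) ^ (1 / 2 : ℝ) = r ^ 16 := by
    rw [← Real.rpow_natCast, ← Real.rpow_natCast, ← Real.rpow_mul hr0.le]; norm_num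
  have e2 : (r ^ 48) ^ (1 / 4 : ℝ) = r ^ 12 := by
    rw [← Real.rpow_natCast, ← Real.rpow_natCast, ← Real.rpow_mul hr0.le]; norm_num
  -- The threshold r⁴⁸ has fourth root r¹², below the r¹⁶ = Δ^{1/2} present in both terms.
  have e3 : r ^ 12 ≤ r ^ 16 := pow_le_pow_right₀ hr (by norm_num)
  have hq4 : 0 < q ^ (1 / 4 : ℝ) := by positivity
  rw [e1]
  rcases h with h | h
  · have h1 : q ^ (1 / 4 : ℝ) ≤ r ^ 12 := by rw [← e2]; gcongr
    have h2 : x * K ≤ x * r ^ 16 * K / q ^ (1 / 4 : ℝ) := by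
      rw [le_div_iff₀ hq4]
      calc x * K * q ^ (1 / 4 : ℝ) ≤ x * K * r ^ 16 := by gcongr; exact h1.trans e3
        _ = _ := by ring
    have : 0 ≤ x ^ (1 / 2 : ℝ) * r ^ 16 * K ^ (3 / 4 : ℝ) * q ^ (1 / 4 : ℝ) := by positivity
    linarith
  · have h1 : K ^ (1 / 4 : ℝ) * x ^ (1 / 2 : ℝ) ≤ r ^ 16 * q ^ (1 / 4 : ℝ) := by
      calc K ^ (1 / 4 : ℝ) * x ^ (1 / 2 : ℝ) = (K * x ^ 2) ^ (1 / 4 : ℝ) := by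
            rw [Real.mul_rpow hK0.le (by positivity), ← Real.rpow_natCast x, ← Real.rpow_mul hx0.le]
            norm_num
        _ ≤ (r ^ 48 * q) ^ (1 / 4 : ℝ) := by gcongr
        _ = r ^ 12 * q ^ (1 / 4 : ℝ) := by rw [Real.mul_rpow (by positivity) hq0.le, e2]
        _ ≤ _ := by gcongr
    have h2 : x * K ≤ x ^ (1 / 2 : ℝ) * r ^ 16 * K ^ (3 / 4 : ℝ) * q ^ (1 / 4 : ℝ) := by
      calc x * K = x ^ (1 / 2 : ℝ) * K ^ (3 / 4 : ℝ) * (K ^ (1 / 4 : ℝ) * x ^ (1 / 2 : ℝ)) := by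
            have a1 : x ^ (1 / 2 : ℝ) * x ^ (1 / 2 : ℝ) = x := by
              rw [← Real.rpow_add hx0]; norm_num
            have a2 : K ^ (3 / 4 : ℝ) * K ^ (1 / 4 : ℝ) = K := by
              rw [← Real.rpow_add hK0]; norm_num
            calc x * K = (x ^ (1 / 2 : ℝ) * x ^ (1 / 2 : ℝ)) *
                  (K ^ (3 / 4 : ℝ) * K ^ (1 / 4 : ℝ)) := by rw [a1, a2]
              _ = _ := by ring
        _ ≤ x ^ (1 / 2 : ℝ) * K ^ (3 / 4 : ℝ) * (r ^ 16 * q ^ (1 / 4 : ℝ)) := by gcongr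
        _ = _ := by ring
    have : 0 ≤ x * r ^ 16 * K / q ^ (1 / 4 : ℝ) := by positivity
    linarith

end

theorem theorem1 (θ ρ : ℝ) (hθ : 0 < θ) (hθ' : θ < 1 / 200) (hρ : 32 * θ < ρ)
    (hρθ : ρ + 4 * θ < 11 / 54) (A B ε : ℝ) (hε : 0 < ε) :
    ∃ C x₀ : ℝ, ∀ x : ℝ, x₀ ≤ x → ∀ (α β : ℝ) (a b : ℤ) (q : ℕ) (lam : ℕ → ℂ) (c : ℤ → ℂ),
      Irrational α → 1 ≤ q → IsCoprime a (q : ℤ) →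
      |α - (a : ℝ) / (q : ℝ)| < 1 / (q : ℝ) ^ 2 →
      (∀ d : ℕ, 1 ≤ d → (d : ℝ) ≤ DParam θ ρ x → ‖lam d‖ ≤ A * (d.divisors.card : ℝ)) →
      (∀ d : ℕ, 1 ≤ d → (d : ℝ) ≤ DParam θ ρ x → lam d ≠ 0 →
        IsWellSeparable (DParam θ ρ x) d) →
      (∀ k : ℤ, k ≠ 0 → |(k : ℝ)| ≤ KParam θ x → ‖c k‖ ≤ B) →
      ‖WSum (DParam θ ρ x) (KParam θ x) x b α β lam c‖ ≤
        C * x ^ ε *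
          (x * KParam θ x / DeltaParam ρ x ^ (1 / 32 : ℝ)
            + x * KParam θ x / (q : ℝ) ^ (1 / 32 : ℝ)
            + x ^ (15 / 16 : ℝ) * KParam θ x ^ (31 / 32 : ℝ) * (q : ℝ) ^ (1 / 32 : ℝ)
            + x * DeltaParam ρ x ^ (1 / 2 : ℝ) * KParam θ x / (q : ℝ) ^ (1 / 4 : ℝ)
            + x ^ (1 / 2 : ℝ) * DeltaParam ρ x ^ (1 / 2 : ℝ) * KParam θ x ^ (3 / 4 : ℝ)
              * (q : ℝ) ^ (1 / 4 : ℝ)) := by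
  have hρ0 : 0 < ρ := by linarith
  -- The bounds contain L⁹ with L = C₀ x^{4η}, so η = ε/36 yields exactly x^ε.
  obtain ⟨C₀, hC₀, hbound⟩ := exists_divBound (by positivity : 0 < ε / 36) A B
  obtain ⟨x₀, hx₀⟩ := Filter.eventually_atTop.1
    (eventually_parameters hθ hθ' (by linarith : ρ < 11 / 54))
  refine ⟨8602 * C₀ ^ 9, x₀, fun x hxx α β a b q lam c _ hq hco happ hlam hsep hc => ?_⟩
  obtain ⟨hx, hK, hKx, hV⟩ := hx₀ x hxx
  have hx1 : 1 ≤ x := by linarith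
  have hx0 : 0 < x := by linarith
  obtain ⟨hdiv, hBL, hAL⟩ := hbound x hx1
  set K := KParam θ x
  set D := DParam θ ρ x with hD
  set L := C₀ * x ^ (4 * (ε / 36))
  set r := x ^ (ρ / 32) with hr_def
  have hr : 1 ≤ r := Real.one_le_rpow hx1 (by positivity)
  have hr0 : 0 < r := by linarith
  have hL2 := hdiv.two_le
  have hrpow : ∀ n : ℕ, r ^ n = x ^ (ρ / 32 * n) := fun n => by
    rw [hr_def, ← Real.rpow_natCast, ← Real.rpow_mul hx0.le]
  have hΔ : DeltaParam ρ x = r ^ 32 := by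
    rw [hrpow, DeltaParam]; congr 1; push_cast; ring
  -- r⁹⁶ = x^{3ρ}, and 3ρ < 33/54 < 1.
  have hrx : ∀ n : ℕ, n ≤ 96 → r ^ n ≤ x := fun n hn => by
    have hn' : (n : ℝ) ≤ 96 := by exact_mod_cast hn
    rw [hrpow]
    calc x ^ (ρ / 32 * n) ≤ x ^ (1 : ℝ) := Real.rpow_le_rpow_of_exponent_le hx1 (by nlinarith)
      _ = x := Real.rpow_one x
  have hDr : D * r ^ 32 = x ^ (1 / 2 : ℝ) / K ^ 4 := by
    rw [hD, DParam, hΔ]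
    change x ^ (1 / 2 : ℝ) / (r ^ 32 * K ^ 4) * r ^ 32 = _
    have : K ≠ 0 := by linarith
    field_simp
  have hDsq : (D * r ^ 32) ^ 2 ≤ x := by
    have h1 : x ^ (1 / 2 : ℝ) / K ^ 4 ≤ x ^ (1 / 2 : ℝ) :=
      div_le_self (by positivity) (one_le_pow₀ hK)
    calc (D * r ^ 32) ^ 2 ≤ (x ^ (1 / 2 : ℝ)) ^ 2 := by rw [hDr]; gcongr
      _ = x := by rw [← Real.rpow_natCast, ← Real.rpow_mul hx0.le]; norm_num
  have hD0 : 0 ≤ D := by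
    rw [hD, DParam, hΔ]; positivity
  have hDx : D ≤ x := by
    have h1 : D ^ 2 ≤ x := by
      refine le_trans ?_ hDsq
      gcongr
      exact le_mul_of_one_le_right hD0 (one_le_pow₀ hr)
    nlinarith
  have hxX : x ≤ x ^ 4 := le_self_pow₀ hx1 (by norm_num)
  have hmem : ∀ d ∈ Finset.Icc 1 ⌊D⌋₊, 1 ≤ d ∧ (d : ℝ) ≤ D := by
    intro d hd
    rw [Finset.mem_Icc] at hd
    exact ⟨hd.1, (Nat.le_floor_iff hD0).1 hd.2⟩
  have hlamL : ∀ d ∈ Finset.Icc 1 ⌊D⌋₊, ‖lam d‖ ≤ L := fun d hd => by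
    obtain ⟨h1, h2⟩ := hmem d hd
    exact (hlam d h1 h2).trans (hAL d (by omega) (h2.trans (hDx.trans hxX)))
  have hcL : ∀ k ∈ nonzeroFrequencies K, ‖c k‖ ≤ L := fun k hk =>
    (norm_le_of_mem_nonzeroFrequencies hc k hk).trans hBL
  have hL9 : L ^ 9 = C₀ ^ 9 * x ^ ε := by
    rw [mul_pow, ← Real.rpow_natCast (x ^ _), ← Real.rpow_mul hx0.le]
    congr 2
    push_cast
    ring
  have hq1 : (1 : ℝ) ≤ q := by exact_mod_cast hq
  have hq0 : (0 : ℝ) < q := by linarith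
  have hΔr : DeltaParam ρ x ^ (1 / 32 : ℝ) = r := by
    rw [hΔ, ← Real.rpow_natCast, ← Real.rpow_mul hr0.le]
    norm_num
  rw [hΔr, hΔ, mul_assoc 8602, ← hL9]
  have t1 : 0 ≤ x * K / r := by positivity
  have t2 : 0 ≤ x * K / (q : ℝ) ^ (1 / 32 : ℝ) := by positivity
  have t3 : 0 ≤ x ^ (15 / 16 : ℝ) * K ^ (31 / 32 : ℝ) * (q : ℝ) ^ (1 / 32 : ℝ) := by positivity
  have t4 : 0 ≤ x * (r ^ 32) ^ (1 / 2 : ℝ) * K / (q : ℝ) ^ (1 / 4 : ℝ) := by positivity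
  have t5 : 0 ≤ x ^ (1 / 2 : ℝ) * (r ^ 32) ^ (1 / 2 : ℝ) * K ^ (3 / 4 : ℝ) *
      (q : ℝ) ^ (1 / 4 : ℝ) := by positivity
  have hL9' : 0 ≤ 8602 * L ^ 9 := by positivity
  -- Off the minor arc the last two terms dominate the trivial bound; on it the first term alone
  -- suffices.
  by_cases hminor : (q : ℝ) < r ^ 48 ∨ K * x ^ 2 < r ^ 48 * q
  · have h1 := hdiv.norm_WSum_le (α := α) hx1 hxX (by linarith : 0 ≤ K) hDx (b := b) (β := β)
      hlamL hcL
    have h2 := le_add_of_not_minor hx1 hK hr hq1 hminor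
    calc _ ≤ _ := h1
      _ ≤ 8602 * L ^ 9 * (x * K) := by
          rw [mul_comm K x]
          gcongr
          · norm_num
          · linarith
          · norm_num
      _ ≤ _ := by
          gcongr
          linarith
  · rw [not_or, not_lt, not_lt] at hminor
    have e : ((r ^ 4) ^ 4) ^ 3 = r ^ 48 := by ring
    have hq' : (q : ℝ) ≤ K * x ^ 2 := by
      refine le_trans ?_ hminor.2
      exact le_mul_of_one_le_left hq0.le (one_le_pow₀ hr)
    -- K ≤ x and 20000 ≤ x justify the choice X = x⁴.
    have hX : 20000 * K * x ^ 2 ≤ x ^ 4 := by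
      calc 20000 * K * x ^ 2 ≤ x * x * x ^ 2 := by gcongr
        _ = x ^ 4 := by ring
    have hm : MinorArc (x ^ 4) L α q x K (r ^ 4) :=
      { divBound := hdiv
        approx := ⟨hq, a, hco, happ⟩
        q_le := by
          have : 0 ≤ K * x ^ 2 := by positivity
          linarith
        one_le_K := hK
        one_le_p := one_le_pow₀ hr
        le_q := by rw [e]; exact hminor.1
        q_mul_le := by rw [e]; exact hminor.2
        le_X := hX
        p_le := by rw [← pow_mul]; exact hrx _ (by norm_num) }
    have h1 := hm.norm_WSum_le hr (hrx 96 le_rfl) hDsq (V := x ^ (1 / 4 : ℝ)) (b := b) (β := β)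
      (lam := lam) (c := c) ?_ ?_ hlamL
      (fun d hd hne => hsep d (hmem d hd).1 (hmem d hd).2 hne) hcL
    · calc _ ≤ _ := h1
        _ = 8602 * L ^ 9 * (x * K / r) := by ring
        _ ≤ _ := by
            gcongr
            linarith
    · rw [hrpow]
      refine le_trans (le_of_eq ?_) hV
      congr 2
      push_cast
      ring
    · rw [← Real.rpow_natCast, ← Real.rpow_mul hx0.le]
      norm_num
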